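/- **Notation.** On $\mathbb R^4$ let $\langle y\rangle=(1+|y|^2)^{1/2}$ and $D=-i\nabla$, so that $m(D)$ is the Fourier multiplier with symbol $m(\xi)$. Put $\|u\|_{H^s}=\|\langle D\rangle^s u\|_{L^2}$, $\|u\|_{\dot H^s}=\||D|^su\|_{L^2}=\||\xi|^s\hat u\|_{L^2}$ (up to the usual normalization of the Fourier transform; only the values of $\hat u$ on $\mathbb R^4\setminus\{0\}$ matter) and $\|u\|_{W^{s,\infty}}=\|\langle D\rangle^su\|_{L^\infty}$. For a function $F$ on $\mathbb R^4$, $xF=(x_jF)_j$ and $x^2F=(x_ix_jF)_{i,j}$, with the Euclidean norm taken over the components. Let $T>0$ and let $A_\mu$ ($\mu=0,\dots,4$) be real fields on $[0,T]\times\mathbb R^4$ such that $t\mapsto A_\mu(t)\in L^2(\mathbb R^4)$ is differentiable on $[0,T]$ and $|D|^{-1}\partial_tA_\mu(t)\in L^2(\mathbb R^4)$ for all $t\in[0,T]$. For $\kappa\in\{+,-\}$ define the half waves and their profiles $$A_{\mu,\kappa}(t)=\tfrac12\big(A_\mu(t)+\kappa|D|^{-1}(-i\partial_t)A_\mu(t)\big),\qquad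 F_{\mu,\kappa}(t)=e^{-\kappa it|D|}A_{\mu,\kappa}(t).$$ Let $n,\beta,\delta$ be real numbers with $$n>2,\qquad 0<\beta<\delta,\qquad \frac{56}{n-2}\le\beta,\qquad \beta+\delta\le\frac14,$$ and set $$\|A_\mu\|_{\Sigma_T^{\mathbf M}}=\sum_{\kappa\in\{+,-\}}\ \sup_{t\in[0,T]}\Big[\langle t\rangle^{-\frac\beta2-\frac\delta2}\|A_{\mu,\kappa}(t)\|_{H^n}+\langle t\rangle^{-\frac\beta2-\frac\delta2}\|xF_{\mu,\kappa}(t)\|_{\dot H^1}+\langle t\rangle^{-\frac18}\|x^2F_{\mu,\kappa}(t)\|_{\dot H^2}\Big].$$ **Proposition 2.5.** For all $n>2$ and $K>0$ there is a constant $C>0$, depending only on $n$ and $K$, such that the following holds for all $\beta,\delta$ as above, all $\varepsilon_1>0$, all $T>0$, all fields $A_\mu$ as above and every $\mu\in\{0,\dots,4\}$. If $A_\mu$ satisfies the a priori bound $$\|A_\mu\|_{\Sigma_T^{\mathbf M}}\le K\varepsilon_1,$$ then $$\|A_{\mu,\kappa}(t)\|_{W^{s,\infty}}\le C\,\langle t\rangle^{-\frac32}\,\varepsilon_1\qquad\text{for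 } \kappa\in\{+,-\},\ 0\le s\le20,\ t\in[0,T].$$ -/

import Mathlib

open MeasureTheory FourierTransform TemperedDistribution
open scoped ENNReal SchwartzMap

noncomputable section

namespace MaxwellDecay

/-- The space `ℝ⁴` with its Euclidean norm. -/
abbrev E4 : Type := EuclideanSpace ℝ (Fin 4)

/-- Complex-valued `L²(ℝ⁴)`. -/
abbrev L2C : Type := Lp ℂ 2 (volume : Measure E4)

/-- Real-valued `L²(ℝ⁴)`. -/
abbrev L2R : Type := Lp ℝ 2 (volume : Measure E4)

/-- A real `L²` function regarded as a complex one. -/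
def toComplex (f : L2R) : L2C := Complex.ofRealCLM.compLp f

/-- The Japanese bracket `⟨t⟩ = (1 + t²)^{1/2}`. -/
def bracket (t : ℝ) : ℝ := Real.sqrt (1 + t ^ 2)

/-! ### Fourier multipliers

Mathlib's Fourier transform is `∫ e^{-2πi x·ξ} f(x) dx`, so that `D = -i∇` corresponds to the
multiplication by `2πξ`, and `m(D)` to the multiplication by `m(2πξ)`. -/

/-- The `L²` function `f` lies in the domain of `m(D)`: the function `m f̂` is in `L²`. -/
def InMultiplierDomain (m : E4 → ℂ) (f : L2C) : Prop :=
  MemLp (fun ξ : E4 => m ((2 * Real.pi) • ξ) * (𝓕 f : L2C) ξ) 2 volume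

open Classical in
/-- The Fourier multiplier `m(D) f` of an `L²` function in the domain of `m(D)`
(and `0` outside the domain). -/
def multiplier (m : E4 → ℂ) (f : L2C) : L2C :=
  if h : InMultiplierDomain m f then 𝓕⁻ (MemLp.toLp _ h) else 0

/-- The symbol `|ξ|⁻¹` of `|D|⁻¹`. -/
def invAbs (ξ : E4) : ℂ := ((‖ξ‖⁻¹ : ℝ) : ℂ)

/-- The symbol of the half-wave propagator `e^{iτ|D|}`. -/
def halfWaveSymbol (τ : ℝ) (ξ : E4) : ℂ := Complex.exp (Complex.I * τ * ‖ξ‖)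

/-! ### Sobolev norms of tempered distributions -/

/-- The operator `⟨D⟩^s` on tempered distributions. -/
def bracketD (s : ℝ) : 𝓢'(E4, ℂ) →L[ℂ] 𝓢'(E4, ℂ) :=
  fourierMultiplierCLM ℂ
    (fun ξ : E4 => (((1 + ‖(2 * Real.pi) • ξ‖ ^ 2) ^ (s / 2) : ℝ) : ℂ))

/-- The norm `‖⟨D⟩^s u‖_{L^p}`, equal to `∞` if `⟨D⟩^s u` is not an `L^p` function. (The function
representing `⟨D⟩^s u` is unique, so the infimum is over at most one element.) -/
def sobolevNorm (s : ℝ) (p : ℝ≥0∞) [Fact (1 ≤ p)] (u : 𝓢'(E4, ℂ)) : ℝ≥0∞ :=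
  ⨅ (g : Lp ℂ p (volume : Measure E4)) (_ : bracketD s u = (g : 𝓢'(E4, ℂ))), ‖g‖ₑ

/-- The Fourier transform of `u` is, away from the origin, the locally integrable function `g`. -/
def FourierEqOffZero (u : 𝓢'(E4, ℂ)) (g : E4 → ℂ) : Prop :=
  LocallyIntegrableOn g {0}ᶜ volume ∧
    ∀ φ : 𝓢(E4, ℂ), HasCompactSupport φ → (0 : E4) ∉ tsupport φ →
      (𝓕 u : 𝓢'(E4, ℂ)) φ = ∫ ξ, φ ξ * g ξ

/-- The homogeneous norm `‖|D|^s u‖_{L²} = ‖|ξ|^s û‖_{L²}`, where only the values of `û` away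
from `ξ = 0` count; it is `∞` if `û` is not a function there. (The function is unique up to null
sets, so the infimum is over at most one element.) -/
def homSobolevNorm (s : ℝ) (u : 𝓢'(E4, ℂ)) : ℝ≥0∞ :=
  ⨅ (g : E4 → ℂ) (_ : FourierEqOffZero u g),
    eLpNorm (fun ξ : E4 => (((2 * Real.pi * ‖ξ‖) ^ s : ℝ) : ℂ) * g ξ) 2 volume

/-- The product of a tempered distribution with the coordinate function `x_j`. -/
def coordMul (j : Fin 4) : 𝓢'(E4, ℂ) →L[ℂ] 𝓢'(E4, ℂ) :=
  smulLeftCLM ℂ (fun x : E4 => ((x j : ℝ) : ℂ))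

/-- `‖x F‖_{Ḣ^1}`, where `x F` is the vector `(x_j F)_j`. -/
def firstMoment (F : L2C) : ℝ≥0∞ :=
  (∑ j : Fin 4, homSobolevNorm 1 (coordMul j (F : 𝓢'(E4, ℂ))) ^ 2) ^ (1 / 2 : ℝ)

/-- `‖x² F‖_{Ḣ^2}`, where `x² F` is the tensor `(x_i x_j F)_{i,j}`. -/
def secondMoment (F : L2C) : ℝ≥0∞ :=
  (∑ i : Fin 4, ∑ j : Fin 4,
    homSobolevNorm 2 (coordMul i (coordMul j (F : 𝓢'(E4, ℂ)))) ^ 2) ^ (1 / 2 : ℝ)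

/-! ### Half waves, profiles and the norm of the a priori assumption

Below `a : ℝ → L²(ℝ⁴; ℝ)` is one component `A_μ` of the gauge field, as a curve on `[0, T]`. -/

/-- `∂_t A_μ(t)`, the derivative in `L²` along `[0, T]` (one-sided at the end points). -/
def timeDeriv (T : ℝ) (a : ℝ → L2R) (t : ℝ) : L2R := derivWithin a (Set.Icc 0 T) t

/-- `A_μ` is differentiable in time on `[0, T]` with values in `L²`, and `|D|⁻¹ ∂_t A_μ(t)` is in
`L²`: this is what is needed for the half waves of `A_μ` to be defined on `[0, T]`. -/
def HasHalfWaves (T : ℝ) (a : ℝ → L2R) : Prop :=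
  DifferentiableOn ℝ a (Set.Icc 0 T) ∧
    ∀ t ∈ Set.Icc 0 T, InMultiplierDomain invAbs (toComplex (timeDeriv T a t))

/-- The half wave `A_{μ,κ}(t) = ½ (A_μ(t) + κ |D|⁻¹ (-i ∂_t) A_μ(t))`, for a sign `κ`. -/
def halfWave (T : ℝ) (a : ℝ → L2R) (κ : ℤˣ) (t : ℝ) : L2C :=
  (1 / 2 : ℂ) • (toComplex (a t)
    + (((κ : ℤ) : ℂ) * (-Complex.I)) • multiplier invAbs (toComplex (timeDeriv T a t)))

/-- The profile `F_{μ,κ}(t) = e^{-κ i t |D|} A_{μ,κ}(t)`. -/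
def profile (T : ℝ) (a : ℝ → L2R) (κ : ℤˣ) (t : ℝ) : L2C :=
  multiplier (halfWaveSymbol (-((κ : ℤ) : ℝ) * t)) (halfWave T a κ t)

/-- The norm of `A_{μ,κ}` in the a priori assumption. -/
def sigmaNormSign (n β δ T : ℝ) (a : ℝ → L2R) (κ : ℤˣ) : ℝ≥0∞ :=
  ⨆ t ∈ Set.Icc 0 T,
    (ENNReal.ofReal (bracket t ^ (-β / 2 - δ / 2))
        * sobolevNorm n 2 (halfWave T a κ t : 𝓢'(E4, ℂ))
      + ENNReal.ofReal (bracket t ^ (-β / 2 - δ / 2)) * firstMoment (profile T a κ t)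
      + ENNReal.ofReal (bracket t ^ (-(1 / 8 : ℝ))) * secondMoment (profile T a κ t))

/-- The norm of `A_μ` in the a priori assumption: the sum over the two signs. -/
def sigmaNorm (n β δ T : ℝ) (a : ℝ → L2R) : ℝ≥0∞ :=
  sigmaNormSign n β δ T a 1 + sigmaNormSign n β δ T a (-1)

end MaxwellDecay

end

/-!
The constraints on `β` and `δ` force `n > 450`, and every norm in the a priori bound is allowed to
grow at most like `⟨t⟩^{1/8}`. With `g(t)` the Fourier transform of the profile of sign `κ`, a half
wave is the oscillatory integral `∫ e^{2πi(x·ξ + κt|ξ|)} g(t, ξ) dξ`, and the moment bounds say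
that `g(t)`, `|ξ| ∇g(t)` and `|ξ|² ∇²g(t)` are bounded in `L²` by `⟨t⟩^{1/8}`, with weak
derivatives taken away from the origin (`HasJet`, `exists_hasJet`). Writing jet for the sum of
these three quantities, the proof rests on two estimates.

*Dispersion.* For an amplitude `f` with frequencies below `R` and for every `A > 0`,
`exists_dispersive_weak` bounds the oscillatory integral by `|t|^{-3/2} R^{1/4} (A^{3/2} ‖|ξ| f‖ +
A^{-1/2} ‖jet f‖)`. In the light-cone coordinates `p = |ξ| + ξ₁` and `η ⊥ x`, the phase is exactly
quadratic in `η ∈ ℝ³` on each slice `p = const`, with curvature bounded below by `|t| / p`. So each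
slice is an explicit Schrödinger integral (`exists_schroedinger_dispersive`), and Cauchy-Schwarz in
`p` puts the slices together. Weak derivatives are reached by approximation with Schwartz
functions.

*Increments of the profile.* Applied to `g(t)` itself, the dispersive estimate would lose the
growth `⟨t⟩^{1/8}`. But `|ξ| (g(2s) - g(s))` is of size `s^{-1+1/8}`, although no equation for the
profile is assumed (`norm_integral_increment_le`, `WaveData.eLpNorm_increment_le`). The field and
its time derivative are combinations of both half waves. Conjugating the field with the phase of
one of them gives the profile plus the profile `h` of the other one with the phase `e^{-2iκs|D|}`.
Tested against a smooth function, the latter contribution is removed by two integrations by parts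
in the radial variable, each of which gains `1/s`. The corrected pairing is differentiable in `s`
with derivative `O(s⁻²)` up to the growth of the norms, and so is nearly constant over `[s, 2s]`.

Now `g(t)` is reached from a time of order one along the times `s, 2s, 4s, …`. With `A = s^{1/2}`,
the increment contributes at most `|t|^{-3/2} s^{-1/4 + 1/8}` times powers of the frequency bound
(`exists_dyadic_step`). The amplitude at time `s` is truncated to frequencies between `1/s` and
`s^{1/200}` (`timeSymbol`), which turns the symbol `⟨D⟩^ν`, `ν ≤ 20`, into a loss of at most
`s^{1/10 + 1/800}`. The total `s^{-19/800}` is summable over dyadic times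
(`exists_truncated_decay`). At the final time, the removed low frequencies fill a ball of radius
`3/t`, and the removed high frequencies are small because `n` is large, so both are integrable to
order `t^{-3/2}` (`exists_decay`).
-/

noncomputable section

namespace MaxwellDecay

open Real LineDeriv Laplacian ContDiff

/-! ### An oscillatory integral on `ℝ³` with quadratic phase -/

/-- Three-dimensional Euclidean space, the slices of `ℝ⁴` in light-cone coordinates. -/
abbrev E3 : Type := EuclideanSpace ℝ (Fin 3)

/-- Parseval's identity against a complex Gaussian, whose Fourier transform is bounded by
`(π / |b|)^{3/2}` uniformly in the real part of `b`. -/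
lemma norm_integral_gaussian_mul_le (b : ℂ) (hb : 0 < b.re) (h : 𝓢(E3, ℂ)) :
    ‖∫ η, Complex.exp (-b * ‖η‖ ^ 2) * h η‖
      ≤ (π / ‖b‖) ^ (3 / 2 : ℝ) * ∫ y, ‖(𝓕⁻ h) y‖ := by
  have hb0 : b ≠ 0 := by rintro rfl; simp at hb
  set k : 𝓢(E3, ℂ) := 𝓕⁻ h with hk
  have hh : h = 𝓕 k := by rw [hk, FourierTransform.fourier_fourierInv_eq]
  have hint : Integrable (fun η : E3 => Complex.exp (-b * ‖η‖ ^ 2)) := by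
    simpa using GaussianFourier.integrable_cexp_neg_mul_sq_norm_add (V := E3) hb 0 0
  have key : ∫ η, Complex.exp (-b * ‖η‖ ^ 2) * h η
      = ∫ y, 𝓕 (fun η : E3 => Complex.exp (-b * ‖η‖ ^ 2)) y * k y := by
    rw [hh]
    have := VectorFourier.integral_bilin_fourierIntegral_eq_flip (ContinuousLinearMap.mul ℂ ℂ)
      (L := innerₗ E3) continuous_fourierChar continuous_inner hint k.integrable (μ := volume)
      (ν := volume)
    simpa using! this.symm
  rw [key, ← integral_const_mul]
  refine norm_integral_le_of_norm_le (k.integrable.norm.const_mul _) (ae_of_all _ fun y => ?_)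
  rw [norm_mul, fourier_gaussian_innerProductSpace hb, norm_mul]
  have h1 : ‖((π : ℂ) / b) ^ ((Module.finrank ℝ E3 : ℂ) / 2)‖ = (π / ‖b‖) ^ (3 / 2 : ℝ) := by
    have : ((Module.finrank ℝ E3 : ℂ) / 2) = ((3 / 2 : ℝ) : ℂ) := by simp
    rw [this, Complex.norm_cpow_real]
    simp [abs_of_pos pi_pos]
  have h2 : ‖Complex.exp (-π ^ 2 * ‖y‖ ^ 2 / b)‖ ≤ 1 := by
    rw [Complex.norm_exp, Real.exp_le_one_iff]
    have : (-(π : ℂ) ^ 2 * ‖y‖ ^ 2 / b) = ((-(π ^ 2 * ‖y‖ ^ 2) : ℝ) : ℂ) * b⁻¹ := by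
      push_cast; ring
    rw [this, Complex.re_ofReal_mul, Complex.inv_re]
    have : 0 ≤ b.re / Complex.normSq b := div_nonneg hb.le (Complex.normSq_nonneg _)
    nlinarith [mul_nonneg (sq_nonneg (π * ‖y‖)) this]
  rw [h1]
  have h3 : 0 ≤ (π / ‖b‖) ^ (3 / 2 : ℝ) := by positivity
  calc _ ≤ (π / ‖b‖) ^ (3 / 2 : ℝ) * 1 * ‖k y‖ := by gcongr
    _ = _ := by ring

/-- The imaginary exponent is reached as the limit of decaying Gaussians. -/
lemma norm_integral_schroedinger_le (T : ℝ) (hT : T ≠ 0) (h : 𝓢(E3, ℂ)) :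
    ‖∫ η, Complex.exp (Complex.I * T * ‖η‖ ^ 2) * h η‖
      ≤ (π / |T|) ^ (3 / 2 : ℝ) * ∫ y, ‖(𝓕⁻ h) y‖ := by
  have hlim : Filter.Tendsto
      (fun n : ℕ => ∫ η, Complex.exp (-((1 / ((n : ℝ) + 1) : ℝ) - Complex.I * T) * ‖η‖ ^ 2) * h η)
      Filter.atTop (nhds (∫ η, Complex.exp (Complex.I * T * ‖η‖ ^ 2) * h η)) := by
    refine tendsto_integral_of_dominated_convergence (fun η => ‖h η‖) (fun n => ?_)
      h.integrable.norm (fun n => ae_of_all _ fun η => ?_) (ae_of_all _ fun η => ?_)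
    · exact (Continuous.mul (by fun_prop) h.continuous).aestronglyMeasurable
    · rw [norm_mul, Complex.norm_exp]
      refine mul_le_of_le_one_left (norm_nonneg _) ?_
      rw [Real.exp_le_one_iff]
      have : (-((1 / ((n : ℝ) + 1) : ℝ) - Complex.I * T) * (‖η‖ : ℂ) ^ 2)
        = ((-(1 / ((n : ℝ) + 1)) * ‖η‖ ^ 2 : ℝ) : ℂ) + ((T * ‖η‖ ^ 2 : ℝ) : ℂ) * Complex.I := by
        push_cast; ring
      rw [this]
      simp only [Complex.add_re, Complex.ofReal_re, Complex.mul_re, Complex.I_re, Complex.I_im,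
        Complex.ofReal_im, mul_zero, sub_zero, mul_one, add_zero]
      have : (0 : ℝ) ≤ 1 / ((n : ℝ) + 1) := by positivity
      nlinarith [sq_nonneg ‖η‖]
    · refine Filter.Tendsto.mul_const _ ?_
      have hc : Continuous (fun x : ℝ => Complex.exp (-((x : ℂ) - Complex.I * T) * ‖η‖ ^ 2)) := by
        fun_prop
      have := (hc.tendsto 0).comp (tendsto_one_div_add_atTop_nhds_zero_nat (𝕜 := ℝ))
      simpa [Function.comp_def] using this
  refine le_of_tendsto hlim.norm (Filter.Eventually.of_forall fun n => ?_)
  have hre : ((1 / ((n : ℝ) + 1) : ℝ) - Complex.I * T : ℂ).re = 1 / ((n : ℝ) + 1) := by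
    rw [Complex.sub_re, Complex.ofReal_re]; simp
  have hpos : (0 : ℝ) < 1 / ((n : ℝ) + 1) := by positivity
  refine (norm_integral_gaussian_mul_le _ (by rw [hre]; exact hpos) h).trans ?_
  refine mul_le_mul_of_nonneg_right ?_ (integral_nonneg fun _ => norm_nonneg _)
  have him : |T| ≤ ‖((1 / ((n : ℝ) + 1) : ℝ) - Complex.I * T : ℂ)‖ := by
    have := Complex.abs_im_le_norm ((1 / ((n : ℝ) + 1) : ℝ) - Complex.I * T : ℂ)
    have h2 : ((1 / ((n : ℝ) + 1) : ℝ) - Complex.I * T : ℂ).im = -T := by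
      rw [Complex.sub_im, Complex.ofReal_im]; simp
    rwa [h2, abs_neg] at this
  have : 0 < |T| := abs_pos.mpr hT
  gcongr

/-- Cauchy-Schwarz against `(1 + |y/A|²)⁻¹`, which is square integrable on `ℝ³`. -/
lemma exists_integral_norm_le_weighted :
    ∃ c : ℝ, 0 < c ∧ ∀ (k : 𝓢(E3, ℂ)) (A : ℝ), 0 < A →
      ∫ y, ‖k y‖ ≤ c * A ^ (3 / 2 : ℝ) * (‖k.toLp 2 volume‖ + (A ^ 2)⁻¹ *
        ‖(SchwartzMap.smulLeftCLM ℂ (fun y : E3 => ((‖y‖ ^ 2 : ℝ) : ℂ)) k).toLp 2 volume‖) := by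
  set φ : E3 → ℝ := fun y => (1 + ‖y‖ ^ 2)⁻¹ with hφ
  have hφ2 : Integrable (fun y => φ y ^ 2) := by
    have := integrable_rpow_neg_one_add_norm_sq (E := E3) (μ := volume) (r := 4) (by simp; norm_num)
    refine this.congr (ae_of_all _ fun y => ?_)
    have h1 : 0 ≤ 1 + ‖y‖ ^ 2 := by positivity
    simp only [hφ]
    rw [show (-(4 : ℝ) / 2) = -((2 : ℕ) : ℝ) by norm_num, rpow_neg h1, rpow_natCast, inv_pow]
  set I := ∫ y, φ y ^ 2 with hI
  have hInn : 0 ≤ I := integral_nonneg fun y => sq_nonneg _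
  refine ⟨I ^ (1 / 2 : ℝ) + 1, by positivity, fun k A hA => ?_⟩
  set q : E3 → ℂ := fun y : E3 => ((‖y‖ ^ 2 : ℝ) : ℂ) with hq
  have hqt : q.HasTemperateGrowth := by
    simp only [hq]; fun_prop
  set G : 𝓢(E3, ℂ) := k + ((A ^ 2)⁻¹ : ℂ) • SchwartzMap.smulLeftCLM ℂ q k with hG
  have hGy : ∀ y, G y = ((1 + ‖A⁻¹ • y‖ ^ 2 : ℝ) : ℂ) * k y := by
    intro y
    rw [hG, _root_.add_apply, _root_.smul_apply,
      SchwartzMap.smulLeftCLM_apply_apply hqt]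
    simp only [hq, norm_smul, norm_inv, Real.norm_eq_abs, abs_of_pos hA, mul_pow, smul_eq_mul]
    push_cast
    ring
  have hGn : ‖G.toLp 2 volume‖ ≤ ‖k.toLp 2 volume‖ + (A ^ 2)⁻¹ *
        ‖(SchwartzMap.smulLeftCLM ℂ q k).toLp 2 volume‖ := by
    have : G.toLp 2 volume
        = k.toLp 2 volume + ((A ^ 2)⁻¹ : ℂ) • (SchwartzMap.smulLeftCLM ℂ q k).toLp 2 volume := by
      simp only [← SchwartzMap.toLpCLM_apply (𝕜 := ℂ), hG, map_add, map_smul]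
    rw [this]
    refine (norm_add_le _ _).trans_eq ?_
    rw [norm_smul]; simp
  have hsc : ∫ y, φ (A⁻¹ • y) ^ 2 = A ^ 3 * I := by
    rw [Measure.integral_comp_inv_smul volume (fun y => φ y ^ 2)]
    simp [abs_of_pos hA, hI]
  have hsci : Integrable (fun y => φ (A⁻¹ • y) ^ 2) :=
    hφ2.comp_smul (inv_ne_zero hA.ne')
  have hφm : MemLp (fun y => φ (A⁻¹ • y)) (ENNReal.ofReal 2) volume := by
    rw [show ENNReal.ofReal 2 = 2 by simp]
    refine (memLp_two_iff_integrable_sq ?_).2 hsci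
    refine Continuous.aestronglyMeasurable ?_
    simp only [hφ]
    exact Continuous.inv₀ (by fun_prop) (fun y => by positivity)
  have hkey : ∫ y, ‖k y‖ = ∫ y, ‖φ (A⁻¹ • y)‖ * ‖G y‖ := by
    refine integral_congr_ae (ae_of_all _ fun y => ?_)
    have h1 : 0 < 1 + ‖A⁻¹ • y‖ ^ 2 := by positivity
    simp only [hGy, hφ, norm_mul, Complex.norm_real, norm_inv, Real.norm_eq_abs]
    rw [← mul_assoc, inv_mul_cancel₀ (by positivity), one_mul]
  have hH := integral_mul_norm_le_Lp_mul_Lq (μ := volume) (f := fun y => φ (A⁻¹ • y))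
    (g := fun y => ‖G y‖) (p := 2) (q := 2) ⟨by norm_num, by norm_num, by norm_num⟩ hφm
    (by simpa using (G.memLp 2 volume).norm)
  simp only [norm_norm] at hH
  rw [hkey]
  refine hH.trans ?_
  have hGL : (∫ y, ‖G y‖ ^ (2 : ℝ)) ^ (1 / 2 : ℝ) = ‖G.toLp 2 volume‖ := by
    rw [SchwartzMap.norm_toLp' (by norm_num) (by norm_num)]; simp
  have hφL : (∫ y, ‖φ (A⁻¹ • y)‖ ^ (2 : ℝ)) ^ (1 / 2 : ℝ) = A ^ (3 / 2 : ℝ) * I ^ (1 / 2 : ℝ) := by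
    have : ∀ y, ‖φ (A⁻¹ • y)‖ ^ (2 : ℝ) = φ (A⁻¹ • y) ^ 2 := fun y => by
      rw [rpow_two, Real.norm_eq_abs, sq_abs]
    simp_rw [this]
    rw [hsc, mul_rpow (by positivity) hInn, ← rpow_natCast, ← rpow_mul hA.le]
    norm_num
  rw [hGL, hφL]
  have hA' : 0 < A ^ (3 / 2 : ℝ) := by positivity
  calc _ ≤ A ^ (3 / 2 : ℝ) * (I ^ (1 / 2 : ℝ) + 1) * ‖G.toLp 2 volume‖ := by gcongr; linarith
    _ = (I ^ (1 / 2 : ℝ) + 1) * A ^ (3 / 2 : ℝ) * ‖G.toLp 2 volume‖ := by ring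
    _ ≤ _ := by gcongr

/-- Quadratic oscillatory integrals over `ℝ³` decay like `|T|^{-3/2}`, with two derivatives in `L²`
on the amplitude. The free parameter `A` is the inverse length scale at which the amplitude and
its second derivatives are balanced. -/
lemma exists_schroedinger_dispersive :
    ∃ c : ℝ, 0 < c ∧ ∀ (h : 𝓢(E3, ℂ)) (T A : ℝ), T ≠ 0 → 0 < A →
      ‖∫ η, Complex.exp (Complex.I * T * ‖η‖ ^ 2) * h η‖
        ≤ c * |T| ^ (-(3 / 2) : ℝ) *
          (A ^ (3 / 2 : ℝ) * ‖h.toLp 2 volume‖ + A ^ (-(1 / 2) : ℝ) * ‖(Δ h).toLp 2 volume‖) := by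
  obtain ⟨c, hc, hcb⟩ := exists_integral_norm_le_weighted
  refine ⟨c * π ^ (3 / 2 : ℝ), by positivity, fun h T A hT hA => ?_⟩
  have hTp : 0 < |T| := abs_pos.mpr hT
  refine (norm_integral_schroedinger_le T hT h).trans ?_
  have h1 := hcb (𝓕⁻ h) A hA
  have hk : ‖(𝓕⁻ h : 𝓢(E3, ℂ)).toLp 2 volume‖ = ‖h.toLp 2 volume‖ := by
    rw [← SchwartzMap.norm_fourier_toL2_eq, FourierTransform.fourier_fourierInv_eq]
  have hL : ‖(SchwartzMap.smulLeftCLM ℂ (fun y : E3 => ((‖y‖ ^ 2 : ℝ) : ℂ)) (𝓕⁻ h)).toLp 2 volume‖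
      ≤ ‖(Δ h).toLp 2 volume‖ := by
    have h2 := SchwartzMap.laplacian_eq_fourierMultiplierCLM h
    have h3 : 𝓕 (Δ h) = (-(2 * π) ^ 2 : ℝ) •
        SchwartzMap.smulLeftCLM ℂ (fun y : E3 => ((‖y‖ ^ 2 : ℝ) : ℂ)) (𝓕 h) := by
      rw [h2, ← SchwartzMap.fourierMultiplierCLM_ofReal ℂ (by fun_prop),
        SchwartzMap.fourierMultiplierCLM_apply]
      have : ∀ (r : ℝ) (u : 𝓢(E3, ℂ)), 𝓕 (r • u) = r • 𝓕 u := fun r u => by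
        exact FourierTransform.fourier_smul (r : ℂ) u
      rw [this, FourierTransform.fourier_fourierInv_eq]
      rfl
    have h4 : ‖(Δ h).toLp 2 volume‖ = (2 * π) ^ 2 * ‖(SchwartzMap.smulLeftCLM ℂ
        (fun y : E3 => ((‖y‖ ^ 2 : ℝ) : ℂ)) (𝓕 h)).toLp 2 volume‖ := by
      rw [← SchwartzMap.norm_fourier_toL2_eq, h3, ← SchwartzMap.toLpCLM_apply (𝕜 := ℝ), map_smul,
        norm_smul, SchwartzMap.toLpCLM_apply]
      simp only [Real.norm_eq_abs, abs_neg, abs_of_nonneg (sq_nonneg (2 * π))]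
    have h5 : ‖(SchwartzMap.smulLeftCLM ℂ (fun y : E3 => ((‖y‖ ^ 2 : ℝ) : ℂ)) (𝓕⁻ h)).toLp 2 volume‖
        = ‖(SchwartzMap.smulLeftCLM ℂ (fun y : E3 => ((‖y‖ ^ 2 : ℝ) : ℂ)) (𝓕 h)).toLp 2 volume‖ := by
      have hqt : (fun y : E3 => ((‖y‖ ^ 2 : ℝ) : ℂ)).HasTemperateGrowth := by fun_prop
      rw [SchwartzMap.norm_toLp' (by norm_num) (by norm_num),
        SchwartzMap.norm_toLp' (by norm_num) (by norm_num)]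
      congr 1
      rw [← integral_neg_eq_self]
      refine integral_congr_ae (ae_of_all _ fun y => ?_)
      simp only [SchwartzMap.smulLeftCLM_apply_apply hqt]
      rw [SchwartzMap.fourierInv_coe, SchwartzMap.fourier_coe, Real.fourierInv_eq_fourier_neg]
      simp
    rw [h5, h4]
    have : 1 ≤ (2 * π) ^ 2 := by nlinarith [pi_gt_three]
    nlinarith [norm_nonneg ((SchwartzMap.smulLeftCLM ℂ
        (fun y : E3 => ((‖y‖ ^ 2 : ℝ) : ℂ)) (𝓕 h)).toLp 2)]
  have h6 : A ^ (3 / 2 : ℝ) * (A ^ 2)⁻¹ = A ^ (-(1 / 2) : ℝ) := by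
    rw [← rpow_natCast, ← rpow_neg hA.le, ← rpow_add hA]; norm_num
  calc (π / |T|) ^ (3 / 2 : ℝ) * ∫ y, ‖(𝓕⁻ h : 𝓢(E3, ℂ)) y‖
      ≤ (π / |T|) ^ (3 / 2 : ℝ) * (c * A ^ (3 / 2 : ℝ) * (‖h.toLp 2 volume‖ + (A ^ 2)⁻¹ *
        ‖(Δ h).toLp 2 volume‖)) := by
        refine mul_le_mul_of_nonneg_left (h1.trans ?_) (by positivity)
        rw [hk]
        gcongr
    _ = _ := by
        rw [← h6, div_rpow pi_pos.le hTp.le, rpow_neg hTp.le]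
        field_simp

/-! ### Light-cone coordinates -/

section

/-- The component `ξ₁` along the axis, as a function of the light-cone coordinates
`p = |ξ| + ξ₁` and `η = ξ'`. -/
def axial (z : ℝ × E3) : ℝ := (z.1 - ‖z.2‖ ^ 2 / z.1) / 2

/-- The Jacobian `∂ξ₁/∂p = |ξ| / p` of the light-cone coordinates. -/
def nullJac (z : ℝ × E3) : ℝ := (1 + ‖z.2‖ ^ 2 / z.1 ^ 2) / 2

lemma nullJac_nonneg (z : ℝ × E3) : 0 ≤ nullJac z := by
  unfold nullJac; positivity

lemma measurable_axial : Measurable axial := by unfold axial; fun_prop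

lemma measurable_nullJac : Measurable nullJac := by unfold nullJac; fun_prop

/-- For fixed `η ≠ 0`, the axial component is a diffeomorphism from `p > 0` onto the line. -/
lemma lintegral_eq_lintegral_axial {η : E3} (hη : η ≠ 0) (G : ℝ → ℝ≥0∞) :
    ∫⁻ a, G a = ∫⁻ p in Set.Ioi (0 : ℝ), ENNReal.ofReal (nullJac (p, η)) * G (axial (p, η)) := by
  have hη' : 0 < ‖η‖ := norm_pos_iff.mpr hη
  have himg : (fun p : ℝ => axial (p, η)) '' Set.Ioi 0 = Set.univ := by
    refine Set.eq_univ_of_forall fun a => ?_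
    -- the positive root of `p ^ 2 - 2 a p - |η| ^ 2 = 0`
    have hs : Real.sqrt (a ^ 2 + ‖η‖ ^ 2) ^ 2 = a ^ 2 + ‖η‖ ^ 2 := Real.sq_sqrt (by positivity)
    have hpos : 0 < Real.sqrt (a ^ 2 + ‖η‖ ^ 2) + a := by
      have : |a| < Real.sqrt (a ^ 2 + ‖η‖ ^ 2) := by
        rw [← Real.sqrt_sq_eq_abs]
        exact Real.sqrt_lt_sqrt (sq_nonneg a) (by nlinarith)
      linarith [neg_abs_le a]
    refine ⟨Real.sqrt (a ^ 2 + ‖η‖ ^ 2) + a, hpos, ?_⟩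
    simp only [axial]
    field_simp
    nlinarith
  have hinj : Set.InjOn (fun p : ℝ => axial (p, η)) (Set.Ioi 0) := by
    intro p hp q hq h
    simp only [Set.mem_Ioi] at hp hq
    simp only [axial] at h
    have h1 : (p - q) * (p * q + ‖η‖ ^ 2) = 0 := by
      field_simp at h
      nlinarith
    have h2 : p * q + ‖η‖ ^ 2 ≠ 0 := by positivity
    have := (mul_eq_zero.mp h1).resolve_right h2
    linarith
  have := lintegral_image_eq_lintegral_abs_deriv_mul (s := Set.Ioi (0 : ℝ)) measurableSet_Ioi
    (f := fun p : ℝ => axial (p, η)) (f' := fun p => nullJac (p, η)) (fun p hp => ?_) hinj G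
  · rw [himg, setLIntegral_univ] at this
    rw [this]
    simp_rw [abs_of_nonneg (nullJac_nonneg _)]
  · refine HasDerivAt.hasDerivWithinAt ?_
    have hp' : p ≠ 0 := ne_of_gt hp
    have h := ((hasDerivAt_id p).sub
      ((hasDerivAt_const p (‖η‖ ^ 2)).div (hasDerivAt_id p) hp')).div_const 2
    refine h.congr_deriv ?_
    simp only [nullJac, id]
    field_simp
    ring

/-- The measure `(|ξ| / p) dp dη` on the domain `p > 0` of the light-cone coordinates. -/
def nullMeasure : Measure (ℝ × E3) :=
  ((volume.restrict (Set.Ioi (0 : ℝ))).prod volume).withDensity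
    fun z => ENNReal.ofReal (nullJac z)

/-- The light-cone coordinates `(p, η)`, `p = |ξ| + ξ₁`, carry Lebesgue measure to `nullMeasure`. -/
lemma measurePreserving_axial :
    MeasurePreserving (fun z : ℝ × E3 => (axial z, z.2)) nullMeasure (volume.prod volume) := by
  have hm : Measurable (fun z : ℝ × E3 => (axial z, z.2)) :=
    measurable_axial.prodMk measurable_snd
  refine ⟨hm, ?_⟩
  ext s hs
  rw [Measure.map_apply hm hs, nullMeasure, withDensity_apply _ (hm hs),
    ← lintegral_indicator (hm hs), lintegral_prod_symm _ ?_, Measure.prod_apply_symm hs]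
  · have hae : ∀ᵐ η : E3, η ≠ 0 := by
      rw [ae_iff]; simp
    refine lintegral_congr_ae (hae.mono fun η hη => ?_)
    have hms : Measurable (fun a : ℝ => (a, η)) := by fun_prop
    have := lintegral_eq_lintegral_axial hη (((fun a : ℝ => (a, η)) ⁻¹' s).indicator 1)
    rw [lintegral_indicator_one (hms hs)] at this
    change _ = volume ((fun a : ℝ => (a, η)) ⁻¹' s)
    rw [this]
    refine lintegral_congr fun p => ?_
    by_cases h : (axial (p, η), η) ∈ s
    · simp [Set.indicator, h]
    · simp [Set.indicator, h]
  · exact ((measurable_nullJac.ennreal_ofReal).indicator (hm hs)).aemeasurable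

variable (b : OrthonormalBasis (Fin 4) ℝ E4)

/-- The vector of `ℝ⁴` with axial component `a` along `b 0` and transversal part `η`. -/
def frame (z : ℝ × E3) : E4 := z.1 • b 0 + ∑ j : Fin 3, z.2 j • b j.succ

lemma frame_eq (z : ℝ × E3) :
    frame b z = b.repr.symm (WithLp.toLp 2 (Fin.cons z.1 (fun j => z.2 j))) := by
  rw [← b.sum_repr (b.repr.symm _), Fin.sum_univ_succ]
  simp [frame]

lemma norm_frame_sq (z : ℝ × E3) : ‖frame b z‖ ^ 2 = z.1 ^ 2 + ‖z.2‖ ^ 2 := by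
  rw [frame_eq, LinearIsometryEquiv.norm_map, EuclideanSpace.norm_sq_eq, Fin.sum_univ_succ,
    EuclideanSpace.norm_sq_eq]
  simp

lemma inner_frame (z : ℝ × E3) : inner ℝ (b 0) (frame b z) = z.1 := by
  rw [← b.repr_apply_apply, frame_eq]
  simp

lemma measurePreserving_frame : MeasurePreserving (frame b) (volume.prod volume) volume := by
  have h1 : MeasurePreserving (fun z : ℝ × E3 => (z.1, (z.2 : Fin 3 → ℝ)))
      (volume.prod volume) (volume.prod volume) :=
    (MeasurePreserving.id volume).prod (PiLp.volume_preserving_ofLp (Fin 3))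
  have h2 := (volume_preserving_piFinSuccAbove (fun _ : Fin 4 => ℝ) 0).symm
  have h3 := PiLp.volume_preserving_toLp (Fin 4)
  have h4 := b.measurePreserving_repr_symm
  have h5 := h4.comp (h3.comp (h2.comp h1))
  convert h5 using 1
  ext1 z
  rw [frame_eq]
  simp [MeasurableEquiv.piFinSuccAbove]
  rfl

/-- The vector of `ℝ⁴` with light-cone coordinates `(p, η)`. -/
def nullFrame (z : ℝ × E3) : E4 := frame b (axial z, z.2)

lemma measurePreserving_nullFrame : MeasurePreserving (nullFrame b) nullMeasure volume :=
  (measurePreserving_frame b).comp measurePreserving_axial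

/-- The length `|ξ| = (p + |η|² / p) / 2` is quadratic in `η` on the slices `p = const`. -/
lemma norm_nullFrame {z : ℝ × E3} (hz : 0 < z.1) : ‖nullFrame b z‖ = z.1 * nullJac z := by
  have h : ‖nullFrame b z‖ ^ 2 = (z.1 * nullJac z) ^ 2 := by
    rw [nullFrame, norm_frame_sq]
    simp only [axial, nullJac]
    field_simp
    ring
  exact (pow_left_inj₀ (norm_nonneg _) (mul_nonneg hz.le (nullJac_nonneg z)) two_ne_zero).mp h

lemma lintegral_nullFrame {G : E4 → ℝ≥0∞} (hG : Measurable G) :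
    ∫⁻ ξ, G ξ = ∫⁻ p in Set.Ioi (0 : ℝ), ∫⁻ η : E3,
      ENNReal.ofReal (nullJac (p, η)) * G (nullFrame b (p, η)) := by
  have hm := (measurePreserving_nullFrame b).measurable
  rw [← (measurePreserving_nullFrame b).lintegral_comp hG, nullMeasure,
    lintegral_withDensity_eq_lintegral_mul (g := fun z => G (nullFrame b z)) _
      measurable_nullJac.ennreal_ofReal (hG.comp hm),
    lintegral_prod _ (by exact (measurable_nullJac.ennreal_ofReal.mul (hG.comp hm)).aemeasurable)]
  rfl

lemma integral_nullFrame {G : E4 → ℂ} (hG : Integrable G) :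
    ∫ ξ, G ξ = ∫ p in Set.Ioi (0 : ℝ), ∫ η : E3, (nullJac (p, η) : ℂ) * G (nullFrame b (p, η)) := by
  have hmp := measurePreserving_nullFrame b
  have hint : Integrable (fun z => G (nullFrame b z)) nullMeasure :=
    hmp.integrable_comp_of_integrable hG
  rw [← hmp.map_eq, integral_map hmp.aemeasurable (by rw [hmp.map_eq]; exact hG.1)]
  unfold nullMeasure at hint ⊢
  have hlt : ∀ᵐ z ∂((volume.restrict (Set.Ioi (0 : ℝ))).prod (volume : Measure E3)),
      ENNReal.ofReal (nullJac z) < ⊤ := ae_of_all _ fun z => ENNReal.ofReal_lt_top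
  have e : ∀ z, (ENNReal.ofReal (nullJac z)).toReal • G (nullFrame b z)
      = (nullJac z : ℂ) * G (nullFrame b z) := fun z => by
    rw [ENNReal.toReal_ofReal (nullJac_nonneg z), Complex.real_smul]
  rw [integrable_withDensity_iff_integrable_smul' measurable_nullJac.ennreal_ofReal hlt] at hint
  rw [integral_withDensity_eq_integral_toReal_smul measurable_nullJac.ennreal_ofReal hlt]
  simp_rw [e] at hint ⊢
  exact integral_prod _ hint

end

/-! ### Slices along light cones -/

section

variable (b : OrthonormalBasis (Fin 4) ℝ E4)

/-- The scale-invariant size `|f| + r |Df| + r² |D²f|` of a function and its derivatives. -/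
def jetSize (f : E4 → ℂ) (ξ : E4) : ℝ :=
  ‖f ξ‖ + ‖ξ‖ * ‖fderiv ℝ f ξ‖ + ‖ξ‖ ^ 2 * ‖fderiv ℝ (fderiv ℝ f) ξ‖

lemma continuous_jetSize {f : E4 → ℂ} (hf : ContDiff ℝ ∞ f) : Continuous (jetSize f) := by
  have h1 : Continuous (fderiv ℝ f) := hf.continuous_fderiv (by simp)
  have h2 : Continuous (fderiv ℝ (fderiv ℝ f)) :=
    (hf.fderiv_right (m := ∞) (by simp)).continuous_fderiv (by simp)
  have h3 := hf.continuous
  have h4 : Continuous fun ξ => ‖fderiv ℝ (fderiv ℝ f) ξ‖ :=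
    Continuous.norm (E := E4 →L[ℝ] E4 →L[ℝ] ℂ) h2
  unfold jetSize
  exact (h3.norm.add (continuous_norm.mul h1.norm)).add ((continuous_norm.pow 2).mul h4)

lemma contDiff_nullFrame (p : ℝ) : ContDiff ℝ ∞ (fun η : E3 => nullFrame b (p, η)) := by
  have h : ∀ j : Fin 3, ContDiff ℝ ∞ (fun η : E3 => η j) := fun j =>
    (EuclideanSpace.proj j : E3 →L[ℝ] ℝ).contDiff
  have h2 : ContDiff ℝ ∞ (fun η : E3 => ‖η‖ ^ 2) := contDiff_norm_sq ℝ
  unfold nullFrame frame axial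
  refine ContDiff.add ?_ (ContDiff.sum fun j _ => (h j).smul contDiff_const)
  exact ((contDiff_const.sub (h2.div_const p)).div_const 2).smul contDiff_const

lemma contDiff_nullJac (p : ℝ) : ContDiff ℝ ∞ (fun η : E3 => ((nullJac (p, η) : ℝ) : ℂ)) := by
  have h2 : ContDiff ℝ ∞ (fun η : E3 => ‖η‖ ^ 2) := contDiff_norm_sq ℝ
  have : ContDiff ℝ ∞ (fun η : E3 => nullJac (p, η)) := by
    simp only [nullJac]
    exact (contDiff_const.add (h2.div_const _)).div_const 2
  exact Complex.ofRealCLM.contDiff.comp this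

lemma norm_snd_le_norm_nullFrame (p : ℝ) (η : E3) : ‖η‖ ≤ ‖nullFrame b (p, η)‖ := by
  have := norm_frame_sq b (axial (p, η), η)
  refine le_of_sq_le_sq ?_ (norm_nonneg _)
  rw [nullFrame, this]
  nlinarith [sq_nonneg (axial (p, η))]

/-- The amplitude `(|ξ| / p) f` on the slice `p = const` of the light-cone coordinates. -/
def slice {f : E4 → ℂ} (hf : ContDiff ℝ ∞ f) {R : ℝ} (hR : ∀ ξ, f ξ ≠ 0 → ‖ξ‖ ≤ R) (p : ℝ) :
    𝓢(E3, ℂ) :=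
  HasCompactSupport.toSchwartzMap
    (f := fun η : E3 => (nullJac (p, η) : ℂ) * f (nullFrame b (p, η)))
    (HasCompactSupport.of_support_subset_isCompact (isCompact_closedBall (0 : E3) R) (by
      intro η hη
      have h1 : f (nullFrame b (p, η)) ≠ 0 := right_ne_zero_of_mul hη
      simpa using (norm_snd_le_norm_nullFrame b p η).trans (hR _ h1)))
    ((contDiff_nullJac p).mul (hf.comp (contDiff_nullFrame b p)))

lemma slice_apply {f : E4 → ℂ} (hf : ContDiff ℝ ∞ f) {R : ℝ} (hR : ∀ ξ, f ξ ≠ 0 → ‖ξ‖ ≤ R)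
    (p : ℝ) (η : E3) :
    slice b hf hR p η = (nullJac (p, η) : ℂ) * f (nullFrame b (p, η)) := rfl

lemma lineDerivOp_lineDerivOp_eq (h : 𝓢(E3, ℂ)) (η m : E3) (k' : ℝ → ℂ) (k'' : ℂ)
    (h1 : ∀ τ : ℝ, HasDerivAt (fun τ : ℝ => h (η + τ • m)) (k' τ) τ)
    (h2 : HasDerivAt k' k'' 0) : (∂_{m} (∂_{m} h)) η = k'' := by
  have h3 : ∀ τ : ℝ, (∂_{m} h) (η + τ • m) = k' τ := by
    intro τ
    rw [SchwartzMap.lineDerivOp_apply, lineDeriv]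
    have := (h1 (τ + 0)).comp_const_add τ 0
    simp only [add_zero] at this
    refine HasDerivAt.deriv ?_
    convert this using 2 with s
    rw [add_smul, add_assoc]
  rw [SchwartzMap.lineDerivOp_apply, lineDeriv]
  simp_rw [h3]
  exact h2.deriv

lemma frame_add (z w : ℝ × E3) : frame b (z + w) = frame b z + frame b w := by
  simp [frame, add_smul, Finset.sum_add_distrib]; abel

lemma frame_smul (c : ℝ) (z : ℝ × E3) : frame b (c • z) = c • frame b z := by
  simp [frame, smul_smul, Finset.smul_sum]

/-- The slices `p = const` are paraboloids: straight lines in `η` become parabolas in `ℝ⁴`. -/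
lemma nullFrame_add_smul {p : ℝ} (hp : 0 < p) (η m : E3) (hm : ‖m‖ = 1) (τ : ℝ) :
    nullFrame b (p, η + τ • m) = nullFrame b (p, η) + τ • frame b (-(inner ℝ η m / p), m)
      + τ ^ 2 • frame b (-(1 / (2 * p)), 0) := by
  rw [nullFrame, nullFrame, ← frame_smul, ← frame_smul, ← frame_add, ← frame_add]
  congr 1
  have h : ‖η + τ • m‖ ^ 2 = ‖η‖ ^ 2 + 2 * τ * inner ℝ η m + τ ^ 2 := by
    rw [norm_add_sq_real, norm_smul, inner_smul_right, hm]
    simp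
    ring
  ext1
  · simp only [axial, h, Prod.fst_add, Prod.smul_fst, smul_eq_mul]
    field_simp
    ring
  · simp

lemma nullJac_add_smul (p : ℝ) (η m : E3) (hm : ‖m‖ = 1) (τ : ℝ) :
    nullJac (p, η + τ • m) = nullJac (p, η) + τ * (inner ℝ η m / p ^ 2)
      + τ ^ 2 * (1 / (2 * p ^ 2)) := by
  have h : ‖η + τ • m‖ ^ 2 = ‖η‖ ^ 2 + 2 * τ * inner ℝ η m + τ ^ 2 := by
    rw [norm_add_sq_real, norm_smul, inner_smul_right, hm]
    simp
    ring
  simp only [nullJac, h]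
  ring

lemma lineDerivOp_lineDerivOp_slice {f : E4 → ℂ} (hf : ContDiff ℝ ∞ f) {R : ℝ}
    (hR : ∀ ξ, f ξ ≠ 0 → ‖ξ‖ ≤ R) {p : ℝ} (hp : 0 < p) (η m : E3) (hm : ‖m‖ = 1) :
    (∂_{m} (∂_{m} (slice b hf hR p))) η =
      ((1 / p ^ 2 : ℝ) : ℂ) * f (nullFrame b (p, η))
      + 2 * ((inner ℝ η m / p ^ 2 : ℝ) : ℂ)
        * fderiv ℝ f (nullFrame b (p, η)) (frame b (-(inner ℝ η m / p), m))
      + (nullJac (p, η) : ℂ) *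
        (fderiv ℝ (fderiv ℝ f) (nullFrame b (p, η)) (frame b (-(inner ℝ η m / p), m))
            (frame b (-(inner ℝ η m / p), m))
          + fderiv ℝ f (nullFrame b (p, η)) ((2 : ℝ) • frame b (-(1 / (2 * p)), 0))) := by
  set γ₀ := nullFrame b (p, η)
  set v := frame b (-(inner ℝ η m / p), m)
  set w := frame b (-(1 / (2 * p)), (0 : E3))
  set c := inner ℝ η m / p ^ 2
  set γ : ℝ → E4 := fun τ => γ₀ + τ • v + τ ^ 2 • w with hγ
  set J : ℝ → ℝ := fun τ => nullJac (p, η) + τ * c + τ ^ 2 * (1 / (2 * p ^ 2)) with hJ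
  have hγ' : ∀ τ, HasDerivAt γ (v + (2 * τ) • w) τ := fun τ => by
    have h1 := (hasDerivAt_id τ).smul_const v
    have h2 := (hasDerivAt_pow 2 τ).smul_const w
    refine ((h1.const_add γ₀).add h2).congr_deriv ?_
    simp
  have hJ' : ∀ τ, HasDerivAt (fun τ => (J τ : ℂ)) ((c + τ * (1 / p ^ 2) : ℝ) : ℂ) τ := fun τ => by
    refine HasDerivAt.ofReal_comp ?_
    have h1 := (hasDerivAt_id τ).mul_const c
    have h2 := (hasDerivAt_pow 2 τ).mul_const (1 / (2 * p ^ 2))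
    refine ((h1.const_add _).add h2).congr_deriv ?_
    simp
    ring
  have hfd : Differentiable ℝ f := hf.differentiable (by simp)
  have hf' : ContDiff ℝ ∞ (fderiv ℝ f) := hf.fderiv_right (by simp)
  have hf'd : Differentiable ℝ (fderiv ℝ f) := hf'.differentiable (by simp)
  have hfγ : ∀ τ, HasDerivAt (fun τ => f (γ τ)) (fderiv ℝ f (γ τ) (v + (2 * τ) • w)) τ := fun τ =>
    (hfd (γ τ)).hasFDerivAt.comp_hasDerivAt τ (hγ' τ)
  have hγ0 : γ 0 = γ₀ := by simp [hγ]
  have hJ0 : J 0 = nullJac (p, η) := by simp [hJ]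
  refine lineDerivOp_lineDerivOp_eq _ η m
    (fun τ => ((c + τ * (1 / p ^ 2) : ℝ) : ℂ) * f (γ τ)
      + (J τ : ℂ) * fderiv ℝ f (γ τ) (v + (2 * τ) • w)) _ (fun τ => ?_) ?_
  · have h := (hJ' τ).mul (hfγ τ)
    refine h.congr_of_eventuallyEq (Filter.Eventually.of_forall fun τ => ?_)
    beta_reduce
    rw [slice_apply, nullJac_add_smul p η m hm, nullFrame_add_smul b hp η m hm]
    rfl
  · have h1 : HasDerivAt (fun τ : ℝ => ((c + τ * (1 / p ^ 2) : ℝ) : ℂ)) ((1 / p ^ 2 : ℝ) : ℂ) 0 := by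
      refine HasDerivAt.ofReal_comp ?_
      refine (((hasDerivAt_id (0 : ℝ)).mul_const (1 / p ^ 2)).const_add c).congr_deriv ?_
      simp
    have h2 : HasDerivAt (fun τ => fderiv ℝ f (γ τ))
        (fderiv ℝ (fderiv ℝ f) (γ 0) (v + (2 * (0 : ℝ)) • w)) 0 :=
      (hf'd (γ 0)).hasFDerivAt.comp_hasDerivAt 0 (hγ' 0)
    have h3 : HasDerivAt (fun τ : ℝ => v + (2 * τ) • w) ((2 : ℝ) • w) 0 := by
      simpa using (((hasDerivAt_id (0 : ℝ)).const_mul 2).smul_const w).const_add v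
    have h := (h1.mul (hfγ 0)).add ((hJ' 0).mul (h2.clm_apply h3))
    refine h.congr_deriv ?_
    simp only [hγ0, hJ0]
    simp
    ring

/-- Second derivatives along a slice are controlled by the scale-invariant jet: the tangent vectors
of the paraboloid have length `≲ (|ξ| / p)^{1/2}`, its curvature is of order `1 / p`, and the
density is `|ξ| / p`, so that every term carries `p⁻²` and the powers of `|ξ|` contained in the jet.
-/
lemma norm_lineDerivOp_lineDerivOp_slice_le {f : E4 → ℂ} (hf : ContDiff ℝ ∞ f) {R : ℝ}
    (hR : ∀ ξ, f ξ ≠ 0 → ‖ξ‖ ≤ R) {p : ℝ} (hp : 0 < p) (η m : E3) (hm : ‖m‖ = 1) :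
    ‖(∂_{m} (∂_{m} (slice b hf hR p))) η‖ ≤ 5 / p ^ 2 * jetSize f (nullFrame b (p, η)) := by
  rw [lineDerivOp_lineDerivOp_slice b hf hR hp η m hm]
  set γ₀ := nullFrame b (p, η) with hγ₀
  set v := frame b (-(inner ℝ η m / p), m) with hv
  set w := frame b (-(1 / (2 * p)), (0 : E3)) with hw
  have hJ := nullJac_nonneg (p, η)
  have hr : ‖γ₀‖ = p * nullJac (p, η) := norm_nullFrame b hp
  have hη : ‖η‖ ^ 2 = (2 * nullJac (p, η) - 1) * p ^ 2 := by
    simp only [nullJac]; field_simp; ring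
  have hin : (inner ℝ η m) ^ 2 ≤ ‖η‖ ^ 2 := by
    have := abs_real_inner_le_norm η m
    rw [hm, mul_one] at this
    exact sq_le_sq' (by linarith [neg_abs_le (inner ℝ η m)]) (le_trans (le_abs_self _) this)
  have hip : (inner ℝ η m / p) ^ 2 ≤ 2 * nullJac (p, η) - 1 := by
    rw [div_pow, div_le_iff₀ (by positivity), ← hη]; exact hin
  have hvn : ‖v‖ ^ 2 ≤ 2 * nullJac (p, η) := by
    rw [hv, norm_frame_sq, hm]; simp only []; nlinarith
  have hwn : ‖(2 : ℝ) • w‖ = 1 / p := by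
    have h2 : ‖w‖ ^ 2 = (1 / (2 * p)) ^ 2 := by rw [hw, norm_frame_sq]; simp
    have h3 : ‖w‖ = 1 / (2 * p) := (pow_left_inj₀ (norm_nonneg _) (by positivity) two_ne_zero).mp h2
    rw [norm_smul, h3]; simp; field_simp
  have hiv : |inner ℝ η m / p| * ‖v‖ ≤ 2 * nullJac (p, η) := by
    nlinarith [sq_nonneg (|inner ℝ η m / p| - ‖v‖), sq_abs (inner ℝ η m / p)]
  set F0 := ‖f γ₀‖
  set F1 := ‖fderiv ℝ f γ₀‖ with hF1
  set F2 := ‖fderiv ℝ (fderiv ℝ f) γ₀‖ with hF2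
  have e1 : ‖fderiv ℝ f γ₀ v‖ ≤ F1 * ‖v‖ := ContinuousLinearMap.le_opNorm _ _
  have e2 : ‖fderiv ℝ (fderiv ℝ f) γ₀ v v‖ ≤ F2 * ‖v‖ ^ 2 := by
    have := (fderiv ℝ (fderiv ℝ f) γ₀).le_opNorm₂ v v
    nlinarith
  have e3 : ‖fderiv ℝ f γ₀ ((2 : ℝ) • w)‖ ≤ F1 * (1 / p) := by
    rw [← hwn]; exact ContinuousLinearMap.le_opNorm _ _
  have F1n : 0 ≤ F1 := norm_nonneg _
  have F2n : 0 ≤ F2 := norm_nonneg (fderiv ℝ (fderiv ℝ f) γ₀)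
  have F0n : 0 ≤ F0 := norm_nonneg _
  set J := nullJac (p, η)
  calc _ ≤ (1 / p ^ 2) * F0 + 2 * |inner ℝ η m / p ^ 2| * (F1 * ‖v‖)
        + J * (F2 * ‖v‖ ^ 2 + F1 * (1 / p)) := by
        refine (norm_add₃_le).trans ?_
        simp only [norm_mul, Complex.norm_real, Real.norm_eq_abs, abs_of_nonneg hJ,
          Complex.norm_ofNat, abs_of_nonneg (show 0 ≤ 1 / p ^ 2 by positivity)]
        gcongr
        exact (norm_add_le _ _).trans (add_le_add e2 e3)
    _ = (1 / p ^ 2) * F0 + 2 / p * F1 * (|inner ℝ η m / p| * ‖v‖)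
        + J * (F2 * ‖v‖ ^ 2 + F1 * (1 / p)) := by
        rw [abs_div, abs_div, abs_of_pos hp, abs_of_pos (show 0 < p ^ 2 by positivity)]
        field_simp
    _ ≤ (1 / p ^ 2) * F0 + 2 / p * F1 * (2 * J) + J * (F2 * (2 * J) + F1 * (1 / p)) := by
        gcongr
    _ = 1 / p ^ 2 * (F0 + 5 * (p * J) * F1 + 2 * (p * J) ^ 2 * F2) := by
        field_simp; ring
    _ ≤ 1 / p ^ 2 * (5 * (F0 + (p * J) * F1 + (p * J) ^ 2 * F2)) := by
        have : 0 ≤ (p * J) ^ 2 * F2 := by positivity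
        gcongr
        nlinarith
    _ = 5 / p ^ 2 * jetSize f γ₀ := by
        rw [jetSize, hr]; ring

lemma norm_laplacian_slice_le {f : E4 → ℂ} (hf : ContDiff ℝ ∞ f) {R : ℝ}
    (hR : ∀ ξ, f ξ ≠ 0 → ‖ξ‖ ≤ R) {p : ℝ} (hp : 0 < p) (η : E3) :
    ‖(Δ (slice b hf hR p)) η‖ ≤ 15 / p ^ 2 * jetSize f (nullFrame b (p, η)) := by
  rw [SchwartzMap.laplacian_eq_sum (EuclideanSpace.basisFun (Fin 3) ℝ), _root_.sum_apply]
  refine (norm_sum_le _ _).trans ?_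
  calc _ ≤ ∑ _i : Fin 3, 5 / p ^ 2 * jetSize f (nullFrame b (p, η)) :=
        Finset.sum_le_sum fun i _ =>
          norm_lineDerivOp_lineDerivOp_slice_le b hf hR hp η _ (OrthonormalBasis.norm_eq_one _ i)
    _ = _ := by simp; ring

end

/-! ### The dispersive estimate for smooth functions -/

section

lemma eLpNorm_two_eq {α F : Type*} [MeasurableSpace α] [NormedAddCommGroup F] (μ : Measure α)
    (f : α → F) : eLpNorm f 2 μ = (∫⁻ x, ‖f x‖ₑ ^ 2 ∂μ) ^ (1 / 2 : ℝ) := by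
  rw [eLpNorm_eq_lintegral_rpow_enorm_toReal (by norm_num) (by norm_num)]
  simp

lemma eLpNorm_two_le_of_sq_le {α F : Type*} [MeasurableSpace α] [NormedAddCommGroup F]
    (μ : Measure α) (f : α → F) (g : α → ℝ≥0∞) (k : ℝ≥0∞) (hk : k ≠ ⊤)
    (h : ∀ x, ‖f x‖ₑ ^ 2 ≤ k ^ 2 * g x) :
    eLpNorm f 2 μ ≤ k * (∫⁻ x, g x ∂μ) ^ (1 / 2 : ℝ) := by
  rw [eLpNorm_two_eq]
  calc _ ≤ (∫⁻ x, k ^ 2 * g x ∂μ) ^ (1 / 2 : ℝ) := by gcongr with x; exact h x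
    _ = _ := by
      rw [lintegral_const_mul' _ _ (by finiteness), ENNReal.mul_rpow_of_nonneg _ _ (by norm_num),
        ← ENNReal.rpow_natCast, ← ENNReal.rpow_mul]
      norm_num

lemma ofReal_norm_toLp_two {V : Type*} [NormedAddCommGroup V] [InnerProductSpace ℝ V]
    [FiniteDimensional ℝ V] [MeasurableSpace V] [BorelSpace V] (h : 𝓢(V, ℂ)) :
    ENNReal.ofReal ‖h.toLp 2 volume‖ = eLpNorm h 2 volume := by
  rw [SchwartzMap.norm_toLp, ENNReal.ofReal_toReal (h.memLp 2 volume).2.ne]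

/-- The oscillating factor `e^{2πi (x·ξ + t|ξ|)}` of the half-wave evolution. -/
def wavePhase (x : E4) (t : ℝ) (ξ : E4) : ℂ :=
  Complex.exp (Complex.I * ((2 * π * (inner ℝ x ξ + t * ‖ξ‖) : ℝ) : ℂ))

lemma norm_wavePhase (x : E4) (t : ℝ) (ξ : E4) : ‖wavePhase x t ξ‖ = 1 := by
  rw [wavePhase, mul_comm, Complex.norm_exp_ofReal_mul_I]

lemma continuous_wavePhase (x : E4) (t : ℝ) : Continuous (wavePhase x t) := by
  unfold wavePhase; fun_prop

variable (b : OrthonormalBasis (Fin 4) ℝ E4)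

/-- In light-cone coordinates along the axis of `x`, the phase is exactly quadratic on slices. -/
lemma wavePhase_nullFrame {p : ℝ} (hp : 0 < p) (η : E3) (X t : ℝ) :
    wavePhase (X • b 0) t (nullFrame b (p, η)) =
      Complex.exp (Complex.I * ((π * (X + t) * p : ℝ) : ℂ))
        * Complex.exp (Complex.I * ((π * (t - X) / p : ℝ) : ℂ) * ‖η‖ ^ 2) := by
  rw [wavePhase, ← Complex.exp_add, norm_nullFrame b hp, inner_smul_left, nullFrame, inner_frame]
  congr 1
  rw [mul_assoc Complex.I, ← mul_add]
  congr 1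
  simp only [axial, nullJac, conj_trivial]
  push_cast
  have hpc : (p : ℂ) ≠ 0 := by exact_mod_cast hp.ne'
  field_simp
  ring

/-- The squared `L²` norm of `G` on a slice, with the density of the light-cone coordinates. -/
def sliceSq (G : E4 → ℝ) (p : ℝ) : ℝ≥0∞ :=
  ∫⁻ η : E3, ENNReal.ofReal (nullJac (p, η)) * ENNReal.ofReal (G (nullFrame b (p, η)) ^ 2)

lemma eLpNorm_slice_le {f : E4 → ℂ} (hf : ContDiff ℝ ∞ f) {R : ℝ}
    (hR : ∀ ξ, f ξ ≠ 0 → ‖ξ‖ ≤ R) {p : ℝ} (hp : 0 < p) :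
    eLpNorm (slice b hf hR p) 2 volume
      ≤ ENNReal.ofReal (2 / p) * sliceSq b (fun ξ => ‖ξ‖ * ‖f ξ‖) p ^ (1 / 2 : ℝ) := by
  refine eLpNorm_two_le_of_sq_le _ _ _ _ ENNReal.ofReal_ne_top fun η => ?_
  have hJ := nullJac_nonneg (p, η)
  have hJ2 : 1 / 2 ≤ nullJac (p, η) := by
    simp only [nullJac]
    have : 0 ≤ ‖η‖ ^ 2 / p ^ 2 := by positivity
    linarith
  rw [← ofReal_norm, ← ENNReal.ofReal_pow (norm_nonneg _),
    ← ENNReal.ofReal_mul hJ, ← ENNReal.ofReal_pow (by positivity),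
    ← ENNReal.ofReal_mul (by positivity)]
  refine ENNReal.ofReal_le_ofReal ?_
  beta_reduce
  rw [slice_apply, norm_mul, Complex.norm_real, Real.norm_eq_abs, abs_of_nonneg hJ,
    norm_nullFrame b hp]
  set J := nullJac (p, η)
  have : (2 / p) ^ 2 * (J * (p * J * ‖f (nullFrame b (p, η))‖) ^ 2)
      = 4 * J * (J * ‖f (nullFrame b (p, η))‖) ^ 2 := by field_simp; ring
  rw [this]
  nlinarith [sq_nonneg (J * ‖f (nullFrame b (p, η))‖)]

lemma eLpNorm_laplacian_slice_le {f : E4 → ℂ} (hf : ContDiff ℝ ∞ f) {R : ℝ}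
    (hR : ∀ ξ, f ξ ≠ 0 → ‖ξ‖ ≤ R) {p : ℝ} (hp : 0 < p) :
    eLpNorm (Δ (slice b hf hR p) : 𝓢(E3, ℂ)) 2 volume
      ≤ ENNReal.ofReal (30 / p ^ 2) * sliceSq b (jetSize f) p ^ (1 / 2 : ℝ) := by
  refine eLpNorm_two_le_of_sq_le _ _ _ _ ENNReal.ofReal_ne_top fun η => ?_
  have hJ := nullJac_nonneg (p, η)
  have hJ2 : 1 / 2 ≤ nullJac (p, η) := by
    simp only [nullJac]
    have : 0 ≤ ‖η‖ ^ 2 / p ^ 2 := by positivity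
    linarith
  rw [← ofReal_norm, ← ENNReal.ofReal_pow (norm_nonneg _),
    ← ENNReal.ofReal_mul hJ, ← ENNReal.ofReal_pow (by positivity),
    ← ENNReal.ofReal_mul (by positivity)]
  refine ENNReal.ofReal_le_ofReal ?_
  have h := norm_laplacian_slice_le b hf hR hp η
  calc ‖(Δ (slice b hf hR p)) η‖ ^ 2 ≤ (15 / p ^ 2 * jetSize f (nullFrame b (p, η))) ^ 2 := by
        gcongr
    _ = (30 / p ^ 2) ^ 2 * (1 / 4 * jetSize f (nullFrame b (p, η)) ^ 2) := by ring
    _ ≤ _ := by gcongr; linarith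

lemma lintegral_sliceSq {G : E4 → ℝ} (hG : Continuous G) :
    ∫⁻ p in Set.Ioi (0 : ℝ), sliceSq b G p = ∫⁻ ξ, ENNReal.ofReal (G ξ ^ 2) :=
  (lintegral_nullFrame b ((hG.pow 2).measurable.ennreal_ofReal)).symm

lemma measurable_sliceSq {G : E4 → ℝ} (hG : Continuous G) : Measurable (sliceSq b G) := by
  have hm := (measurePreserving_nullFrame b).measurable
  refine Measurable.lintegral_prod_right' (f := fun z : ℝ × E3 =>
    ENNReal.ofReal (nullJac z) * ENNReal.ofReal (G (nullFrame b z) ^ 2)) ?_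
  exact measurable_nullJac.ennreal_ofReal.mul
    (((hG.measurable.comp hm).pow_const 2).ennreal_ofReal)

lemma sqrt_lintegral_ofReal_sq {G : E4 → ℝ} :
    (∫⁻ ξ, ENNReal.ofReal (G ξ ^ 2)) ^ (1 / 2 : ℝ) = eLpNorm G 2 volume := by
  rw [eLpNorm_two_eq]
  congr 1
  refine lintegral_congr fun ξ => ?_
  rw [← ofReal_norm, ← ENNReal.ofReal_pow (norm_nonneg _), Real.norm_eq_abs, sq_abs]

/-- Cauchy-Schwarz in the slice variable `p`. On the support of an amplitude with frequencies below
`R` one has `p ≤ 2R`; this is the source of the power `R^{1/4}`. -/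
lemma lintegral_rpow_mul_sliceSq_le {G : E4 → ℝ} (hG : Continuous G) {R : ℝ} (hR : 0 < R) :
    ∫⁻ p in Set.Ioc 0 (2 * R), ENNReal.ofReal (p ^ (-(1 / 4) : ℝ)) * sliceSq b G p ^ (1 / 2 : ℝ)
      ≤ ENNReal.ofReal (2 * R ^ (1 / 4 : ℝ)) * eLpNorm G 2 volume := by
  have hmm : Measurable (fun p : ℝ => ENNReal.ofReal (p ^ (-(1 / 4) : ℝ))) := by fun_prop
  have h := ENNReal.lintegral_mul_le_Lp_mul_Lq (volume.restrict (Set.Ioc 0 (2 * R)))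
    (p := 2) (q := 2) ⟨by norm_num, by norm_num, by norm_num⟩ hmm.aemeasurable
    (g := fun p => sliceSq b G p ^ (1 / 2 : ℝ))
    ((measurable_sliceSq b hG).pow_const _).aemeasurable
  refine h.trans (mul_le_mul' ?_ ?_)
  · have h1 : ∫⁻ p in Set.Ioc 0 (2 * R), ENNReal.ofReal (p ^ (-(1 / 4) : ℝ)) ^ (2 : ℝ)
        = ENNReal.ofReal (2 * (2 * R) ^ (1 / 2 : ℝ)) := by
      have h2 : ∫⁻ p in Set.Ioc 0 (2 * R), ENNReal.ofReal (p ^ (-(1 / 4) : ℝ)) ^ (2 : ℝ)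
          = ∫⁻ p in Set.Ioc 0 (2 * R), ENNReal.ofReal (p ^ (-(1 / 2) : ℝ)) := by
        refine setLIntegral_congr_fun measurableSet_Ioc fun p hp => ?_
        have hp0 : 0 < p := hp.1
        rw [ENNReal.ofReal_rpow_of_nonneg (by positivity) (by norm_num), ← rpow_mul hp0.le]
        norm_num
      rw [h2, ← ofReal_integral_eq_lintegral_ofReal]
      · rw [← intervalIntegral.integral_of_le (by positivity), integral_rpow (by norm_num)]
        congr 1
        norm_num
        ring
      · change IntegrableOn _ _ _
        rw [← intervalIntegrable_iff_integrableOn_Ioc_of_le (by positivity)]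
        exact intervalIntegral.intervalIntegrable_rpow' (by norm_num)
      · filter_upwards [ae_restrict_mem measurableSet_Ioc] with p hp
        exact rpow_nonneg hp.1.le _
    rw [h1, ENNReal.ofReal_rpow_of_nonneg (by positivity) (by norm_num)]
    refine ENNReal.ofReal_le_ofReal ?_
    have h3 : (2 * R ^ (1 / 4 : ℝ)) = (4 * R ^ (1 / 2 : ℝ)) ^ (1 / 2 : ℝ) := by
      rw [mul_rpow (by norm_num) (by positivity), ← rpow_mul hR.le]
      congr 1
      · rw [show (4 : ℝ) = 2 ^ (2 : ℝ) by norm_num, ← rpow_mul (by norm_num)]; norm_num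
      · norm_num
    rw [h3, mul_rpow (by norm_num) hR.le]
    have h4 : (2 : ℝ) ^ (1 / 2 : ℝ) ≤ 2 := by
      calc (2 : ℝ) ^ (1 / 2 : ℝ) ≤ 2 ^ (1 : ℝ) := by gcongr <;> norm_num
        _ = 2 := by norm_num
    have h5 : 0 ≤ R ^ (1 / 2 : ℝ) := by positivity
    refine rpow_le_rpow (by positivity) ?_ (by norm_num)
    nlinarith
  · rw [← sqrt_lintegral_ofReal_sq, ← lintegral_sliceSq b hG]
    refine ENNReal.rpow_le_rpow ?_ (by norm_num)
    simp_rw [← ENNReal.rpow_mul]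
    norm_num
    exact lintegral_mono_set Set.Ioc_subset_Ioi_self

/-- Dispersive decay for smooth amplitudes with bounded frequency support. Only the weighted norms
of the amplitude enter that are invariant under the scaling of the half-wave equation, up to the
power of the frequency bound `R`. -/
lemma exists_dispersive_smooth :
    ∃ c : ℝ, 0 < c ∧ ∀ (f : E4 → ℂ), ContDiff ℝ ∞ f → ∀ R : ℝ, 0 < R →
      (∀ ξ, f ξ ≠ 0 → ‖ξ‖ ≤ R) → ∀ (x : E4) (t A : ℝ), t ≠ 0 → 0 < A →
      ‖∫ ξ, wavePhase x t ξ * f ξ‖ₑ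
        ≤ ENNReal.ofReal (c * |t| ^ (-(3 / 2) : ℝ) * R ^ (1 / 4 : ℝ)) *
          (ENNReal.ofReal (A ^ (3 / 2 : ℝ)) * eLpNorm (fun ξ => ‖ξ‖ * ‖f ξ‖) 2 volume
            + ENNReal.ofReal (A ^ (-(1 / 2) : ℝ)) * eLpNorm (jetSize f) 2 volume) := by
  obtain ⟨c, hc, hcb⟩ := exists_schroedinger_dispersive
  refine ⟨60 * c, by positivity, fun f hf R hRp hR x t A ht hA => ?_⟩
  have htp : 0 < |t| := abs_pos.mpr ht
  -- On the slice `p = const` the phase has curvature proportional to `(t - X) / p`. The axis is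
  -- oriented so that `X` and `t` have opposite signs, whence `|t - X| ≥ |t|`.
  obtain ⟨b, X, hX, hXt⟩ : ∃ (b : OrthonormalBasis (Fin 4) ℝ E4) (X : ℝ),
      x = X • b 0 ∧ X * t ≤ 0 := by
    obtain ⟨e, Y, he, hxe⟩ : ∃ (e : E4) (Y : ℝ), ‖e‖ = 1 ∧ x = Y • e := by
      by_cases hx : x = 0
      · exact ⟨EuclideanSpace.single 0 1, 0, by simp, by simp [hx]⟩
      · exact ⟨‖x‖⁻¹ • x, ‖x‖, by
          rw [norm_smul, norm_inv, norm_norm, inv_mul_cancel₀ (norm_ne_zero_iff.mpr hx)], by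
          rw [smul_smul, mul_inv_cancel₀ (norm_ne_zero_iff.mpr hx), one_smul]⟩
    obtain ⟨e', Y', he', hxe', hY'⟩ : ∃ (e' : E4) (Y' : ℝ), ‖e'‖ = 1 ∧ x = Y' • e' ∧ Y' * t ≤ 0 := by
      rcases le_total (Y * t) 0 with h | h
      · exact ⟨e, Y, he, hxe, h⟩
      · exact ⟨-e, -Y, by simpa using he, by simpa using hxe, by linarith⟩
    have horth : Orthonormal ℝ (({0} : Set (Fin 4)).domRestrict (fun _ => e')) := by
      refine ⟨fun i => he', fun i j hij => ?_⟩
      exact absurd (Subtype.ext (i.2.trans j.2.symm)) hij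
    obtain ⟨b, hb⟩ := horth.exists_orthonormalBasis_extension_of_card_eq (by simp)
    exact ⟨b, Y', by rw [hb 0 rfl]; exact hxe', hY'⟩
  subst hX
  set α := ENNReal.ofReal (A ^ (3 / 2 : ℝ))
  set β := ENNReal.ofReal (A ^ (-(1 / 2) : ℝ))
  set G₀ : E4 → ℝ := fun ξ => ‖ξ‖ * ‖f ξ‖ with hG₀
  have hG₀c : Continuous G₀ := continuous_norm.mul hf.continuous.norm
  have hG₁c : Continuous (jetSize f) := continuous_jetSize hf
  have hfc : HasCompactSupport f :=
    HasCompactSupport.of_support_subset_isCompact (isCompact_closedBall (0 : E4) R)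
      fun ξ hξ => by simpa using hR ξ hξ
  have hint : Integrable (fun ξ => wavePhase (X • b 0) t ξ * f ξ) :=
    ((continuous_wavePhase _ t).mul hf.continuous).integrable_of_hasCompactSupport hfc.mul_left
  set k : ℝ≥0∞ := ENNReal.ofReal (30 * c * |t| ^ (-(3 / 2) : ℝ)) with hk
  have hslice : ∀ p : ℝ, 0 < p → ‖∫ η : E3, (nullJac (p, η) : ℂ) *
      (wavePhase (X • b 0) t (nullFrame b (p, η)) * f (nullFrame b (p, η)))‖ₑ
      ≤ k * (α * (ENNReal.ofReal (p ^ (-(1 / 4) : ℝ)) * sliceSq b G₀ p ^ (1 / 2 : ℝ))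
        + β * (ENNReal.ofReal (p ^ (-(1 / 4) : ℝ)) * sliceSq b (jetSize f) p ^ (1 / 2 : ℝ))) := by
    intro p hp
    set h := slice b hf hR p with hh
    set T := π * (t - X) / p with hT
    have htX : |t| ≤ |t - X| := by
      rw [← sq_le_sq]; nlinarith [sq_nonneg X]
    have hTabs : |t| / p ≤ |T| := by
      rw [hT, abs_div, abs_mul, abs_of_pos hp, abs_of_pos pi_pos]
      gcongr
      nlinarith [pi_gt_three]
    have hT0 : T ≠ 0 := abs_pos.mp (lt_of_lt_of_le (by positivity) hTabs)
    have e1 : ∫ η : E3, (nullJac (p, η) : ℂ) *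
        (wavePhase (X • b 0) t (nullFrame b (p, η)) * f (nullFrame b (p, η)))
        = Complex.exp (Complex.I * ((π * (X + t) * p : ℝ) : ℂ)) *
          ∫ η, Complex.exp (Complex.I * T * ‖η‖ ^ 2) * h η := by
      rw [← integral_const_mul]
      refine integral_congr_ae (ae_of_all _ fun η => ?_)
      beta_reduce
      rw [wavePhase_nullFrame b hp, hh, slice_apply]
      ring
    -- The scale `A p^{-1/2}` makes both terms carry the same power of `p` below.
    have e2 : ‖∫ η : E3, (nullJac (p, η) : ℂ) *
        (wavePhase (X • b 0) t (nullFrame b (p, η)) * f (nullFrame b (p, η)))‖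
        ≤ c * |T| ^ (-(3 / 2) : ℝ) * ((A * p ^ (-(1 / 2) : ℝ)) ^ (3 / 2 : ℝ) * ‖h.toLp 2 volume‖
          + (A * p ^ (-(1 / 2) : ℝ)) ^ (-(1 / 2) : ℝ) * ‖(Δ h).toLp 2 volume‖) := by
      rw [e1, norm_mul, mul_comm Complex.I, Complex.norm_exp_ofReal_mul_I, one_mul]
      exact hcb h T (A * p ^ (-(1 / 2) : ℝ)) hT0 (by positivity)
    have e3 : |T| ^ (-(3 / 2) : ℝ) ≤ |t| ^ (-(3 / 2) : ℝ) * p ^ (3 / 2 : ℝ) := by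
      calc |T| ^ (-(3 / 2) : ℝ) ≤ (|t| / p) ^ (-(3 / 2) : ℝ) :=
            rpow_le_rpow_of_nonpos (by positivity) hTabs (by norm_num)
        _ = _ := by
          rw [div_rpow htp.le hp.le, rpow_neg hp.le, div_inv_eq_mul]
    have e4 : (A * p ^ (-(1 / 2) : ℝ)) ^ (3 / 2 : ℝ) = A ^ (3 / 2 : ℝ) * p ^ (-(3 / 4) : ℝ) := by
      rw [mul_rpow hA.le (by positivity), ← rpow_mul hp.le]; norm_num
    have e5 : (A * p ^ (-(1 / 2) : ℝ)) ^ (-(1 / 2) : ℝ)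
        = A ^ (-(1 / 2) : ℝ) * p ^ (1 / 4 : ℝ) := by
      rw [mul_rpow hA.le (by positivity), ← rpow_mul hp.le]; norm_num
    have e6 : ‖∫ η : E3, (nullJac (p, η) : ℂ) *
        (wavePhase (X • b 0) t (nullFrame b (p, η)) * f (nullFrame b (p, η)))‖
        ≤ c * |t| ^ (-(3 / 2) : ℝ) * (A ^ (3 / 2 : ℝ) * (p ^ (3 / 4 : ℝ) * ‖h.toLp 2 volume‖)
          + A ^ (-(1 / 2) : ℝ) * (p ^ (7 / 4 : ℝ) * ‖(Δ h).toLp 2 volume‖)) := by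
      refine e2.trans ?_
      rw [e4, e5]
      calc _ ≤ c * (|t| ^ (-(3 / 2) : ℝ) * p ^ (3 / 2 : ℝ)) *
            (A ^ (3 / 2 : ℝ) * p ^ (-(3 / 4) : ℝ) * ‖h.toLp 2 volume‖
              + A ^ (-(1 / 2) : ℝ) * p ^ (1 / 4 : ℝ) * ‖(Δ h).toLp 2 volume‖) := by gcongr
        _ = _ := by
          have h1 : p ^ (3 / 4 : ℝ) = p ^ (3 / 2 : ℝ) * p ^ (-(3 / 4) : ℝ) := by
            rw [← rpow_add hp]; norm_num
          have h2 : p ^ (7 / 4 : ℝ) = p ^ (3 / 2 : ℝ) * p ^ (1 / 4 : ℝ) := by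
            rw [← rpow_add hp]; norm_num
          rw [h1, h2]
          ring
    have h7 : ENNReal.ofReal (p ^ (3 / 4 : ℝ)) * eLpNorm h 2 volume
        ≤ 30 * (ENNReal.ofReal (p ^ (-(1 / 4) : ℝ)) * sliceSq b G₀ p ^ (1 / 2 : ℝ)) := by
      calc _ ≤ ENNReal.ofReal (p ^ (3 / 4 : ℝ)) *
            (ENNReal.ofReal (2 / p) * sliceSq b G₀ p ^ (1 / 2 : ℝ)) := by
              gcongr; exact eLpNorm_slice_le b hf hR hp
        _ = ENNReal.ofReal (2 * p ^ (-(1 / 4) : ℝ)) * sliceSq b G₀ p ^ (1 / 2 : ℝ) := by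
              rw [← mul_assoc, ← ENNReal.ofReal_mul (by positivity)]
              congr 2
              rw [show (-(1 / 4) : ℝ) = 3 / 4 - 1 by norm_num, rpow_sub hp, rpow_one]
              ring
        _ ≤ _ := by
              rw [← mul_assoc, ← ENNReal.ofReal_ofNat 30, ← ENNReal.ofReal_mul (by norm_num)]
              gcongr
              norm_num
    have h8 : ENNReal.ofReal (p ^ (7 / 4 : ℝ)) * eLpNorm (Δ h : 𝓢(E3, ℂ)) 2 volume
        ≤ 30 * (ENNReal.ofReal (p ^ (-(1 / 4) : ℝ)) * sliceSq b (jetSize f) p ^ (1 / 2 : ℝ)) := by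
      calc _ ≤ ENNReal.ofReal (p ^ (7 / 4 : ℝ)) *
            (ENNReal.ofReal (30 / p ^ 2) * sliceSq b (jetSize f) p ^ (1 / 2 : ℝ)) := by
              gcongr; exact eLpNorm_laplacian_slice_le b hf hR hp
        _ = ENNReal.ofReal (30 * p ^ (-(1 / 4) : ℝ)) * sliceSq b (jetSize f) p ^ (1 / 2 : ℝ) := by
              rw [← mul_assoc, ← ENNReal.ofReal_mul (by positivity)]
              congr 2
              rw [show (-(1 / 4) : ℝ) = 7 / 4 - (2 : ℕ) by norm_num, rpow_sub hp, rpow_natCast]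
              ring
        _ ≤ _ := by
              rw [← mul_assoc, ← ENNReal.ofReal_ofNat 30, ← ENNReal.ofReal_mul (by norm_num)]
    rw [← ofReal_norm]
    calc _ ≤ ENNReal.ofReal _ := ENNReal.ofReal_le_ofReal e6
      _ = ENNReal.ofReal (c * |t| ^ (-(3 / 2) : ℝ)) *
          (α * (ENNReal.ofReal (p ^ (3 / 4 : ℝ)) * eLpNorm h 2 volume)
            + β * (ENNReal.ofReal (p ^ (7 / 4 : ℝ)) * eLpNorm (Δ h : 𝓢(E3, ℂ)) 2 volume)) := by
          rw [ENNReal.ofReal_mul (p := c * |t| ^ (-(3 / 2) : ℝ)) (by positivity),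
            ENNReal.ofReal_add (by positivity) (by positivity),
            ENNReal.ofReal_mul (p := A ^ (3 / 2 : ℝ)) (by positivity),
            ENNReal.ofReal_mul (p := p ^ (3 / 4 : ℝ)) (by positivity),
            ENNReal.ofReal_mul (p := A ^ (-(1 / 2) : ℝ)) (by positivity),
            ENNReal.ofReal_mul (p := p ^ (7 / 4 : ℝ)) (by positivity),
            ofReal_norm_toLp_two, ofReal_norm_toLp_two]
      _ ≤ ENNReal.ofReal (c * |t| ^ (-(3 / 2) : ℝ)) *
          (α * (30 * (ENNReal.ofReal (p ^ (-(1 / 4) : ℝ)) * sliceSq b G₀ p ^ (1 / 2 : ℝ)))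
            + β * (30 * (ENNReal.ofReal (p ^ (-(1 / 4) : ℝ)) *
              sliceSq b (jetSize f) p ^ (1 / 2 : ℝ)))) := by gcongr
      _ = _ := by
          rw [hk, mul_assoc 30 c, ENNReal.ofReal_mul (by norm_num : (0 : ℝ) ≤ 30),
            ENNReal.ofReal_ofNat]
          ring
  have hvanish : ∀ p : ℝ, 2 * R < p → ∫ η : E3, (nullJac (p, η) : ℂ) *
      (wavePhase (X • b 0) t (nullFrame b (p, η)) * f (nullFrame b (p, η))) = 0 := by
    intro p hp
    have hp0 : 0 < p := by linarith
    refine integral_eq_zero_of_ae (ae_of_all _ fun η => ?_)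
    have : f (nullFrame b (p, η)) = 0 := by
      by_contra hne
      have h1 := hR _ hne
      rw [norm_nullFrame b hp0] at h1
      have hJ2 : 1 / 2 ≤ nullJac (p, η) := by
        simp only [nullJac]
        have : 0 ≤ ‖η‖ ^ 2 / p ^ 2 := by positivity
        linarith
      nlinarith
    simp [this]
  rw [integral_nullFrame b hint]
  refine (enorm_integral_le_lintegral_enorm _).trans ?_
  calc _ ≤ ∫⁻ p in Set.Ioi (0 : ℝ), (Set.Ioc 0 (2 * R)).indicator (fun p =>
        k * (α * (ENNReal.ofReal (p ^ (-(1 / 4) : ℝ)) * sliceSq b G₀ p ^ (1 / 2 : ℝ))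
        + β * (ENNReal.ofReal (p ^ (-(1 / 4) : ℝ)) * sliceSq b (jetSize f) p ^ (1 / 2 : ℝ)))) p := by
        refine setLIntegral_mono' measurableSet_Ioi fun p hp => ?_
        by_cases h : p ≤ 2 * R
        · rw [Set.indicator_of_mem (show p ∈ Set.Ioc 0 (2 * R) from ⟨hp, h⟩)]
          exact hslice p hp
        · rw [hvanish p (not_le.mp h)]; simp
    _ = ∫⁻ p in Set.Ioc (0 : ℝ) (2 * R),
        k * (α * (ENNReal.ofReal (p ^ (-(1 / 4) : ℝ)) * sliceSq b G₀ p ^ (1 / 2 : ℝ))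
        + β * (ENNReal.ofReal (p ^ (-(1 / 4) : ℝ)) * sliceSq b (jetSize f) p ^ (1 / 2 : ℝ))) := by
        rw [setLIntegral_indicator measurableSet_Ioc,
          Set.inter_eq_left.mpr Set.Ioc_subset_Ioi_self]
    _ ≤ k * (α * (ENNReal.ofReal (2 * R ^ (1 / 4 : ℝ)) * eLpNorm G₀ 2 volume)
        + β * (ENNReal.ofReal (2 * R ^ (1 / 4 : ℝ)) * eLpNorm (jetSize f) 2 volume)) := by
        have m0 := (measurable_sliceSq b hG₀c).pow_const (1 / 2 : ℝ)
        rw [lintegral_const_mul' _ _ ENNReal.ofReal_ne_top, lintegral_add_left' ?_,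
          lintegral_const_mul' _ _ ENNReal.ofReal_ne_top,
          lintegral_const_mul' _ _ ENNReal.ofReal_ne_top]
        · gcongr
          · exact lintegral_rpow_mul_sliceSq_le b hG₀c hRp
          · exact lintegral_rpow_mul_sliceSq_le b hG₁c hRp
        · have : Measurable fun p : ℝ => ENNReal.ofReal (p ^ (-(1 / 4) : ℝ)) := by fun_prop
          exact ((this.mul m0).const_mul α).aemeasurable
    _ = _ := by
        rw [hk, show 60 * c * |t| ^ (-(3 / 2) : ℝ) * R ^ (1 / 4 : ℝ)
          = (30 * c * |t| ^ (-(3 / 2) : ℝ)) * (2 * R ^ (1 / 4 : ℝ)) by ring,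
          ENNReal.ofReal_mul (by positivity : 0 ≤ 30 * c * |t| ^ (-(3 / 2) : ℝ))]
        ring

end

/-! ### Weak derivatives and the Fourier transform on `L²` -/

/-- The coordinate direction `e_j` of `ℝ⁴`. -/
def coordDir (j : Fin 4) : E4 := EuclideanSpace.single j 1

lemma inner_coordDir (y : E4) (j : Fin 4) : inner ℝ y (coordDir j) = y j := by
  simp [coordDir, EuclideanSpace.inner_single_right]

lemma norm_coordDir (j : Fin 4) : ‖coordDir j‖ = 1 := by simp [coordDir]

lemma ae_eq_of_forall_schwartz {f g : E4 → ℂ} (hf : LocallyIntegrable f)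
    (hg : LocallyIntegrable g) (h : ∀ φ : 𝓢(E4, ℂ), ∫ ξ, φ ξ * f ξ = ∫ ξ, φ ξ * g ξ) :
    f =ᵐ[volume] g := by
  refine ae_eq_of_integral_contDiff_smul_eq hf hg fun u hu hus => ?_
  have hu' : ContDiff ℝ ∞ (fun ξ => (u ξ : ℂ)) := Complex.ofRealCLM.contDiff.comp hu
  have hus' : HasCompactSupport (fun ξ => (u ξ : ℂ)) := hus.comp_left (g := Complex.ofReal) rfl
  simpa [Complex.real_smul] using h (hus'.toSchwartzMap hu')

lemma integral_mul_fourierInv (K : L2C) (φ : 𝓢(E4, ℂ)) :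
    ∫ y, φ y * (𝓕⁻ K : L2C) y = ∫ ξ, (𝓕⁻ φ) ξ * K ξ := by
  have h := DFunLike.congr_fun (Lp.fourierInv_toTemperedDistribution_eq K) φ
  rw [TemperedDistribution.fourierInv_apply, Lp.toTemperedDistribution_apply,
    Lp.toTemperedDistribution_apply] at h
  simpa [smul_eq_mul] using h.symm

lemma integral_mul_fourier (K : L2C) (φ : 𝓢(E4, ℂ)) :
    ∫ y, φ y * (𝓕 K : L2C) y = ∫ ξ, (𝓕 φ) ξ * K ξ := by
  have h := DFunLike.congr_fun (Lp.fourier_toTemperedDistribution_eq K) φ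
  rw [TemperedDistribution.fourier_apply, Lp.toTemperedDistribution_apply,
    Lp.toTemperedDistribution_apply] at h
  simpa [smul_eq_mul] using h.symm

/-- `g` is the weak derivative of `f` on `ℝ⁴` in the direction `v`. -/
def WeakDeriv (v : E4) (f g : E4 → ℂ) : Prop :=
  ∀ φ : 𝓢(E4, ℂ), ∫ ξ, (∂_{v} φ) ξ * f ξ = -∫ ξ, φ ξ * g ξ

lemma locallyIntegrable_L2C (u : L2C) : LocallyIntegrable u volume :=
  (Lp.memLp u).locallyIntegrable (by norm_num)

/-- Weak derivatives become multiplications under the inverse Fourier transform on `L²`. -/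
lemma fourierInv_weakDeriv {v : E4} {u g : L2C} (h : WeakDeriv v u g) :
    ∀ᵐ y, (𝓕⁻ g : L2C) y = -(2 * π * Complex.I) * (inner ℝ y v : ℝ) * (𝓕⁻ u : L2C) y := by
  have ht : (fun y : E4 => inner ℝ y v).HasTemperateGrowth := by fun_prop
  have hc : Continuous fun y : E4 => -(2 * π * Complex.I) * ((inner ℝ y v : ℝ) : ℂ) := by fun_prop
  refine ae_eq_of_forall_schwartz (locallyIntegrable_L2C _)
    ((locallyIntegrable_L2C (𝓕⁻ u)).continuous_mul hc) fun φ => ?_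
  rw [integral_mul_fourierInv]
  have h1 := h (𝓕⁻ φ)
  have h2 : ∂_{v} (𝓕⁻ φ) = 𝓕⁻ ((2 * π * Complex.I) • SchwartzMap.smulLeftCLM ℂ (inner ℝ · v) φ) :=
    SchwartzMap.lineDerivOp_fourierInv_eq φ v
  rw [h2, ← integral_mul_fourierInv] at h1
  rw [← neg_eq_iff_eq_neg] at h1
  rw [← h1, ← integral_neg]
  refine integral_congr_ae (ae_of_all _ fun y => ?_)
  beta_reduce
  rw [_root_.smul_apply, SchwartzMap.smulLeftCLM_apply_apply ht, smul_eq_mul, Complex.real_smul]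
  ring

lemma memLp_one_add_norm_sq_mul (K : L2C) (K₂ : Fin 4 → L2C)
    (h : ∀ i, ∀ᵐ y, K₂ i y
      = -(2 * π * Complex.I) * (y i : ℝ) * (-(2 * π * Complex.I) * (y i : ℝ) * K y)) :
    MemLp (fun y : E4 => ((1 + ‖y‖ ^ 2 : ℝ) : ℂ) * K y) 2 volume := by
  have hs : MemLp (fun y : E4 => ∑ i : Fin 4, K₂ i y) 2 volume :=
    memLp_finsetSum Finset.univ fun i _ => Lp.memLp (K₂ i)
  have hs' : MemLp (fun y : E4 => ((-(2 * π) ^ 2 : ℂ)⁻¹) * ∑ i : Fin 4, K₂ i y) 2 volume :=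
    hs.const_mul _
  have hsum : MemLp (fun y : E4 => K y + ((-(2 * π) ^ 2 : ℂ)⁻¹) * ∑ i : Fin 4, K₂ i y) 2 volume :=
    (Lp.memLp K).add hs'
  refine (memLp_congr_ae ?_).mp hsum
  filter_upwards [ae_all_iff.mpr h] with y hy
  simp only [hy, EuclideanSpace.norm_sq_eq, Real.norm_eq_abs, sq_abs]
  push_cast
  have hpi : (π : ℂ) ≠ 0 := by exact_mod_cast pi_ne_zero
  rw [add_mul, one_mul, Finset.sum_mul]
  congr 1
  rw [Finset.mul_sum]
  refine Finset.sum_congr rfl fun i _ => ?_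
  field_simp
  linear_combination (-(y i : ℂ) ^ 2 * K y) * Complex.I_sq

/-- `L²` functions with two weak derivatives in `L²` are approximated by Schwartz functions
together with these derivatives. On the Fourier side one approximates `(1 + |y|²) û`. -/
lemma exists_schwartz_approx (u : L2C) (u₁ : Fin 4 → L2C) (u₂ : Fin 4 → Fin 4 → L2C)
    (h₁ : ∀ j, WeakDeriv (coordDir j) u (u₁ j))
    (h₂ : ∀ i j, WeakDeriv (coordDir i) (u₁ j) (u₂ i j)) {ε : ℝ} (hε : 0 < ε) :
    ∃ f : 𝓢(E4, ℂ), ‖f.toLp 2 volume - u‖ ≤ ε ∧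
      (∀ j, ‖(∂_{coordDir j} f).toLp 2 volume - u₁ j‖ ≤ ε) ∧
      ∀ i j, ‖(∂_{coordDir i} (∂_{coordDir j} f)).toLp 2 volume - u₂ i j‖ ≤ ε := by
  set K : L2C := 𝓕⁻ u with hK
  have d₁ : ∀ j, ∀ᵐ y, (𝓕⁻ (u₁ j) : L2C) y = -(2 * π * Complex.I) * (y j : ℝ) * K y := fun j => by
    simpa only [inner_coordDir] using fourierInv_weakDeriv (h₁ j)
  have d₂ : ∀ i j, ∀ᵐ y, (𝓕⁻ (u₂ i j) : L2C) y
      = -(2 * π * Complex.I) * (y i : ℝ) * (-(2 * π * Complex.I) * (y j : ℝ) * K y) := fun i j => by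
    have := fourierInv_weakDeriv (h₂ i j)
    simp only [inner_coordDir] at this
    filter_upwards [this, d₁ j] with y hy hy'
    rw [hy, hy']
  -- `H = (1 + |y|²) K` is in `L²`
  set w : E4 → ℂ := fun y => ((1 + ‖y‖ ^ 2 : ℝ) : ℂ) with hw
  have hHmem : MemLp (fun y => w y * K y) 2 volume :=
    memLp_one_add_norm_sq_mul K (fun i => 𝓕⁻ (u₂ i i)) fun i => d₂ i i
  set H : L2C := hHmem.toLp _ with hH
  have hHy : ∀ᵐ y, H y = w y * K y := hHmem.coeFn_toLp
  set δ : ℝ := ε / (2 * π + 1) ^ 2 with hδ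
  have hpp : 0 < (2 * π + 1) ^ 2 := by positivity
  have hδ0 : 0 < δ := by positivity
  obtain ⟨Hk, hHk⟩ : ∃ Hk : 𝓢(E4, ℂ), ‖Hk.toLp 2 volume - H‖ < δ := by
    have hd := SchwartzMap.denseRange_toLpCLM (E := E4) (F := ℂ) (p := 2) (μ := volume)
      (by norm_num)
    obtain ⟨Hk, hHk⟩ := hd.exists_dist_lt H hδ0
    exact ⟨Hk, by rw [← norm_neg, neg_sub]; simpa [dist_eq_norm] using hHk⟩
  set v : E4 → ℂ := fun y => (((1 + ‖y‖ ^ 2) ^ (-1 : ℝ) : ℝ) : ℂ) with hv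
  have hvt : v.HasTemperateGrowth := by
    have := Function.hasTemperateGrowth_one_add_norm_sq_rpow (H := E4) (-1)
    simp only [hv]; fun_prop
  have hvw : ∀ y, v y * w y = 1 := fun y => by
    have : (0 : ℝ) < 1 + ‖y‖ ^ 2 := by positivity
    simp only [hv, hw]
    rw [← Complex.ofReal_mul, rpow_neg_one, inv_mul_cancel₀ this.ne', Complex.ofReal_one]
  set Kk : 𝓢(E4, ℂ) := SchwartzMap.smulLeftCLM ℂ v Hk with hKk
  have hKky : ∀ y, Kk y = v y * Hk y := fun y => by
    rw [hKk, SchwartzMap.smulLeftCLM_apply_apply hvt, smul_eq_mul]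
  -- all multipliers below are bounded by `(2π + 1)² (1 + |y|²)`
  have main : ∀ (g : 𝓢(E4, ℂ)) (z : L2C) (q : E4 → ℂ), (∀ y, g y = q y * Kk y) →
      (∀ᵐ y, z y = q y * K y) → (∀ y, ‖q y‖ ≤ (2 * π + 1) ^ 2 * (1 + ‖y‖ ^ 2)) →
      ‖g.toLp 2 volume - z‖ ≤ ε := by
    intro g z q hg hz hq
    have h : ‖g.toLp 2 volume - z‖ ≤ (2 * π + 1) ^ 2 * ‖Hk.toLp 2 volume - H‖ := by
      refine Lp.norm_le_mul_norm_of_ae_le_mul ?_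
      filter_upwards [Lp.coeFn_sub (g.toLp 2 volume) z, Lp.coeFn_sub (Hk.toLp 2 volume) H,
        g.coeFn_toLp 2 volume, Hk.coeFn_toLp 2 volume, hz, hHy] with y e1 e2 e3 e4 e5 e6
      rw [e1, e2, Pi.sub_apply, Pi.sub_apply, e3, e4, e5, e6, hg, hKky]
      have : q y * (v y * Hk y) - q y * K y = q y * v y * (Hk y - w y * K y) := by
        linear_combination q y * K y * hvw y
      rw [this, norm_mul]
      refine mul_le_mul_of_nonneg_right ?_ (norm_nonneg _)
      have hy0 : (0 : ℝ) < 1 + ‖y‖ ^ 2 := by positivity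
      have hvn : ‖v y‖ = (1 + ‖y‖ ^ 2)⁻¹ := by
        simp only [hv, Complex.norm_real, Real.norm_eq_abs, rpow_neg_one]
        exact abs_of_pos (by positivity)
      rw [norm_mul, hvn, ← div_eq_mul_inv, div_le_iff₀ hy0]
      exact hq y
    calc _ ≤ (2 * π + 1) ^ 2 * δ := h.trans (by gcongr)
      _ = ε := by rw [hδ]; field_simp
  have hyj : ∀ (y : E4) j, |y j| ≤ ‖y‖ := fun y j => by
    simpa using PiLp.norm_apply_le y j
  have hqt : ∀ j : Fin 4, (fun y : E4 => inner ℝ y (coordDir j)).HasTemperateGrowth := fun j => by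
    fun_prop
  have isom : ∀ (g : 𝓢(E4, ℂ)) (z : L2C), ‖(𝓕 g).toLp 2 volume - z‖
      = ‖g.toLp 2 volume - 𝓕⁻ z‖ := fun g z => by
    have h : 𝓕 (g.toLp 2 volume - 𝓕⁻ z) = 𝓕 (g.toLp 2 volume) - z := by
      rw [sub_eq_add_neg, FourierTransform.fourier_add, FourierTransform.fourier_neg,
        FourierTransform.fourier_fourierInv_eq, sub_eq_add_neg]
    rw [← SchwartzMap.toLp_fourier_eq, ← Lp.norm_fourier_eq (g.toLp 2 volume - 𝓕⁻ z), h]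
  refine ⟨𝓕 Kk, ?_, fun j => ?_, fun i j => ?_⟩
  · rw [isom]
    refine main _ _ (fun _ => 1) (fun y => by simp) (ae_of_all _ fun y => by simp [hK])
      (fun y => ?_)
    simp only [norm_one]
    nlinarith [pi_gt_three, sq_nonneg ‖y‖]
  · rw [SchwartzMap.lineDerivOp_fourier_eq, isom]
    refine main _ _ (fun y => -(2 * π * Complex.I) * (y j : ℝ)) (fun y => ?_) (d₁ j) fun y => ?_
    · rw [_root_.smul_apply, SchwartzMap.smulLeftCLM_apply_apply (hqt j), inner_coordDir,
        Complex.real_smul, smul_eq_mul]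
      ring
    · simp only [norm_mul, norm_neg, Complex.norm_I, Complex.norm_ofNat, Complex.norm_real,
        Real.norm_eq_abs, abs_of_pos pi_pos]
      have := hyj y j
      have h2 : 2 * ‖y‖ ≤ 1 + ‖y‖ ^ 2 := by nlinarith [sq_nonneg (‖y‖ - 1)]
      calc 2 * π * 1 * |y j| = π * (2 * |y j|) := by ring
        _ ≤ π * (1 + ‖y‖ ^ 2) := by gcongr; linarith
        _ ≤ _ := by gcongr; nlinarith [pi_pos]
  · rw [SchwartzMap.lineDerivOp_fourier_eq, SchwartzMap.lineDerivOp_fourier_eq, isom]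
    refine main _ _ (fun y => -(2 * π * Complex.I) * (y i : ℝ) * (-(2 * π * Complex.I) * (y j : ℝ)))
      (fun y => ?_) ?_ fun y => ?_
    · rw [_root_.smul_apply, SchwartzMap.smulLeftCLM_apply_apply (hqt i), _root_.smul_apply,
        SchwartzMap.smulLeftCLM_apply_apply (hqt j), inner_coordDir, inner_coordDir,
        Complex.real_smul, smul_eq_mul, smul_eq_mul, Complex.real_smul]
      ring
    · filter_upwards [d₂ i j] with y hy
      rw [hy]; ring
    · simp only [norm_mul, norm_neg, Complex.norm_I, Complex.norm_ofNat, Complex.norm_real,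
        Real.norm_eq_abs, abs_of_pos pi_pos]
      have h1 : |y i| * |y j| ≤ ‖y‖ ^ 2 := by
        rw [sq]; exact mul_le_mul (hyj y i) (hyj y j) (abs_nonneg _) (norm_nonneg _)
      calc 2 * π * 1 * |y i| * (2 * π * 1 * |y j|) = (2 * π) ^ 2 * (|y i| * |y j|) := by ring
        _ ≤ (2 * π + 1) ^ 2 * (1 + ‖y‖ ^ 2) := by
          gcongr
          · linarith
          · linarith

/-! ### The dispersive estimate for weakly differentiable functions -/

lemma eq_sum_coordDir (y : E4) : y = ∑ j, y j • coordDir j := by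
  have h := (EuclideanSpace.basisFun (Fin 4) ℝ).sum_repr y
  simpa [coordDir] using h.symm

lemma norm_clm_le_sum {F : Type*} [NormedAddCommGroup F] [NormedSpace ℝ F] (L : E4 →L[ℝ] F) :
    ‖L‖ ≤ ∑ j, ‖L (coordDir j)‖ := by
  refine L.opNorm_le_bound (Finset.sum_nonneg fun _ _ => norm_nonneg _) fun y => ?_
  conv_lhs => rw [eq_sum_coordDir y, map_sum]
  refine (norm_sum_le _ _).trans ?_
  rw [Finset.sum_mul]
  refine Finset.sum_le_sum fun j _ => ?_
  rw [map_smul, norm_smul, mul_comm]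
  gcongr
  simpa using PiLp.norm_apply_le y j

/-- The partial derivatives of a Schwartz function, as plain functions. -/
def partials (f : 𝓢(E4, ℂ)) (j : Fin 4) : E4 → ℂ := (∂_{coordDir j} f : 𝓢(E4, ℂ))

/-- The second partial derivatives of a Schwartz function, as plain functions. -/
def secondPartials (f : 𝓢(E4, ℂ)) (i j : Fin 4) : E4 → ℂ :=
  (∂_{coordDir i} (∂_{coordDir j} f : 𝓢(E4, ℂ)) : 𝓢(E4, ℂ))

lemma norm_fderiv_le_sum (f : 𝓢(E4, ℂ)) (ξ : E4) :
    ‖fderiv ℝ f ξ‖ ≤ ∑ j, ‖partials f j ξ‖ := by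
  simpa only [partials, SchwartzMap.lineDerivOp_apply_eq_fderiv] using norm_clm_le_sum (fderiv ℝ f ξ)

lemma lineDerivOp_lineDerivOp_apply (f : 𝓢(E4, ℂ)) (v w : E4) (ξ : E4) :
    (∂_{v} (∂_{w} f : 𝓢(E4, ℂ)) : 𝓢(E4, ℂ)) ξ = fderiv ℝ (fderiv ℝ f) ξ v w := by
  rw [SchwartzMap.lineDerivOp_apply_eq_fderiv]
  have h : ⇑(∂_{w} f : 𝓢(E4, ℂ)) = fun ξ => fderiv ℝ f ξ w := by
    ext ξ; rw [SchwartzMap.lineDerivOp_apply_eq_fderiv]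
  have hd : DifferentiableAt ℝ (fderiv ℝ f) ξ :=
    ((f.smooth 2).fderiv_right (m := 1) (by norm_num)).differentiable (by norm_num) ξ
  rw [h, fderiv_clm_apply hd (differentiableAt_const w)]
  simp

lemma norm_fderiv_fderiv_le_sum (f : 𝓢(E4, ℂ)) (ξ : E4) :
    ‖fderiv ℝ (fderiv ℝ f) ξ‖ ≤ ∑ i, ∑ j, ‖secondPartials f i j ξ‖ := by
  refine (norm_clm_le_sum _).trans (Finset.sum_le_sum fun i _ => ?_)
  simpa only [secondPartials, lineDerivOp_lineDerivOp_apply] using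
    norm_clm_le_sum (fderiv ℝ (fderiv ℝ f) ξ (coordDir i))

lemma norm_fderiv_eq (f : E4 → ℂ) (ξ : E4) : ‖fderiv ℝ f ξ‖ = ‖iteratedFDeriv ℝ 1 f ξ‖ := by
  rw [← norm_iteratedFDeriv_fderiv, norm_iteratedFDeriv_zero]

lemma norm_fderiv_fderiv_eq (f : E4 → ℂ) (ξ : E4) :
    ‖fderiv ℝ (fderiv ℝ f) ξ‖ = ‖iteratedFDeriv ℝ 2 f ξ‖ := by
  rw [← norm_iteratedFDeriv_fderiv, ← norm_iteratedFDeriv_fderiv, norm_iteratedFDeriv_zero]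

/-- The size at `ξ` of a function and its weak derivatives of order at most two, with the weights
that make it invariant under dilations. -/
def weakJet (u : E4 → ℂ) (u₁ : Fin 4 → E4 → ℂ) (u₂ : Fin 4 → Fin 4 → E4 → ℂ) (ξ : E4) : ℝ :=
  ‖u ξ‖ + ‖ξ‖ * ∑ j, ‖u₁ j ξ‖ + ‖ξ‖ ^ 2 * ∑ i, ∑ j, ‖u₂ i j ξ‖

/-- The unweighted sum of a function and its derivatives of order at most two. -/
def flatJet (u : E4 → ℂ) (u₁ : Fin 4 → E4 → ℂ) (u₂ : Fin 4 → Fin 4 → E4 → ℂ) (ξ : E4) : ℝ :=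
  ‖u ξ‖ + ∑ j, ‖u₁ j ξ‖ + ∑ i, ∑ j, ‖u₂ i j ξ‖

lemma exists_cutoff (R : ℝ) (hR : 0 < R) : ∃ χ : 𝓢(E4, ℂ),
    (∀ ξ, ‖ξ‖ < 2 * R → χ =ᶠ[nhds ξ] 1) ∧ (∀ ξ, χ ξ ≠ 0 → ‖ξ‖ ≤ 3 * R) ∧ ∀ ξ, ‖χ ξ‖ ≤ 1 := by
  let b : ContDiffBump (0 : E4) := ⟨2 * R, 3 * R, by linarith, by linarith⟩
  have hb : ContDiff ℝ ∞ (fun ξ => (b ξ : ℂ)) := Complex.ofRealCLM.contDiff.comp b.contDiff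
  have hbs : HasCompactSupport (fun ξ => (b ξ : ℂ)) :=
    b.hasCompactSupport.comp_left (g := Complex.ofReal) rfl
  refine ⟨hbs.toSchwartzMap hb, fun ξ hξ => ?_, fun ξ hξ => ?_, fun ξ => ?_⟩
  · have hmem : ξ ∈ Metric.ball (0 : E4) b.rIn := by simpa using hξ
    filter_upwards [b.eventuallyEq_one_of_mem_ball hmem] with η hη
    simp [hη]
  · by_contra hlt
    refine hξ ?_
    have : b ξ = 0 := b.zero_of_le_dist (by simp only [dist_zero_right]; exact (not_le.mp hlt).le)
    simp [this]
  · have h1 := b.nonneg (x := ξ)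
    have h2 := b.le_one (x := ξ)
    simp [abs_of_nonneg h1, h2]

lemma exists_seminorm_bound (χ : 𝓢(E4, ℂ)) : ∃ B : ℝ, 1 ≤ B ∧ ∀ k ≤ 2, ∀ i ≤ 2, ∀ ξ : E4,
    ‖ξ‖ ^ k * ‖iteratedFDeriv ℝ i χ ξ‖ ≤ B := by
  choose b hb using fun k i => χ.decay k i
  refine ⟨1 + ∑ k ∈ Finset.range 3, ∑ i ∈ Finset.range 3, b k i, ?_, fun k hk i hi ξ => ?_⟩
  · have : 0 ≤ ∑ k ∈ Finset.range 3, ∑ i ∈ Finset.range 3, b k i :=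
      Finset.sum_nonneg fun k _ => Finset.sum_nonneg fun i _ => (hb k i).1.le
    linarith
  · refine ((hb k i).2 ξ).trans ?_
    have h1 : b k i ≤ ∑ i ∈ Finset.range 3, b k i :=
      Finset.single_le_sum (f := fun i => b k i) (fun i _ => (hb k i).1.le)
        (Finset.mem_range.mpr (by omega))
    have h2 : ∑ i ∈ Finset.range 3, b k i ≤ ∑ k ∈ Finset.range 3, ∑ i ∈ Finset.range 3, b k i :=
      Finset.single_le_sum (f := fun k => ∑ i ∈ Finset.range 3, b k i)
        (fun k _ => Finset.sum_nonneg fun i _ => (hb k i).1.le)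
        (Finset.mem_range.mpr (by omega))
    linarith

lemma jetSize_le_weakJet_add (f : 𝓢(E4, ℂ)) (u : E4 → ℂ) (u₁ : Fin 4 → E4 → ℂ)
    (u₂ : Fin 4 → Fin 4 → E4 → ℂ) (ξ : E4) :
    jetSize f ξ ≤ weakJet u u₁ u₂ ξ + (1 + ‖ξ‖ + ‖ξ‖ ^ 2) * flatJet (fun ξ => f ξ - u ξ)
      (fun j ξ => partials f j ξ - u₁ j ξ) (fun i j ξ => secondPartials f i j ξ - u₂ i j ξ) ξ := by
  have s0 : ‖f ξ‖ ≤ ‖u ξ‖ + ‖f ξ - u ξ‖ := by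
    simpa using norm_add_le (u ξ) (f ξ - u ξ)
  have s1 : ∑ j, ‖partials f j ξ‖ ≤ ∑ j, ‖u₁ j ξ‖ + ∑ j, ‖partials f j ξ - u₁ j ξ‖ := by
    rw [← Finset.sum_add_distrib]
    refine Finset.sum_le_sum fun j _ => ?_
    simpa using norm_add_le (u₁ j ξ) (partials f j ξ - u₁ j ξ)
  have s2 : ∑ i, ∑ j, ‖secondPartials f i j ξ‖ ≤ ∑ i, ∑ j, ‖u₂ i j ξ‖
      + ∑ i, ∑ j, ‖secondPartials f i j ξ - u₂ i j ξ‖ := by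
    simp only [← Finset.sum_add_distrib]
    refine Finset.sum_le_sum fun i _ => Finset.sum_le_sum fun j _ => ?_
    simpa using norm_add_le (u₂ i j ξ) (secondPartials f i j ξ - u₂ i j ξ)
  have d1 := (norm_fderiv_le_sum f ξ).trans s1
  have d2 := (norm_fderiv_fderiv_le_sum f ξ).trans s2
  have e0 : 0 ≤ ‖f ξ - u ξ‖ := norm_nonneg _
  have e1 : 0 ≤ ∑ j, ‖partials f j ξ - u₁ j ξ‖ := Finset.sum_nonneg fun _ _ => norm_nonneg _
  have e2 : 0 ≤ ∑ i, ∑ j, ‖secondPartials f i j ξ - u₂ i j ξ‖ :=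
    Finset.sum_nonneg fun _ _ => Finset.sum_nonneg fun _ _ => norm_nonneg _
  unfold jetSize weakJet flatJet
  generalize ∑ j, ‖partials f j ξ - u₁ j ξ‖ = E₁ at *
  generalize ∑ i, ∑ j, ‖secondPartials f i j ξ - u₂ i j ξ‖ = E₂ at *
  generalize ∑ j, ‖u₁ j ξ‖ = U₁ at *
  generalize ∑ i, ∑ j, ‖u₂ i j ξ‖ = U₂ at *
  have hr := norm_nonneg ξ
  calc _ ≤ (‖u ξ‖ + ‖f ξ - u ξ‖) + ‖ξ‖ * (U₁ + E₁) + ‖ξ‖ ^ 2 * (U₂ + E₂) := by gcongr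
    _ ≤ _ := by
      have h1 : 0 ≤ (‖ξ‖ + ‖ξ‖ ^ 2) * ‖f ξ - u ξ‖ := by positivity
      have h2 : 0 ≤ (1 + ‖ξ‖ ^ 2) * E₁ := by positivity
      have h3 : 0 ≤ (1 + ‖ξ‖) * E₂ := by positivity
      linarith

lemma jetSize_mul_le {χ f : 𝓢(E4, ℂ)} {B : ℝ} (hB1 : 1 ≤ B) (hB : ∀ k ≤ 2, ∀ i ≤ 2, ∀ ξ : E4,
    ‖ξ‖ ^ k * ‖iteratedFDeriv ℝ i χ ξ‖ ≤ B) (ξ : E4) :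
    jetSize (fun ξ => χ ξ * f ξ) ξ
      ≤ 3 * B * (‖f ξ‖ + ‖fderiv ℝ f ξ‖ + ‖fderiv ℝ (fderiv ℝ f) ξ‖) := by
  have hχ2 : ContDiff ℝ 2 χ := χ.smooth 2
  have hf2 : ContDiff ℝ 2 f := f.smooth 2
  have p0 : ‖χ ξ‖ ≤ B := by simpa using hB 0 (by norm_num) 0 (by norm_num) ξ
  have p1 : ‖fderiv ℝ (fun ξ => χ ξ * f ξ) ξ‖
      ≤ ‖χ ξ‖ * ‖fderiv ℝ f ξ‖ + ‖iteratedFDeriv ℝ 1 χ ξ‖ * ‖f ξ‖ := by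
    rw [norm_fderiv_eq, norm_fderiv_eq]
    have := norm_iteratedFDeriv_mul_le (n := 1) hχ2 hf2 ξ (by norm_num)
    simpa [Finset.sum_range_succ] using this
  have p2 : ‖fderiv ℝ (fderiv ℝ fun ξ => χ ξ * f ξ) ξ‖
      ≤ ‖χ ξ‖ * ‖fderiv ℝ (fderiv ℝ f) ξ‖ + 2 * ‖iteratedFDeriv ℝ 1 χ ξ‖ * ‖fderiv ℝ f ξ‖
        + ‖iteratedFDeriv ℝ 2 χ ξ‖ * ‖f ξ‖ := by
    rw [norm_fderiv_fderiv_eq, norm_fderiv_fderiv_eq, norm_fderiv_eq]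
    have := norm_iteratedFDeriv_mul_le (n := 2) hχ2 hf2 ξ (by norm_num)
    simpa [Finset.sum_range_succ] using this
  have b10 : ‖ξ‖ * ‖χ ξ‖ ≤ B := by simpa using hB 1 (by norm_num) 0 (by norm_num) ξ
  have b11 : ‖ξ‖ * ‖iteratedFDeriv ℝ 1 χ ξ‖ ≤ B := by
    simpa using hB 1 (by norm_num) 1 (by norm_num) ξ
  have b20 : ‖ξ‖ ^ 2 * ‖χ ξ‖ ≤ B := by simpa using hB 2 le_rfl 0 (by norm_num) ξ
  have b21 := hB 2 le_rfl 1 (by norm_num) ξ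
  have b22 := hB 2 le_rfl 2 le_rfl ξ
  have hn0 := norm_nonneg (f ξ)
  have hn1 := norm_nonneg (fderiv ℝ f ξ)
  have hn2 : 0 ≤ ‖fderiv ℝ (fderiv ℝ f) ξ‖ := norm_nonneg (E := E4 →L[ℝ] E4 →L[ℝ] ℂ) _
  unfold jetSize
  rw [norm_mul]
  generalize ‖fderiv ℝ (fderiv ℝ fun ξ => χ ξ * f ξ) ξ‖ = G₂ at *
  generalize ‖fderiv ℝ (fun ξ => χ ξ * f ξ) ξ‖ = G₁ at *
  generalize ‖fderiv ℝ (fderiv ℝ f) ξ‖ = F₂ at *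
  generalize ‖fderiv ℝ f ξ‖ = F₁ at *
  generalize ‖f ξ‖ = F₀ at *
  generalize ‖iteratedFDeriv ℝ 1 χ ξ‖ = X₁ at *
  generalize ‖iteratedFDeriv ℝ 2 χ ξ‖ = X₂ at *
  have hr := norm_nonneg ξ
  calc _ ≤ ‖χ ξ‖ * F₀ + ‖ξ‖ * (‖χ ξ‖ * F₁ + X₁ * F₀)
        + ‖ξ‖ ^ 2 * (‖χ ξ‖ * F₂ + 2 * X₁ * F₁ + X₂ * F₀) := by gcongr
    _ = ‖χ ξ‖ * F₀ + (‖ξ‖ * ‖χ ξ‖) * F₁ + (‖ξ‖ * X₁) * F₀ + (‖ξ‖ ^ 2 * ‖χ ξ‖) * F₂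
        + 2 * (‖ξ‖ ^ 2 * X₁) * F₁ + (‖ξ‖ ^ 2 * X₂) * F₀ := by ring
    _ ≤ B * F₀ + B * F₁ + B * F₀ + B * F₂ + 2 * B * F₁ + B * F₀ := by gcongr
    _ ≤ 3 * B * (F₀ + F₁ + F₂) := by nlinarith

/-- Cutting off an approximation `f` of a function `u` that lives in `|ξ| ≤ R`: where `χ = 1`, the
weights are bounded, and where it is not, `u` vanishes and the decay of `χ` absorbs the weights.
Hence the error `f - u` enters without weights. -/
lemma jetSize_mul_cutoff_le {R : ℝ} (hR : 0 < R) {χ : 𝓢(E4, ℂ)}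
    (hχ : ∀ ξ, ‖ξ‖ < 2 * R → χ =ᶠ[nhds ξ] 1) :
    ∃ C : ℝ, 0 < C ∧ ∀ (f : 𝓢(E4, ℂ)) (u : E4 → ℂ) (u₁ : Fin 4 → E4 → ℂ)
      (u₂ : Fin 4 → Fin 4 → E4 → ℂ) (ξ : E4),
      (R < ‖ξ‖ → u ξ = 0 ∧ (∀ j, u₁ j ξ = 0) ∧ ∀ i j, u₂ i j ξ = 0) →
      jetSize (fun ξ => χ ξ * f ξ) ξ ≤ weakJet u u₁ u₂ ξ + C * flatJet (fun ξ => f ξ - u ξ)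
        (fun j ξ => partials f j ξ - u₁ j ξ)
        (fun i j ξ => secondPartials f i j ξ - u₂ i j ξ) ξ := by
  obtain ⟨B, hB1, hB⟩ := exists_seminorm_bound χ
  refine ⟨3 * B + (1 + 2 * R + (2 * R) ^ 2), by positivity, fun f u u₁ u₂ ξ hu => ?_⟩
  set E := flatJet (fun ξ => f ξ - u ξ) (fun j ξ => partials f j ξ - u₁ j ξ)
        (fun i j ξ => secondPartials f i j ξ - u₂ i j ξ) ξ with hE
  have hE0 : 0 ≤ E := by rw [hE]; unfold flatJet; positivity
  rcases lt_or_ge ‖ξ‖ (2 * R) with hlt | hge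
  · have heq : (fun ξ => χ ξ * f ξ) =ᶠ[nhds ξ] f := by
      filter_upwards [hχ ξ hlt] with η hη
      simp [hη]
    have hj : jetSize (fun ξ => χ ξ * f ξ) ξ = jetSize f ξ := by
      simp only [jetSize]
      rw [heq.fderiv_eq, heq.fderiv.fderiv_eq, heq.eq_of_nhds]
    rw [hj]
    refine (jetSize_le_weakJet_add f u u₁ u₂ ξ).trans ?_
    have hr := norm_nonneg ξ
    have : ‖ξ‖ ^ 2 ≤ (2 * R) ^ 2 := by gcongr
    exact add_le_add le_rfl (mul_le_mul_of_nonneg_right (by linarith) hE0)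
  · obtain ⟨hu0, hu1, hu2⟩ := hu (by linarith)
    have hjet : ‖f ξ‖ + ‖fderiv ℝ f ξ‖ + ‖fderiv ℝ (fderiv ℝ f) ξ‖ ≤ E := by
      rw [hE]
      simp only [flatJet, hu0, hu1, hu2, sub_zero]
      exact add_le_add (add_le_add le_rfl (norm_fderiv_le_sum f ξ)) (norm_fderiv_fderiv_le_sum f ξ)
    have hw : 0 ≤ weakJet u u₁ u₂ ξ := by unfold weakJet; positivity
    have h1 : 0 ≤ (1 + 2 * R + (2 * R) ^ 2) * E := by positivity
    have h2 : 3 * B * (‖f ξ‖ + ‖fderiv ℝ f ξ‖ + ‖fderiv ℝ (fderiv ℝ f) ξ‖) ≤ 3 * B * E := by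
      gcongr
    linarith [jetSize_mul_le (f := f) hB1 hB ξ]

lemma eLpNorm_sum_le_card_mul {ι : Type*} [Fintype ι] {g : ι → E4 → ℝ}
    (hg : ∀ i, AEStronglyMeasurable (g i) volume) {ε : ℝ≥0∞}
    (h : ∀ i, eLpNorm (g i) 2 volume ≤ ε) :
    eLpNorm (fun ξ => ∑ i, g i ξ) 2 volume ≤ Fintype.card ι * ε := by
  have h1 := eLpNorm_sum_le (p := 2) (s := Finset.univ) (f := g) (fun i _ => hg i) (by norm_num)
  have h2 : (∑ i, g i) = fun ξ => ∑ i, g i ξ := by ext ξ; simp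
  rw [h2] at h1
  refine h1.trans ((Finset.sum_le_sum fun i _ => h i).trans (le_of_eq ?_))
  rw [Finset.sum_const, nsmul_eq_mul, Finset.card_univ]

lemma eLpNorm_flatJet_le {u : E4 → ℂ} {u₁ : Fin 4 → E4 → ℂ} {u₂ : Fin 4 → Fin 4 → E4 → ℂ}
    (hu : AEStronglyMeasurable u volume) (hu₁ : ∀ j, AEStronglyMeasurable (u₁ j) volume)
    (hu₂ : ∀ i j, AEStronglyMeasurable (u₂ i j) volume) {ε : ℝ≥0∞}
    (h : eLpNorm u 2 volume ≤ ε) (h₁ : ∀ j, eLpNorm (u₁ j) 2 volume ≤ ε)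
    (h₂ : ∀ i j, eLpNorm (u₂ i j) 2 volume ≤ ε) :
    eLpNorm (flatJet u u₁ u₂) 2 volume ≤ 21 * ε := by
  have m1 : AEStronglyMeasurable (fun ξ => ∑ j, ‖u₁ j ξ‖) volume :=
    Finset.aestronglyMeasurable_fun_sum _ fun j _ => (hu₁ j).norm
  have m2' : ∀ i, AEStronglyMeasurable (fun ξ => ∑ j, ‖u₂ i j ξ‖) volume :=
    fun i => Finset.aestronglyMeasurable_fun_sum _ fun j _ => (hu₂ i j).norm
  have m2 : AEStronglyMeasurable (fun ξ => ∑ i, ∑ j, ‖u₂ i j ξ‖) volume :=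
    Finset.aestronglyMeasurable_fun_sum _ fun i _ => m2' i
  have b1 : eLpNorm (fun ξ => ∑ j, ‖u₁ j ξ‖) 2 volume ≤ 4 * ε :=
    (eLpNorm_sum_le_card_mul (g := fun j ξ => ‖u₁ j ξ‖) (fun j => (hu₁ j).norm)
      (fun j => (eLpNorm_norm (u₁ j)).trans_le (h₁ j))).trans_eq (by simp)
  have b2' : ∀ i, eLpNorm (fun ξ => ∑ j, ‖u₂ i j ξ‖) 2 volume ≤ 4 * ε := fun i =>
    (eLpNorm_sum_le_card_mul (g := fun j ξ => ‖u₂ i j ξ‖) (fun j => (hu₂ i j).norm)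
      (fun j => (eLpNorm_norm (u₂ i j)).trans_le (h₂ i j))).trans_eq (by simp)
  have b2 : eLpNorm (fun ξ => ∑ i, ∑ j, ‖u₂ i j ξ‖) 2 volume ≤ 16 * ε := by
    refine (eLpNorm_sum_le_card_mul (g := fun i ξ => ∑ j, ‖u₂ i j ξ‖) m2' b2').trans_eq ?_
    rw [Fintype.card_fin, ← mul_assoc]
    norm_num
  have b0 : eLpNorm (fun ξ => ‖u ξ‖) 2 volume ≤ ε := (eLpNorm_norm u).trans_le h
  have s1 : eLpNorm (fun ξ => ‖u ξ‖ + ∑ j, ‖u₁ j ξ‖) 2 volume ≤ ε + 4 * ε :=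
    (eLpNorm_add_le hu.norm m1 (by norm_num)).trans (add_le_add b0 b1)
  have s2 : eLpNorm (flatJet u u₁ u₂) 2 volume ≤ ε + 4 * ε + 16 * ε :=
    (eLpNorm_add_le (hu.norm.add m1) m2 (by norm_num)).trans (add_le_add s1 b2)
  exact s2.trans_eq (by ring)

lemma ennreal_le_of_forall_ofReal_mul {X Y : ℝ≥0∞} {C : ℝ} (hC : 0 < C)
    (h : ∀ ε : ℝ, 0 < ε → X ≤ Y + ENNReal.ofReal (C * ε)) : X ≤ Y := by
  refine ENNReal.le_of_forall_pos_le_add fun η hη _ => ?_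
  have := h (η / C) (by positivity)
  rwa [mul_div_cancel₀ _ hC.ne', ENNReal.ofReal_coe_nnreal] at this

lemma WeakDeriv.congr_ae {v : E4} {u g u' g' : E4 → ℂ} (h : WeakDeriv v u g)
    (hu : u =ᵐ[volume] u') (hg : g =ᵐ[volume] g') : WeakDeriv v u' g' := fun φ => by
  have h1 : ∫ ξ, (∂_{v} φ) ξ * u ξ = ∫ ξ, (∂_{v} φ) ξ * u' ξ :=
    integral_congr_ae (hu.mono fun ξ hξ => congrArg ((∂_{v} φ) ξ * ·) hξ)
  have h2 : ∫ ξ, φ ξ * g ξ = ∫ ξ, φ ξ * g' ξ :=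
    integral_congr_ae (hg.mono fun ξ hξ => congrArg (φ ξ * ·) hξ)
  rw [← h1, ← h2]
  exact h φ

lemma eLpNorm_sub_le_of_toLp (f : 𝓢(E4, ℂ)) {u : E4 → ℂ} (hu : MemLp u 2 volume) {ε : ℝ}
    (h : ‖f.toLp 2 volume - hu.toLp u‖ ≤ ε) :
    eLpNorm (fun ξ => f ξ - u ξ) 2 volume ≤ ENNReal.ofReal ε := by
  have h1 : f.toLp 2 volume - hu.toLp u = ((f.memLp 2 volume).sub hu).toLp _ := rfl
  rw [h1, Lp.norm_toLp] at h
  exact (ENNReal.le_ofReal_iff_toReal_le ((f.memLp 2 volume).sub hu).2.ne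
    (ENNReal.toReal_nonneg.trans h)).mpr h

lemma aestronglyMeasurable_weakJet {u : E4 → ℂ} {u₁ : Fin 4 → E4 → ℂ}
    {u₂ : Fin 4 → Fin 4 → E4 → ℂ}
    (hu : AEStronglyMeasurable u volume) (hu₁ : ∀ j, AEStronglyMeasurable (u₁ j) volume)
    (hu₂ : ∀ i j, AEStronglyMeasurable (u₂ i j) volume) :
    AEStronglyMeasurable (weakJet u u₁ u₂) volume := by
  have m1 : AEStronglyMeasurable (fun ξ => ∑ j, ‖u₁ j ξ‖) volume :=
    Finset.aestronglyMeasurable_fun_sum _ fun j _ => (hu₁ j).norm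
  have m2 : AEStronglyMeasurable (fun ξ => ∑ i, ∑ j, ‖u₂ i j ξ‖) volume :=
    Finset.aestronglyMeasurable_fun_sum _ fun i _ =>
      Finset.aestronglyMeasurable_fun_sum _ fun j _ => (hu₂ i j).norm
  exact (hu.norm.add (continuous_norm.aestronglyMeasurable.mul m1)).add
    ((continuous_norm.pow 2).aestronglyMeasurable.mul m2)

lemma aestronglyMeasurable_flatJet {u : E4 → ℂ} {u₁ : Fin 4 → E4 → ℂ}
    {u₂ : Fin 4 → Fin 4 → E4 → ℂ}
    (hu : AEStronglyMeasurable u volume) (hu₁ : ∀ j, AEStronglyMeasurable (u₁ j) volume)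
    (hu₂ : ∀ i j, AEStronglyMeasurable (u₂ i j) volume) :
    AEStronglyMeasurable (flatJet u u₁ u₂) volume :=
  (hu.norm.add (Finset.aestronglyMeasurable_fun_sum _ fun j _ => (hu₁ j).norm)).add
    (Finset.aestronglyMeasurable_fun_sum _ fun i _ =>
      Finset.aestronglyMeasurable_fun_sum _ fun j _ => (hu₂ i j).norm)

lemma ofReal_affine {l k a b p q ε : ℝ} (hl : 0 ≤ l) (hk : 0 ≤ k) (ha : 0 ≤ a) (hb : 0 ≤ b)
    (hp : 0 ≤ p) (hq : 0 ≤ q) : ENNReal.ofReal ((l + k * (a * p + b * q)) * ε)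
      = (ENNReal.ofReal l + ENNReal.ofReal k * (ENNReal.ofReal a * ENNReal.ofReal p
        + ENNReal.ofReal b * ENNReal.ofReal q)) * ENNReal.ofReal ε := by
  rw [ENNReal.ofReal_mul (by positivity), ENNReal.ofReal_add hl (by positivity),
    ENNReal.ofReal_mul hk, ENNReal.ofReal_add (by positivity) (by positivity),
    ENNReal.ofReal_mul ha, ENNReal.ofReal_mul hb]

/-- Dispersive decay for amplitudes with two weak derivatives in `L²` and bounded frequency
support. -/
lemma exists_dispersive_weak :
    ∃ c : ℝ, 0 < c ∧ ∀ (u : E4 → ℂ) (u₁ : Fin 4 → E4 → ℂ) (u₂ : Fin 4 → Fin 4 → E4 → ℂ) (R : ℝ),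
      0 < R → MemLp u 2 → (∀ j, MemLp (u₁ j) 2) → (∀ i j, MemLp (u₂ i j) 2) →
      (∀ j, WeakDeriv (coordDir j) u (u₁ j)) →
      (∀ i j, WeakDeriv (coordDir i) (u₁ j) (u₂ i j)) →
      (∀ ξ, R < ‖ξ‖ → u ξ = 0 ∧ (∀ j, u₁ j ξ = 0) ∧ ∀ i j, u₂ i j ξ = 0) →
      ∀ (x : E4) (t A : ℝ), t ≠ 0 → 0 < A →
      ‖∫ ξ, wavePhase x t ξ * u ξ‖ₑ
        ≤ ENNReal.ofReal (c * |t| ^ (-(3 / 2) : ℝ) * R ^ (1 / 4 : ℝ)) *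
          (ENNReal.ofReal (A ^ (3 / 2 : ℝ)) * eLpNorm (fun ξ => ‖ξ‖ * ‖u ξ‖) 2 volume
            + ENNReal.ofReal (A ^ (-(1 / 2) : ℝ)) * eLpNorm (weakJet u u₁ u₂) 2 volume) := by
  obtain ⟨c, hc, hcb⟩ := exists_dispersive_smooth
  refine ⟨c * 3 ^ (1 / 4 : ℝ), by positivity,
    fun u u₁ u₂ R hR hu hu₁ hu₂ hw₁ hw₂ hsupp x t A ht hA => ?_⟩
  obtain ⟨χ, hχ1, hχs, hχb⟩ := exists_cutoff R hR
  obtain ⟨C, hC, hCb⟩ := jetSize_mul_cutoff_le hR hχ1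
  set k : ℝ := c * |t| ^ (-(3 / 2) : ℝ) * (3 * R) ^ (1 / 4 : ℝ) with hk
  have hkk : c * 3 ^ (1 / 4 : ℝ) * |t| ^ (-(3 / 2) : ℝ) * R ^ (1 / 4 : ℝ) = k := by
    rw [hk, mul_rpow (by norm_num) hR.le]; ring
  rw [hkk]
  have hk0 : 0 ≤ k := by rw [hk]; positivity
  have hA1 : 0 ≤ A ^ (3 / 2 : ℝ) := by positivity
  have hA2 : 0 ≤ A ^ (-(1 / 2) : ℝ) := by positivity
  have hχL : 0 ≤ ‖χ.toLp 2 volume‖ := norm_nonneg _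
  refine ennreal_le_of_forall_ofReal_mul (C := ‖χ.toLp 2 volume‖ + k * (A ^ (3 / 2 : ℝ) * (3 * R)
    + A ^ (-(1 / 2) : ℝ) * (C * 21)) + 1) (by positivity) fun ε hε => ?_
  have hW₁ : ∀ j, WeakDeriv (coordDir j) (hu.toLp u) ((hu₁ j).toLp (u₁ j)) := fun j =>
    (hw₁ j).congr_ae hu.coeFn_toLp.symm (hu₁ j).coeFn_toLp.symm
  have hW₂ : ∀ i j, WeakDeriv (coordDir i) ((hu₁ j).toLp (u₁ j)) ((hu₂ i j).toLp (u₂ i j)) :=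
    fun i j => (hw₂ i j).congr_ae (hu₁ j).coeFn_toLp.symm (hu₂ i j).coeFn_toLp.symm
  obtain ⟨f, hf0, hf1, hf2⟩ := exists_schwartz_approx (hu.toLp u) (fun j => (hu₁ j).toLp (u₁ j))
    (fun i j => (hu₂ i j).toLp (u₂ i j)) hW₁ hW₂ hε
  set F : E4 → ℂ := fun ξ => χ ξ * f ξ with hF
  have hFc : ContDiff ℝ ∞ F := (χ.smooth ⊤).mul (f.smooth ⊤)
  have hFs : ∀ ξ, F ξ ≠ 0 → ‖ξ‖ ≤ 3 * R := fun ξ h => hχs ξ (left_ne_zero_of_mul h)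
  have n0 := eLpNorm_sub_le_of_toLp f hu hf0
  have n1 : ∀ j, eLpNorm (fun ξ => partials f j ξ - u₁ j ξ) 2 volume ≤ ENNReal.ofReal ε :=
    fun j => eLpNorm_sub_le_of_toLp _ (hu₁ j) (hf1 j)
  have n2 : ∀ i j, eLpNorm (fun ξ => secondPartials f i j ξ - u₂ i j ξ) 2 volume
      ≤ ENNReal.ofReal ε := fun i j => eLpNorm_sub_le_of_toLp _ (hu₂ i j) (hf2 i j)
  have p1 : ∀ j, AEStronglyMeasurable (partials f j) volume := fun j =>
    (SchwartzMap.continuous _).aestronglyMeasurable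
  have p2 : ∀ i j, AEStronglyMeasurable (secondPartials f i j) volume := fun i j =>
    (SchwartzMap.continuous _).aestronglyMeasurable
  have hm0 : AEStronglyMeasurable (fun ξ => f ξ - u ξ) volume :=
    f.continuous.aestronglyMeasurable.sub hu.1
  have hm1 : ∀ j, AEStronglyMeasurable (fun ξ => partials f j ξ - u₁ j ξ) volume :=
    fun j => (p1 j).sub (hu₁ j).1
  have hm2 : ∀ i j, AEStronglyMeasurable (fun ξ => secondPartials f i j ξ - u₂ i j ξ) volume :=
    fun i j => (p2 i j).sub (hu₂ i j).1
  have hflat := eLpNorm_flatJet_le hm0 hm1 hm2 n0 n1 n2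
  set J := flatJet (fun ξ => f ξ - u ξ) (fun j ξ => partials f j ξ - u₁ j ξ)
    (fun i j ξ => secondPartials f i j ξ - u₂ i j ξ) with hJ
  have hJm : AEStronglyMeasurable J volume :=
    aestronglyMeasurable_flatJet hm0 hm1 hm2
  have hWm : AEStronglyMeasurable (weakJet u u₁ u₂) volume :=
    aestronglyMeasurable_weakJet hu.1 (fun j => (hu₁ j).1) (fun i j => (hu₂ i j).1)
  have hjet : eLpNorm (jetSize F) 2 volume
      ≤ eLpNorm (weakJet u u₁ u₂) 2 volume + ENNReal.ofReal (C * 21) * ENNReal.ofReal ε := by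
    refine (eLpNorm_mono_real fun ξ => ?_).trans
      ((eLpNorm_add_le hWm (hJm.const_mul C) (by norm_num)).trans ?_)
    · rw [Real.norm_of_nonneg (by unfold jetSize; positivity)]
      exact hCb f u u₁ u₂ ξ (hsupp ξ)
    · refine add_le_add le_rfl ?_
      have : eLpNorm (fun ξ => C * J ξ) 2 volume = ENNReal.ofReal C * eLpNorm J 2 volume := by
        have := eLpNorm_const_smul (p := 2) (μ := (volume : Measure E4)) C J
        rwa [Real.enorm_of_nonneg hC.le] at this
      rw [this, ENNReal.ofReal_mul hC.le, mul_assoc]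
      gcongr
      simpa using hflat
  have hrad : eLpNorm (fun ξ => ‖ξ‖ * ‖F ξ‖) 2 volume
      ≤ eLpNorm (fun ξ => ‖ξ‖ * ‖u ξ‖) 2 volume + ENNReal.ofReal (3 * R) * ENNReal.ofReal ε := by
    have hd : eLpNorm (fun ξ => 3 * R * ‖f ξ - u ξ‖) 2 volume
        = ENNReal.ofReal (3 * R) * eLpNorm (fun ξ => f ξ - u ξ) 2 volume := by
      have := eLpNorm_const_smul (p := 2) (μ := (volume : Measure E4)) (3 * R)
        (fun ξ => ‖f ξ - u ξ‖)
      rwa [Real.enorm_of_nonneg (by positivity), eLpNorm_norm] at this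
    refine (eLpNorm_mono_real (g := fun ξ => ‖ξ‖ * ‖u ξ‖ + 3 * R * ‖f ξ - u ξ‖) fun ξ => ?_).trans
      ((eLpNorm_add_le (continuous_norm.aestronglyMeasurable.mul hu.1.norm)
        (hm0.norm.const_mul _) (by norm_num)).trans (add_le_add le_rfl ?_))
    · rw [Real.norm_of_nonneg (by positivity), hF]
      beta_reduce
      by_cases h0 : χ ξ = 0
      · rw [h0]; simp only [zero_mul, norm_zero, mul_zero]; positivity
      · have h3 := hχs ξ h0
        have h4 : ‖f ξ‖ ≤ ‖u ξ‖ + ‖f ξ - u ξ‖ := by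
          simpa using norm_add_le (u ξ) (f ξ - u ξ)
        calc ‖ξ‖ * ‖χ ξ * f ξ‖ ≤ ‖ξ‖ * (1 * (‖u ξ‖ + ‖f ξ - u ξ‖)) := by
              rw [norm_mul]; gcongr; exact hχb ξ
          _ = ‖ξ‖ * ‖u ξ‖ + ‖ξ‖ * ‖f ξ - u ξ‖ := by ring
          _ ≤ _ := by gcongr
    · rw [hd]; gcongr
  -- the oscillatory integrals of `u` and `F` differ by the integral of `χ (u - f)`
  have hdiff : ‖∫ ξ, wavePhase x t ξ * u ξ‖ₑ
      ≤ ‖∫ ξ, wavePhase x t ξ * F ξ‖ₑ + ENNReal.ofReal (‖χ.toLp 2 volume‖) * ENNReal.ofReal ε := by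
    have hχu : ∀ ξ, u ξ = χ ξ * u ξ := fun ξ => by
      rcases lt_or_ge R ‖ξ‖ with h | h
      · simp [(hsupp ξ h).1]
      · have := (hχ1 ξ (by linarith)).eq_of_nhds
        rw [this]; simp
    have hW : Continuous fun ξ => wavePhase x t ξ * χ ξ :=
      (continuous_wavePhase x t).mul χ.continuous
    have hWχ : MemLp (fun ξ => wavePhase x t ξ * χ ξ) 2 volume :=
      (memLp_congr_norm hW.aestronglyMeasurable χ.continuous.aestronglyMeasurable
        (ae_of_all _ fun ξ => by rw [norm_mul, norm_wavePhase, one_mul])).mpr (χ.memLp 2 volume)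
    have hfu : MemLp (fun ξ => f ξ - u ξ) 2 volume := (f.memLp 2 volume).sub hu
    have i1 : Integrable (fun ξ => wavePhase x t ξ * F ξ) volume := by
      have := hWχ.integrable_mul (f.memLp 2 volume)
      refine this.congr (ae_of_all _ fun ξ => ?_)
      simp only [Pi.mul_apply, hF]; ring
    have i2 : Integrable (fun ξ => (wavePhase x t ξ * χ ξ) * (f ξ - u ξ)) volume :=
      hWχ.integrable_mul hfu
    have heq : ∫ ξ, wavePhase x t ξ * u ξ = (∫ ξ, wavePhase x t ξ * F ξ)
        - ∫ ξ, (wavePhase x t ξ * χ ξ) * (f ξ - u ξ) := by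
      rw [← integral_sub i1 i2]
      refine integral_congr_ae (ae_of_all _ fun ξ => ?_)
      simp only [hF]
      conv_lhs => rw [hχu ξ]
      ring
    rw [heq]
    refine enorm_sub_le.trans (add_le_add le_rfl ?_)
    refine (enorm_integral_le_lintegral_enorm _).trans ?_
    have hhol := eLpNorm_smul_le_mul_eLpNorm (p := 2) (q := 2) (r := 1) hfu.1 hWχ.1
    rw [eLpNorm_one_eq_lintegral_enorm] at hhol
    refine hhol.trans ?_
    gcongr
    rw [ofReal_norm_toLp_two]
    refine (eLpNorm_congr_norm_ae (ae_of_all _ fun ξ => ?_)).le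
    rw [norm_mul, norm_wavePhase, one_mul]
  have hmain := hcb F hFc (3 * R) (by positivity) hFs x t A ht hA
  rw [← hk] at hmain
  refine hdiff.trans ?_
  calc _ ≤ ENNReal.ofReal k * (ENNReal.ofReal (A ^ (3 / 2 : ℝ)) *
          (eLpNorm (fun ξ => ‖ξ‖ * ‖u ξ‖) 2 volume + ENNReal.ofReal (3 * R) * ENNReal.ofReal ε)
          + ENNReal.ofReal (A ^ (-(1 / 2) : ℝ)) * (eLpNorm (weakJet u u₁ u₂) 2 volume
            + ENNReal.ofReal (C * 21) * ENNReal.ofReal ε))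
        + ENNReal.ofReal (‖χ.toLp 2 volume‖) * ENNReal.ofReal ε := by
        refine add_le_add (hmain.trans ?_) le_rfl
        gcongr
    _ = ENNReal.ofReal k * (ENNReal.ofReal (A ^ (3 / 2 : ℝ)) *
          eLpNorm (fun ξ => ‖ξ‖ * ‖u ξ‖) 2 volume
          + ENNReal.ofReal (A ^ (-(1 / 2) : ℝ)) * eLpNorm (weakJet u u₁ u₂) 2 volume)
        + ENNReal.ofReal ((‖χ.toLp 2 volume‖ + k * (A ^ (3 / 2 : ℝ) * (3 * R)
          + A ^ (-(1 / 2) : ℝ) * (C * 21))) * ε) := by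
        rw [ofReal_affine hχL hk0 hA1 hA2 (by positivity) (by positivity)]
        ring
    _ ≤ _ := by
        refine add_le_add le_rfl (ENNReal.ofReal_le_ofReal
          (mul_le_mul_of_nonneg_right ?_ hε.le))
        linarith

/-! ### Functions with weak derivatives away from the origin -/

/-- Test functions on `ℝ⁴ ∖ {0}`: smooth, with compact support that avoids the origin. -/
structure IsTest (φ : E4 → ℂ) : Prop where
  smooth : ContDiff ℝ ∞ φ
  compact : HasCompactSupport φ
  zero_notMem : (0 : E4) ∉ tsupport φ

lemma IsTest.mul_left {φ c : E4 → ℂ} (hφ : IsTest φ) (hc : ContDiffOn ℝ ∞ c {0}ᶜ) :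
    IsTest (fun ξ => c ξ * φ ξ) := by
  refine ⟨contDiff_iff_contDiffAt.mpr fun ξ => ?_, hφ.compact.mul_left,
    fun h => hφ.zero_notMem (closure_mono (Function.support_mul_subset_right c φ) h)⟩
  by_cases h0 : ξ = 0
  · have hz : (fun ξ => c ξ * φ ξ) =ᶠ[nhds ξ] fun _ => 0 := by
      have := notMem_tsupport_iff_eventuallyEq.mp hφ.zero_notMem
      rw [h0]
      filter_upwards [this] with η hη
      simp [hη]
    exact contDiffAt_const.congr_of_eventuallyEq hz
  · exact (hc.contDiffAt (isOpen_compl_singleton.mem_nhds h0)).mul hφ.smooth.contDiffAt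

lemma IsTest.fderiv_apply {φ : E4 → ℂ} (hφ : IsTest φ) (v : E4) :
    IsTest (fun ξ => fderiv ℝ φ ξ v) := by
  have hs : tsupport (fun ξ => fderiv ℝ φ ξ v) ⊆ tsupport φ := tsupport_fderiv_apply_subset ℝ v
  refine ⟨?_, hφ.compact.fderiv_apply ℝ v, fun h => hφ.zero_notMem (hs h)⟩
  exact (hφ.smooth.fderiv_right (m := ∞) (by simp)).clm_apply contDiff_const

lemma IsTest.sum {ι : Type*} (s : Finset ι) {φ : ι → E4 → ℂ} (hφ : ∀ i, IsTest (φ i)) :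
    IsTest (fun ξ => ∑ i ∈ s, φ i ξ) := by
  classical
  induction s using Finset.induction_on with
  | empty =>
    refine ⟨by simpa using contDiff_const, HasCompactSupport.zero, ?_⟩
    simp [tsupport_eq_empty_iff.mpr (show (fun _ : E4 => (0 : ℂ)) = 0 from rfl)]
  | insert a s ha ih =>
    simp only [Finset.sum_insert ha]
    refine ⟨(hφ a).smooth.add ih.smooth, (hφ a).compact.add ih.compact, fun h => ?_⟩
    rcases tsupport_add (φ a) (fun ξ => ∑ i ∈ s, φ i ξ) h with h | h
    · exact (hφ a).zero_notMem h
    · exact ih.zero_notMem h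

lemma IsTest.const_mul {φ : E4 → ℂ} (hφ : IsTest φ) (c : ℂ) : IsTest (fun ξ => c * φ ξ) :=
  hφ.mul_left contDiffOn_const

lemma IsTest.eq_zero_of_eq_zero {φ : E4 → ℂ} (hφ : IsTest φ) : φ 0 = 0 :=
  image_eq_zero_of_notMem_tsupport hφ.zero_notMem

lemma IsTest.memLp {φ : E4 → ℂ} (hφ : IsTest φ) (p : ℝ≥0∞) : MemLp φ p volume :=
  hφ.smooth.continuous.memLp_of_hasCompactSupport hφ.compact

lemma contDiffOn_norm_zpow (k : ℤ) :
    ContDiffOn ℝ ∞ (fun ξ : E4 => ((‖ξ‖ ^ k : ℝ) : ℂ)) {0}ᶜ := by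
  refine Complex.ofRealCLM.contDiff.comp_contDiffOn fun ξ hξ => ?_
  have h0 : ‖ξ‖ ≠ 0 := norm_ne_zero_iff.mpr hξ
  have hn : ContDiffAt ℝ ∞ (fun ξ : E4 => ‖ξ‖) ξ := contDiffAt_norm ℝ hξ
  obtain ⟨k, rfl | rfl⟩ := k.eq_nat_or_neg
  · exact ((hn.pow k).congr_of_eventuallyEq
      (Filter.Eventually.of_forall fun _ => zpow_natCast _ _)).contDiffWithinAt
  · exact (((hn.pow k).inv (pow_ne_zero _ h0)).congr_of_eventuallyEq
      (Filter.Eventually.of_forall fun η => (zpow_neg ‖η‖ k).trans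
        (congrArg Inv.inv (zpow_natCast _ _)))).contDiffWithinAt

/-- The function `|ξ|^k f` is square integrable. -/
def MemWeight (k : ℕ) (f : E4 → ℂ) : Prop :=
  MemLp (fun ξ => ((‖ξ‖ ^ k : ℝ) : ℂ) * f ξ) 2 volume

lemma IsTest.weight_div {φ : E4 → ℂ} (hφ : IsTest φ) (k : ℕ) :
    IsTest (fun ξ => ((‖ξ‖ ^ (-k : ℤ) : ℝ) : ℂ) * φ ξ) := hφ.mul_left (contDiffOn_norm_zpow _)

lemma IsTest.mul_eq_weight {φ : E4 → ℂ} (hφ : IsTest φ) (k : ℕ) (f : E4 → ℂ) (ξ : E4) :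
    φ ξ * f ξ = (((‖ξ‖ ^ (-k : ℤ) : ℝ) : ℂ) * φ ξ) * (((‖ξ‖ ^ k : ℝ) : ℂ) * f ξ) := by
  by_cases h0 : ξ = 0
  · rw [h0, hφ.eq_zero_of_eq_zero]; simp
  · have : ((‖ξ‖ ^ k : ℝ) : ℂ) ≠ 0 := by
      exact_mod_cast pow_ne_zero _ (norm_ne_zero_iff.mpr h0)
    rw [zpow_neg, zpow_natCast, Complex.ofReal_inv]
    field_simp

lemma MemWeight.integrable {k : ℕ} {f : E4 → ℂ} (hf : MemWeight k f) {φ : E4 → ℂ}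
    (hφ : IsTest φ) : Integrable (fun ξ => φ ξ * f ξ) volume := by
  simp only [hφ.mul_eq_weight k f]
  exact ((hφ.weight_div k).memLp 2).integrable_mul hf

lemma MemWeight.memLp_mul {k : ℕ} {f : E4 → ℂ} (hf : MemWeight k f) {φ : E4 → ℂ}
    (hφ : IsTest φ) : MemLp (fun ξ => φ ξ * f ξ) 2 volume := by
  simp only [hφ.mul_eq_weight k f]
  exact hf.mul' ((hφ.weight_div k).memLp ⊤)

/-- Hölder's inequality for a test function against a function of weight `k`. -/
lemma MemWeight.enorm_integral_le {k : ℕ} {f : E4 → ℂ} (hf : MemWeight k f) {φ : E4 → ℂ}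
    (hφ : IsTest φ) : ‖∫ ξ, φ ξ * f ξ‖ₑ ≤
      eLpNorm (fun ξ => ((‖ξ‖ ^ (-k : ℤ) : ℝ) : ℂ) * φ ξ) 2 volume *
        eLpNorm (fun ξ => ((‖ξ‖ ^ k : ℝ) : ℂ) * f ξ) 2 volume := by
  simp only [hφ.mul_eq_weight k f]
  refine (enorm_integral_le_lintegral_enorm _).trans ?_
  have h := eLpNorm_smul_le_mul_eLpNorm (p := 2) (q := 2) (r := 1) hf.1
    ((hφ.weight_div k).memLp 2).1
  rwa [eLpNorm_one_eq_lintegral_enorm] at h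

/-- `g` is the weak derivative of `f` on `ℝ⁴ ∖ {0}` in the direction `v`. -/
def WeakDerivOff (v : E4) (f g : E4 → ℂ) : Prop :=
  ∀ φ : E4 → ℂ, IsTest φ → ∫ ξ, fderiv ℝ φ ξ v * f ξ = -∫ ξ, φ ξ * g ξ

lemma IsTest.mul_schwartz {m : E4 → ℂ} (hm : IsTest m) (φ : 𝓢(E4, ℂ)) :
    IsTest (fun ξ => m ξ * φ ξ) := by
  have := hm.mul_left (c := φ) (φ.smooth ⊤).contDiffOn
  simpa only [mul_comm] using this

/-- The product rule: cutting off a function that has a weak derivative away from the origin yields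
a function with a weak derivative on the whole space. -/
lemma WeakDerivOff.mul_test {v : E4} {f g m : E4 → ℂ} {k l : ℕ} (h : WeakDerivOff v f g)
    (hf : MemWeight k f) (hg : MemWeight l g) (hm : IsTest m) :
    WeakDeriv v (fun ξ => m ξ * f ξ) (fun ξ => fderiv ℝ m ξ v * f ξ + m ξ * g ξ) := fun φ => by
  have h1 := h _ (hm.mul_schwartz φ)
  have hd : ∀ ξ, fderiv ℝ (fun ξ => m ξ * φ ξ) ξ v = m ξ * (∂_{v} φ) ξ + fderiv ℝ m ξ v * φ ξ :=
    fun ξ => by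
    rw [fderiv_fun_mul (hm.smooth.differentiable (by simp) ξ)
      ((φ.smooth 1).differentiable (by simp) ξ), SchwartzMap.lineDerivOp_apply_eq_fderiv]
    simp [mul_comm]
  have i1 : Integrable (fun ξ => m ξ * (∂_{v} φ) ξ * f ξ) volume :=
    hf.integrable (hm.mul_schwartz (∂_{v} φ))
  have i2 : Integrable (fun ξ => fderiv ℝ m ξ v * φ ξ * f ξ) volume :=
    hf.integrable ((hm.fderiv_apply v).mul_schwartz φ)
  have i3 : Integrable (fun ξ => m ξ * φ ξ * g ξ) volume := hg.integrable (hm.mul_schwartz φ)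
  simp only [hd, add_mul] at h1
  rw [integral_add i1 i2] at h1
  have e1 : ∫ ξ, (∂_{v} φ) ξ * (m ξ * f ξ) = ∫ ξ, m ξ * (∂_{v} φ) ξ * f ξ :=
    integral_congr_ae (ae_of_all _ fun ξ => by ring)
  have e2 : ∫ ξ, φ ξ * (fderiv ℝ m ξ v * f ξ + m ξ * g ξ)
      = (∫ ξ, fderiv ℝ m ξ v * φ ξ * f ξ) + ∫ ξ, m ξ * φ ξ * g ξ := by
    rw [← integral_add i2 i3]
    exact integral_congr_ae (ae_of_all _ fun ξ => by ring)
  rw [e1, e2]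
  linear_combination h1

lemma integrable_schwartz_mul (φ : 𝓢(E4, ℂ)) {f : E4 → ℂ} (hf : MemLp f 2 volume) :
    Integrable (fun ξ => φ ξ * f ξ) volume := (φ.memLp 2 volume).integrable_mul hf

lemma WeakDeriv.add {v : E4} {f g f' g' : E4 → ℂ} (h : WeakDeriv v f g) (h' : WeakDeriv v f' g')
    (hf : MemLp f 2 volume) (hg : MemLp g 2 volume) (hf' : MemLp f' 2 volume)
    (hg' : MemLp g' 2 volume) :
    WeakDeriv v (fun ξ => f ξ + f' ξ) (fun ξ => g ξ + g' ξ) := fun φ => by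
  simp only [mul_add]
  rw [integral_add (integrable_schwartz_mul _ hf) (integrable_schwartz_mul _ hf'),
    integral_add (integrable_schwartz_mul _ hg) (integrable_schwartz_mul _ hg'), h φ, h' φ]
  ring

lemma WeakDeriv.sub {v : E4} {f g f' g' : E4 → ℂ} (h : WeakDeriv v f g) (h' : WeakDeriv v f' g')
    (hf : MemLp f 2 volume) (hg : MemLp g 2 volume) (hf' : MemLp f' 2 volume)
    (hg' : MemLp g' 2 volume) :
    WeakDeriv v (fun ξ => f ξ - f' ξ) (fun ξ => g ξ - g' ξ) := fun φ => by
  simp only [mul_sub]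
  rw [integral_sub (integrable_schwartz_mul _ hf) (integrable_schwartz_mul _ hf'),
    integral_sub (integrable_schwartz_mul _ hg) (integrable_schwartz_mul _ hg'), h φ, h' φ]
  ring

/-- A square integrable function `f` with first and second weak derivatives `f₁`, `f₂` away from
the origin, such that `|ξ| f₁` and `|ξ|² f₂` are square integrable, all with `L²` norms at
most `M`. -/
structure HasJet (f : E4 → ℂ) (f₁ : Fin 4 → E4 → ℂ) (f₂ : Fin 4 → Fin 4 → E4 → ℂ) (M : ℝ) :
    Prop where
  mem : MemWeight 0 f
  mem₁ : ∀ j, MemWeight 1 (f₁ j)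
  mem₂ : ∀ i j, MemWeight 2 (f₂ i j)
  deriv₁ : ∀ j, WeakDerivOff (coordDir j) f (f₁ j)
  deriv₂ : ∀ i j, WeakDerivOff (coordDir i) (f₁ j) (f₂ i j)
  norm : eLpNorm (fun ξ => ((‖ξ‖ ^ 0 : ℝ) : ℂ) * f ξ) 2 volume ≤ ENNReal.ofReal M
  norm₁ : ∀ j, eLpNorm (fun ξ => ((‖ξ‖ ^ 1 : ℝ) : ℂ) * f₁ j ξ) 2 volume ≤ ENNReal.ofReal M
  norm₂ : ∀ i j, eLpNorm (fun ξ => ((‖ξ‖ ^ 2 : ℝ) : ℂ) * f₂ i j ξ) 2 volume ≤ ENNReal.ofReal M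

lemma HasJet.memLp {f : E4 → ℂ} {f₁ : Fin 4 → E4 → ℂ} {f₂ : Fin 4 → Fin 4 → E4 → ℂ} {M : ℝ}
    (h : HasJet f f₁ f₂ M) : MemLp f 2 volume := by simpa [MemWeight] using h.mem

lemma HasJet.eLpNorm_weakJet_le {f : E4 → ℂ} {f₁ : Fin 4 → E4 → ℂ}
    {f₂ : Fin 4 → Fin 4 → E4 → ℂ} {M : ℝ} (h : HasJet f f₁ f₂ M) :
    eLpNorm (weakJet f f₁ f₂) 2 volume ≤ 21 * ENNReal.ofReal M := by
  have := eLpNorm_flatJet_le h.mem.1 (fun j => (h.mem₁ j).1) (fun i j => (h.mem₂ i j).1)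
    h.norm h.norm₁ h.norm₂
  refine (eLpNorm_congr_norm_ae (ae_of_all _ fun ξ => ?_)).trans_le this
  congr 1
  simp only [weakJet, flatJet, norm_mul, Complex.norm_real, norm_pow, norm_norm, pow_zero, pow_one,
    one_mul, Finset.mul_sum, norm_one]

/-- The first weak derivatives of the product of `f` with a test function `m`. -/
def cut₁ (m f : E4 → ℂ) (f₁ : Fin 4 → E4 → ℂ) (j : Fin 4) (ξ : E4) : ℂ :=
  fderiv ℝ m ξ (coordDir j) * f ξ + m ξ * f₁ j ξ

/-- The second weak derivatives of the product of `f` with a test function `m`. -/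
def cut₂ (m f : E4 → ℂ) (f₁ : Fin 4 → E4 → ℂ) (f₂ : Fin 4 → Fin 4 → E4 → ℂ) (i j : Fin 4)
    (ξ : E4) : ℂ :=
  (fderiv ℝ (fun ξ => fderiv ℝ m ξ (coordDir j)) ξ (coordDir i) * f ξ
      + fderiv ℝ m ξ (coordDir j) * f₁ i ξ)
    + (fderiv ℝ m ξ (coordDir i) * f₁ j ξ + m ξ * f₂ i j ξ)

section cut

variable {m f : E4 → ℂ} {f₁ : Fin 4 → E4 → ℂ} {f₂ : Fin 4 → Fin 4 → E4 → ℂ} {M : ℝ}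

lemma HasJet.memLp_cut (h : HasJet f f₁ f₂ M) (hm : IsTest m) :
    MemLp (fun ξ => m ξ * f ξ) 2 volume := h.mem.memLp_mul hm

lemma HasJet.memLp_cut₁ (h : HasJet f f₁ f₂ M) (hm : IsTest m) (j : Fin 4) :
    MemLp (cut₁ m f f₁ j) 2 volume :=
  (h.mem.memLp_mul (hm.fderiv_apply _)).add ((h.mem₁ j).memLp_mul hm)

lemma HasJet.memLp_cut₂ (h : HasJet f f₁ f₂ M) (hm : IsTest m) (i j : Fin 4) :
    MemLp (cut₂ m f f₁ f₂ i j) 2 volume :=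
  ((h.mem.memLp_mul ((hm.fderiv_apply _).fderiv_apply _)).add
    ((h.mem₁ i).memLp_mul (hm.fderiv_apply _))).add
    (((h.mem₁ j).memLp_mul (hm.fderiv_apply _)).add ((h.mem₂ i j).memLp_mul hm))

lemma HasJet.weakDeriv_cut (h : HasJet f f₁ f₂ M) (hm : IsTest m) (j : Fin 4) :
    WeakDeriv (coordDir j) (fun ξ => m ξ * f ξ) (cut₁ m f f₁ j) :=
  (h.deriv₁ j).mul_test h.mem (h.mem₁ j) hm

lemma HasJet.weakDeriv_cut₁ (h : HasJet f f₁ f₂ M) (hm : IsTest m) (i j : Fin 4) :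
    WeakDeriv (coordDir i) (cut₁ m f f₁ j) (cut₂ m f f₁ f₂ i j) :=
  ((h.deriv₁ i).mul_test h.mem (h.mem₁ i) (hm.fderiv_apply (coordDir j))).add
    ((h.deriv₂ i j).mul_test (h.mem₁ j) (h.mem₂ i j) hm)
    (h.mem.memLp_mul (hm.fderiv_apply _))
    ((h.mem.memLp_mul ((hm.fderiv_apply _).fderiv_apply _)).add
      ((h.mem₁ i).memLp_mul (hm.fderiv_apply _)))
    ((h.mem₁ j).memLp_mul hm)
    (((h.mem₁ j).memLp_mul (hm.fderiv_apply _)).add ((h.mem₂ i j).memLp_mul hm))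

end cut

lemma weakJet_cut_le {m : E4 → ℂ} (hm : IsTest m) {B : ℝ} (hB : ∀ ξ, jetSize m ξ ≤ B)
    (f : E4 → ℂ) (f₁ : Fin 4 → E4 → ℂ) (f₂ : Fin 4 → Fin 4 → E4 → ℂ) (ξ : E4) :
    weakJet (fun ξ => m ξ * f ξ) (cut₁ m f f₁) (cut₂ m f f₁ f₂) ξ
      ≤ 21 * B * weakJet f f₁ f₂ ξ := by
  have hr := norm_nonneg ξ
  have hn2 : 0 ≤ ‖fderiv ℝ (fderiv ℝ m) ξ‖ := norm_nonneg (E := E4 →L[ℝ] E4 →L[ℝ] ℂ) _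
  have hj := hB ξ
  unfold jetSize at hj
  have hB0 : 0 ≤ B := le_trans (by positivity) hj
  have a0 : ‖m ξ‖ ≤ B := by
    nlinarith [mul_nonneg hr (norm_nonneg (fderiv ℝ m ξ)), mul_nonneg (sq_nonneg ‖ξ‖) hn2]
  have a1' : ‖ξ‖ * ‖fderiv ℝ m ξ‖ ≤ B := by
    nlinarith [norm_nonneg (m ξ), mul_nonneg (sq_nonneg ‖ξ‖) hn2]
  have a2' : ‖ξ‖ ^ 2 * ‖fderiv ℝ (fderiv ℝ m) ξ‖ ≤ B := by
    nlinarith [norm_nonneg (m ξ), mul_nonneg hr (norm_nonneg (fderiv ℝ m ξ))]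
  have a1 : ∀ j, ‖ξ‖ * ‖fderiv ℝ m ξ (coordDir j)‖ ≤ B := fun j => by
    refine le_trans ?_ a1'
    gcongr
    simpa [norm_coordDir] using (fderiv ℝ m ξ).le_opNorm (coordDir j)
  have a2 : ∀ i j, ‖ξ‖ ^ 2 * ‖fderiv ℝ (fun ξ => fderiv ℝ m ξ (coordDir j)) ξ (coordDir i)‖ ≤ B :=
    fun i j => by
    refine le_trans ?_ a2'
    gcongr
    have hd : DifferentiableAt ℝ (fderiv ℝ m) ξ :=
      (hm.smooth.fderiv_right (m := 1) (by norm_cast)).differentiable (by norm_num) ξ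
    rw [fderiv_clm_apply hd (differentiableAt_const _)]
    simpa [norm_coordDir] using (fderiv ℝ (fderiv ℝ m) ξ).le_opNorm₂ (coordDir i) (coordDir j)
  have b1 : ∀ j, ‖ξ‖ * ‖cut₁ m f f₁ j ξ‖ ≤ B * ‖f ξ‖ + B * (‖ξ‖ * ‖f₁ j ξ‖) := fun j => by
    calc ‖ξ‖ * ‖cut₁ m f f₁ j ξ‖
        ≤ ‖ξ‖ * (‖fderiv ℝ m ξ (coordDir j)‖ * ‖f ξ‖ + ‖m ξ‖ * ‖f₁ j ξ‖) := by
          gcongr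
          refine (norm_add_le _ _).trans ?_
          rw [norm_mul, norm_mul]
      _ = (‖ξ‖ * ‖fderiv ℝ m ξ (coordDir j)‖) * ‖f ξ‖ + ‖m ξ‖ * (‖ξ‖ * ‖f₁ j ξ‖) := by ring
      _ ≤ _ := by gcongr; exact a1 j
  have b2 : ∀ i j, ‖ξ‖ ^ 2 * ‖cut₂ m f f₁ f₂ i j ξ‖ ≤ B * ‖f ξ‖ + B * (‖ξ‖ * ‖f₁ i ξ‖)
      + B * (‖ξ‖ * ‖f₁ j ξ‖) + B * (‖ξ‖ ^ 2 * ‖f₂ i j ξ‖) := fun i j => by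
    calc ‖ξ‖ ^ 2 * ‖cut₂ m f f₁ f₂ i j ξ‖
        ≤ ‖ξ‖ ^ 2 * (‖fderiv ℝ (fun ξ => fderiv ℝ m ξ (coordDir j)) ξ (coordDir i)‖ * ‖f ξ‖
          + ‖fderiv ℝ m ξ (coordDir j)‖ * ‖f₁ i ξ‖
          + (‖fderiv ℝ m ξ (coordDir i)‖ * ‖f₁ j ξ‖ + ‖m ξ‖ * ‖f₂ i j ξ‖)) := by
          gcongr
          refine (norm_add_le _ _).trans ?_
          refine (add_le_add (norm_add_le _ _) (norm_add_le _ _)).trans ?_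
          simp only [norm_mul]
          exact le_rfl
      _ = (‖ξ‖ ^ 2 * ‖fderiv ℝ (fun ξ => fderiv ℝ m ξ (coordDir j)) ξ (coordDir i)‖) * ‖f ξ‖
          + (‖ξ‖ * ‖fderiv ℝ m ξ (coordDir j)‖) * (‖ξ‖ * ‖f₁ i ξ‖)
          + (‖ξ‖ * ‖fderiv ℝ m ξ (coordDir i)‖) * (‖ξ‖ * ‖f₁ j ξ‖)
          + ‖m ξ‖ * (‖ξ‖ ^ 2 * ‖f₂ i j ξ‖) := by ring
      _ ≤ _ := by
          gcongr
          · exact a2 i j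
          · exact a1 j
          · exact a1 i
  unfold weakJet
  have s1 : ‖ξ‖ * ∑ j, ‖cut₁ m f f₁ j ξ‖ ≤ 4 * B * ‖f ξ‖ + B * (‖ξ‖ * ∑ j, ‖f₁ j ξ‖) := by
    rw [Finset.mul_sum]
    refine (Finset.sum_le_sum fun j _ => b1 j).trans (le_of_eq ?_)
    simp only [Finset.sum_add_distrib, ← Finset.mul_sum, Finset.sum_const, Finset.card_univ,
      Fintype.card_fin, nsmul_eq_mul]
    push_cast
    ring
  have s2 : ‖ξ‖ ^ 2 * ∑ i, ∑ j, ‖cut₂ m f f₁ f₂ i j ξ‖ ≤ 16 * B * ‖f ξ‖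
      + 8 * B * (‖ξ‖ * ∑ j, ‖f₁ j ξ‖) + B * (‖ξ‖ ^ 2 * ∑ i, ∑ j, ‖f₂ i j ξ‖) := by
    simp only [Finset.mul_sum]
    refine (Finset.sum_le_sum fun i _ => Finset.sum_le_sum fun j _ => b2 i j).trans (le_of_eq ?_)
    simp only [Finset.sum_add_distrib, ← Finset.mul_sum, Finset.sum_const, Finset.card_univ,
      Fintype.card_fin, nsmul_eq_mul]
    push_cast
    ring
  have s0 : ‖m ξ * f ξ‖ ≤ B * ‖f ξ‖ := by rw [norm_mul]; gcongr
  have p1 : 0 ≤ ‖ξ‖ * ∑ j, ‖f₁ j ξ‖ := by positivity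
  have p2 : 0 ≤ ‖ξ‖ ^ 2 * ∑ i, ∑ j, ‖f₂ i j ξ‖ := by positivity
  generalize ‖ξ‖ * ∑ j, ‖f₁ j ξ‖ = P₁ at *
  generalize ‖ξ‖ ^ 2 * ∑ i, ∑ j, ‖f₂ i j ξ‖ = P₂ at *
  have q1 : 0 ≤ B * P₁ := by positivity
  have q2 : 0 ≤ B * P₂ := by positivity
  nlinarith

lemma HasJet.eLpNorm_weakJet_cut_le {m f : E4 → ℂ} {f₁ : Fin 4 → E4 → ℂ}
    {f₂ : Fin 4 → Fin 4 → E4 → ℂ} {M B : ℝ} (h : HasJet f f₁ f₂ M) (hm : IsTest m)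
    (hB0 : 0 ≤ B) (hB : ∀ ξ, jetSize m ξ ≤ B) :
    eLpNorm (weakJet (fun ξ => m ξ * f ξ) (cut₁ m f f₁) (cut₂ m f f₁ f₂)) 2 volume
      ≤ ENNReal.ofReal (441 * B * M) := by
  have hle : eLpNorm (weakJet (fun ξ => m ξ * f ξ) (cut₁ m f f₁) (cut₂ m f f₁ f₂)) 2 volume
      ≤ eLpNorm ((21 * B) • weakJet f f₁ f₂) 2 volume := by
    refine eLpNorm_mono_real fun ξ => ?_
    rw [Real.norm_of_nonneg (by unfold weakJet; positivity)]
    exact weakJet_cut_le hm hB f f₁ f₂ ξ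
  refine hle.trans ?_
  rw [eLpNorm_const_smul, Real.enorm_of_nonneg (by positivity)]
  calc _ ≤ ENNReal.ofReal (21 * B) * (21 * ENNReal.ofReal M) := by
        gcongr; exact h.eLpNorm_weakJet_le
    _ = _ := by
        rw [show (441 * B * M : ℝ) = (21 * B) * (21 * M) by ring,
          ENNReal.ofReal_mul (p := 21 * B) (by positivity),
          ENNReal.ofReal_mul (p := 21) (q := M) (by norm_num)]
        norm_num

/-! ### Truncated symbols -/

lemma jetSize_nonneg (f : E4 → ℂ) (ξ : E4) : 0 ≤ jetSize f ξ := by unfold jetSize; positivity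

lemma norm_le_jetSize (f : E4 → ℂ) (ξ : E4) : ‖f ξ‖ ≤ jetSize f ξ := by
  have h1 : 0 ≤ ‖ξ‖ * ‖fderiv ℝ f ξ‖ := by positivity
  have h2 : 0 ≤ ‖ξ‖ ^ 2 * ‖fderiv ℝ (fderiv ℝ f) ξ‖ := by positivity
  unfold jetSize
  linarith

lemma jetSize_mul {f g : E4 → ℂ} (hf : ContDiff ℝ ∞ f) (hg : ContDiff ℝ ∞ g) (ξ : E4) :
    jetSize (fun ξ => f ξ * g ξ) ξ ≤ 2 * (jetSize f ξ * jetSize g ξ) := by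
  have hf2 : ContDiff ℝ 2 f := hf.of_le (by norm_cast)
  have hg2 : ContDiff ℝ 2 g := hg.of_le (by norm_cast)
  have p1 : ‖fderiv ℝ (fun ξ => f ξ * g ξ) ξ‖
      ≤ ‖f ξ‖ * ‖fderiv ℝ g ξ‖ + ‖fderiv ℝ f ξ‖ * ‖g ξ‖ := by
    simp only [norm_fderiv_eq]
    have := norm_iteratedFDeriv_mul_le (n := 1) hf2 hg2 ξ (by norm_num)
    simpa [Finset.sum_range_succ] using this
  have p2 : ‖fderiv ℝ (fderiv ℝ fun ξ => f ξ * g ξ) ξ‖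
      ≤ ‖f ξ‖ * ‖fderiv ℝ (fderiv ℝ g) ξ‖ + 2 * ‖fderiv ℝ f ξ‖ * ‖fderiv ℝ g ξ‖
        + ‖fderiv ℝ (fderiv ℝ f) ξ‖ * ‖g ξ‖ := by
    simp only [norm_fderiv_fderiv_eq]
    simp only [norm_fderiv_eq]
    have := norm_iteratedFDeriv_mul_le (n := 2) hf2 hg2 ξ (by norm_num)
    simpa [Finset.sum_range_succ] using this
  have f2 : 0 ≤ ‖fderiv ℝ (fderiv ℝ f) ξ‖ := norm_nonneg (E := E4 →L[ℝ] E4 →L[ℝ] ℂ) _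
  have g2 : 0 ≤ ‖fderiv ℝ (fderiv ℝ g) ξ‖ := norm_nonneg (E := E4 →L[ℝ] E4 →L[ℝ] ℂ) _
  have f1 := norm_nonneg (fderiv ℝ f ξ)
  have g1 := norm_nonneg (fderiv ℝ g ξ)
  have f0 := norm_nonneg (f ξ)
  have g0 := norm_nonneg (g ξ)
  unfold jetSize
  rw [norm_mul]
  generalize ‖fderiv ℝ (fderiv ℝ fun ξ => f ξ * g ξ) ξ‖ = P₂ at *
  generalize ‖fderiv ℝ (fun ξ => f ξ * g ξ) ξ‖ = P₁ at *
  generalize ‖fderiv ℝ (fderiv ℝ f) ξ‖ = F₂ at *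
  generalize ‖fderiv ℝ (fderiv ℝ g) ξ‖ = G₂ at *
  generalize ‖fderiv ℝ f ξ‖ = F₁ at *
  generalize ‖fderiv ℝ g ξ‖ = G₁ at *
  generalize ‖f ξ‖ = F₀ at *
  generalize ‖g ξ‖ = G₀ at *
  have hr := norm_nonneg ξ
  generalize ‖ξ‖ = r at *
  calc _ ≤ F₀ * G₀ + r * (F₀ * G₁ + F₁ * G₀) + r ^ 2 * (F₀ * G₂ + 2 * F₁ * G₁ + F₂ * G₀) := by
        gcongr
    _ ≤ _ := by
        have a1 : 0 ≤ F₀ * G₀ := by positivity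
        have a2 : 0 ≤ F₀ * (r * G₁) := by positivity
        have a3 : 0 ≤ (r * F₁) * G₀ := by positivity
        have a4 : 0 ≤ F₀ * (r ^ 2 * G₂) := by positivity
        have a5 : 0 ≤ (r ^ 2 * F₂) * G₀ := by positivity
        have a6 : 0 ≤ (r * F₁) * (r ^ 2 * G₂) := by positivity
        have a7 : 0 ≤ (r ^ 2 * F₂) * (r * G₁) := by positivity
        have a8 : 0 ≤ (r ^ 2 * F₂) * (r ^ 2 * G₂) := by positivity
        nlinarith

/-- The weighted jet is invariant under dilations. -/
lemma jetSize_comp_smul {f : E4 → ℂ} (hf : ContDiff ℝ ∞ f) {a : ℝ} (ha : 0 ≤ a) (ξ : E4) :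
    jetSize (fun ξ => f (a • ξ)) ξ = jetSize f (a • ξ) := by
  have h1 : ‖fderiv ℝ (fun ξ => f (a • ξ)) ξ‖ = a * ‖fderiv ℝ f (a • ξ)‖ := by
    simp only [norm_fderiv_eq]
    rw [iteratedFDeriv_comp_const_smul a (hf.of_le (by norm_cast)), norm_smul]
    simp [abs_of_nonneg ha]
  have h2 : ‖fderiv ℝ (fderiv ℝ fun ξ => f (a • ξ)) ξ‖
      = a ^ 2 * ‖fderiv ℝ (fderiv ℝ f) (a • ξ)‖ := by
    simp only [norm_fderiv_fderiv_eq]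
    rw [iteratedFDeriv_comp_const_smul a (hf.of_le (by norm_cast)), norm_smul]
    simp
  unfold jetSize
  rw [h1, h2, norm_smul, Real.norm_of_nonneg ha]
  ring

lemma exists_jetSize_le {f : E4 → ℂ} (hf : ContDiff ℝ ∞ f) (hs : HasCompactSupport f) :
    ∃ C : ℝ, 0 < C ∧ ∀ ξ, jetSize f ξ ≤ C := by
  obtain ⟨B, hB1, hB⟩ := exists_seminorm_bound (hs.toSchwartzMap hf)
  have hc : ⇑(hs.toSchwartzMap hf) = f := rfl
  rw [hc] at hB
  refine ⟨3 * B, by positivity, fun ξ => ?_⟩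
  unfold jetSize
  rw [norm_fderiv_eq, norm_fderiv_fderiv_eq]
  have h0 := hB 0 (by norm_num) 0 (by norm_num) ξ
  have h1 := hB 1 (by norm_num) 1 (by norm_num) ξ
  have h2 := hB 2 (by norm_num) 2 (by norm_num) ξ
  rw [norm_iteratedFDeriv_zero, pow_zero, one_mul] at h0
  rw [pow_one] at h1
  linarith

/-- The symbol `⟨2πξ⟩^σ` of `⟨D⟩^σ`. -/
def bracketSymbol (σ : ℝ) (ξ : E4) : ℝ := (1 + ‖(2 * π) • ξ‖ ^ 2) ^ (σ / 2)

lemma bracketSymbol_base_pos (ξ : E4) : 0 < 1 + ‖(2 * π) • ξ‖ ^ 2 := by positivity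

lemma bracketSymbol_pos (σ : ℝ) (ξ : E4) : 0 < bracketSymbol σ ξ :=
  rpow_pos_of_pos (bracketSymbol_base_pos ξ) _

lemma contDiff_bracketSymbol (σ : ℝ) : ContDiff ℝ ∞ (bracketSymbol σ) := by
  have h : ContDiff ℝ ∞ fun ξ : E4 => 1 + ‖(2 * π) • ξ‖ ^ 2 :=
    contDiff_const.add ((contDiff_const_smul (2 * π)).norm_sq ℝ)
  exact h.rpow_const_of_ne fun ξ => (bracketSymbol_base_pos ξ).ne'

lemma hasFDerivAt_bracketSymbol (σ : ℝ) (ξ : E4) : HasFDerivAt (bracketSymbol σ)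
    ((σ * (2 * π) ^ 2 * bracketSymbol (σ - 2) ξ) • innerSL ℝ ξ) ξ := by
  have h1 : HasFDerivAt (fun ξ : E4 => 1 + ‖(2 * π) • ξ‖ ^ 2)
      ((2 * (2 * π) ^ 2) • innerSL ℝ ξ) ξ := by
    have h := ((hasStrictFDerivAt_norm_sq ξ).hasFDerivAt.const_mul ((2 * π) ^ 2)).const_add 1
    have he : (fun ξ : E4 => 1 + ‖(2 * π) • ξ‖ ^ 2) = fun ξ => 1 + (2 * π) ^ 2 * ‖ξ‖ ^ 2 := by
      ext ξ; rw [norm_smul, mul_pow, Real.norm_eq_abs, sq_abs]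
    rw [he]
    refine h.congr_fderiv ?_
    ext v
    simp
    ring
  have h2 := h1.rpow_const (p := σ / 2) (Or.inl (bracketSymbol_base_pos ξ).ne')
  refine HasFDerivAt.congr_fderiv (f := bracketSymbol σ) h2 ?_
  ext v
  simp only [bracketSymbol, _root_.smul_apply, smul_eq_mul]
  rw [show (σ - 2) / 2 = σ / 2 - 1 by ring]
  ring

lemma sq_mul_bracketSymbol_sub_two_le (σ : ℝ) (ξ : E4) :
    (2 * π) ^ 2 * ‖ξ‖ ^ 2 * bracketSymbol (σ - 2) ξ ≤ bracketSymbol σ ξ := by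
  have h : bracketSymbol σ ξ = (1 + ‖(2 * π) • ξ‖ ^ 2) * bracketSymbol (σ - 2) ξ := by
    unfold bracketSymbol
    rw [show (σ - 2) / 2 = σ / 2 - 1 by ring, rpow_sub_one (bracketSymbol_base_pos ξ).ne']
    field_simp
  rw [h]
  refine mul_le_mul_of_nonneg_right ?_ (bracketSymbol_pos _ _).le
  rw [norm_smul, mul_pow ‖2 * π‖, Real.norm_eq_abs, sq_abs]
  linarith

lemma norm_fderiv_bracketSymbol_le {σ : ℝ} (ξ : E4) :
    ‖ξ‖ * ‖fderiv ℝ (bracketSymbol σ) ξ‖ ≤ |σ| * bracketSymbol σ ξ := by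
  rw [(hasFDerivAt_bracketSymbol σ ξ).fderiv, norm_smul, innerSL_apply_norm]
  have h0 := (bracketSymbol_pos (σ - 2) ξ).le
  have h := sq_mul_bracketSymbol_sub_two_le σ ξ
  calc ‖ξ‖ * (‖σ * (2 * π) ^ 2 * bracketSymbol (σ - 2) ξ‖ * ‖ξ‖)
      = |σ| * ((2 * π) ^ 2 * ‖ξ‖ ^ 2 * bracketSymbol (σ - 2) ξ) := by
        rw [norm_mul, norm_mul, Real.norm_of_nonneg h0, Real.norm_of_nonneg (sq_nonneg (2 * π)),
          Real.norm_eq_abs]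
        ring
    _ ≤ _ := by gcongr

lemma norm_fderiv_fderiv_bracketSymbol_le {σ : ℝ} (ξ : E4) :
    ‖ξ‖ ^ 2 * ‖fderiv ℝ (fderiv ℝ (bracketSymbol σ)) ξ‖
      ≤ |σ| * (|σ - 2| + 1) * bracketSymbol σ ξ := by
  obtain ⟨J, hJ⟩ : ∃ J : E4 →L[ℝ] E4 →L[ℝ] ℝ, ∀ ξ, J ξ = innerSL ℝ ξ :=
    ⟨innerSL ℝ, fun _ => rfl⟩
  have hf : fderiv ℝ (bracketSymbol σ)
      = fun ξ => (σ * (2 * π) ^ 2 * bracketSymbol (σ - 2) ξ) • J ξ := by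
    ext1 ξ
    rw [(hasFDerivAt_bracketSymbol σ ξ).fderiv, hJ]
  have hc : HasFDerivAt (fun ξ => σ * (2 * π) ^ 2 * bracketSymbol (σ - 2) ξ)
      ((σ * (2 * π) ^ 2) • fderiv ℝ (bracketSymbol (σ - 2)) ξ) ξ :=
    ((contDiff_bracketSymbol (σ - 2)).differentiable (by simp) ξ).hasFDerivAt.const_mul _
  have hJd : HasFDerivAt (fun ξ => J ξ) J ξ := J.hasFDerivAt
  have hd := hc.fun_smul hJd
  rw [hf, hd.fderiv]
  have h0 := (bracketSymbol_pos (σ - 2) ξ).le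
  have h := sq_mul_bracketSymbol_sub_two_le σ ξ
  have h1 := norm_fderiv_bracketSymbol_le (σ := σ - 2) ξ
  have hb : ‖(σ * (2 * π) ^ 2 * bracketSymbol (σ - 2) ξ) • J
      + ((σ * (2 * π) ^ 2) • fderiv ℝ (bracketSymbol (σ - 2)) ξ).smulRight (J ξ)‖
      ≤ |σ| * (2 * π) ^ 2 * bracketSymbol (σ - 2) ξ
        + |σ| * (2 * π) ^ 2 * ‖fderiv ℝ (bracketSymbol (σ - 2)) ξ‖ * ‖ξ‖ := by
    refine ContinuousLinearMap.opNorm_le_bound _ (by positivity) fun v => ?_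
    have hJv : ‖J v‖ = ‖v‖ := by rw [hJ, innerSL_apply_norm]
    have hJξ : ‖J ξ‖ = ‖ξ‖ := by rw [hJ, innerSL_apply_norm]
    have e : ((σ * (2 * π) ^ 2 * bracketSymbol (σ - 2) ξ) • J
        + ((σ * (2 * π) ^ 2) • fderiv ℝ (bracketSymbol (σ - 2)) ξ).smulRight (J ξ)) v
        = (σ * (2 * π) ^ 2 * bracketSymbol (σ - 2) ξ) • J v
          + (σ * (2 * π) ^ 2 * fderiv ℝ (bracketSymbol (σ - 2)) ξ v) • J ξ := by
      simp [mul_assoc]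
    rw [e]
    refine (norm_add_le _ _).trans ?_
    rw [norm_smul, norm_smul, hJv, hJξ, norm_mul, norm_mul, norm_mul, norm_mul,
      Real.norm_of_nonneg h0, Real.norm_of_nonneg (sq_nonneg (2 * π)), Real.norm_eq_abs σ]
    have hop := (fderiv ℝ (bracketSymbol (σ - 2)) ξ).le_opNorm v
    calc _ ≤ |σ| * (2 * π) ^ 2 * bracketSymbol (σ - 2) ξ * ‖v‖
          + |σ| * (2 * π) ^ 2 * (‖fderiv ℝ (bracketSymbol (σ - 2)) ξ‖ * ‖v‖) * ‖ξ‖ := by gcongr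
      _ = _ := by ring
  calc _ ≤ ‖ξ‖ ^ 2 * (|σ| * (2 * π) ^ 2 * bracketSymbol (σ - 2) ξ
        + |σ| * (2 * π) ^ 2 * ‖fderiv ℝ (bracketSymbol (σ - 2)) ξ‖ * ‖ξ‖) := by gcongr
    _ = |σ| * ((2 * π) ^ 2 * ‖ξ‖ ^ 2 * bracketSymbol (σ - 2) ξ)
        + |σ| * (2 * π) ^ 2 * ‖ξ‖ ^ 2 * (‖ξ‖ * ‖fderiv ℝ (bracketSymbol (σ - 2)) ξ‖) := by ring
    _ ≤ |σ| * ((2 * π) ^ 2 * ‖ξ‖ ^ 2 * bracketSymbol (σ - 2) ξ)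
        + |σ| * (2 * π) ^ 2 * ‖ξ‖ ^ 2 * (|σ - 2| * bracketSymbol (σ - 2) ξ) := by gcongr
    _ = |σ| * (|σ - 2| + 1) * ((2 * π) ^ 2 * ‖ξ‖ ^ 2 * bracketSymbol (σ - 2) ξ) := by ring
    _ ≤ _ := by gcongr

lemma bracketSymbol_le {σ : ℝ} (hσ : σ ≤ 20) {R : ℝ} (hR : 1 ≤ R) {ξ : E4} (hξ : ‖ξ‖ ≤ 3 * R) :
    bracketSymbol σ ξ ≤ 400 ^ 10 * R ^ 20 := by
  have hb : 1 + ‖(2 * π) • ξ‖ ^ 2 ≤ 400 * R ^ 2 := by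
    rw [norm_smul, Real.norm_of_nonneg (by positivity : (0 : ℝ) ≤ 2 * π)]
    have h1 : 2 * π * ‖ξ‖ ≤ 6.4 * (3 * R) := by
      gcongr
      linarith [pi_lt_d2]
    have h2 : (2 * π * ‖ξ‖) ^ 2 ≤ (6.4 * (3 * R)) ^ 2 := by gcongr
    nlinarith
  have h1 : 1 ≤ 1 + ‖(2 * π) • ξ‖ ^ 2 := by linarith [sq_nonneg ‖(2 * π) • ξ‖]
  calc bracketSymbol σ ξ ≤ (1 + ‖(2 * π) • ξ‖ ^ 2) ^ (10 : ℝ) := by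
        unfold bracketSymbol
        exact rpow_le_rpow_of_exponent_le h1 (by linarith)
    _ = (1 + ‖(2 * π) • ξ‖ ^ 2) ^ 10 := by norm_cast
    _ ≤ (400 * R ^ 2) ^ 10 := by gcongr
    _ = _ := by ring

lemma jetSize_bracketSymbol_le {σ : ℝ} (hσ0 : 0 ≤ σ) (hσ : σ ≤ 20) (ξ : E4) :
    jetSize (fun ξ => (bracketSymbol σ ξ : ℂ)) ξ ≤ 421 * bracketSymbol σ ξ := by
  have h0 := (bracketSymbol_pos σ ξ).le
  have hf : (fun ξ => (bracketSymbol σ ξ : ℂ)) = Complex.ofRealLI ∘ bracketSymbol σ := rfl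
  have e1 : ‖fderiv ℝ (fun ξ => (bracketSymbol σ ξ : ℂ)) ξ‖ = ‖fderiv ℝ (bracketSymbol σ) ξ‖ := by
    rw [norm_fderiv_eq, hf, Complex.ofRealLI.norm_iteratedFDeriv_comp_left
      ((contDiff_bracketSymbol σ).of_le (by norm_cast)).contDiffAt le_rfl]
    rw [← norm_iteratedFDeriv_fderiv, norm_iteratedFDeriv_zero]
  have e2 : ‖fderiv ℝ (fderiv ℝ fun ξ => (bracketSymbol σ ξ : ℂ)) ξ‖
      = ‖fderiv ℝ (fderiv ℝ (bracketSymbol σ)) ξ‖ := by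
    rw [norm_fderiv_fderiv_eq, hf, Complex.ofRealLI.norm_iteratedFDeriv_comp_left
      ((contDiff_bracketSymbol σ).of_le (by norm_cast)).contDiffAt le_rfl]
    rw [← norm_iteratedFDeriv_fderiv, ← norm_iteratedFDeriv_fderiv, norm_iteratedFDeriv_zero]
  unfold jetSize
  rw [e1, e2, Complex.norm_real, Real.norm_of_nonneg h0]
  have b1 := norm_fderiv_bracketSymbol_le (σ := σ) ξ
  have b2 := norm_fderiv_fderiv_bracketSymbol_le (σ := σ) ξ
  have c2 : |σ| * (|σ - 2| + 1) ≤ 400 := by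
    rw [abs_of_nonneg hσ0]
    have : |σ - 2| ≤ 18 := abs_le.mpr ⟨by linarith, by linarith⟩
    nlinarith [abs_nonneg (σ - 2)]
  have c1 : |σ| ≤ 20 := by rwa [abs_of_nonneg hσ0]
  have d1 : |σ| * bracketSymbol σ ξ ≤ 20 * bracketSymbol σ ξ := by gcongr
  have d2 : |σ| * (|σ - 2| + 1) * bracketSymbol σ ξ ≤ 400 * bracketSymbol σ ξ := by gcongr
  linarith

/-- The function `⟨2πξ⟩^σ c(ξ/R) (1 - c(sξ))`, which truncates the symbol of `⟨D⟩^σ` to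
frequencies between `1/s` and `R`. -/
def truncSymbol (c : E4 → ℂ) (σ s R : ℝ) (ξ : E4) : ℂ :=
  (bracketSymbol σ ξ : ℂ) * (c (R⁻¹ • ξ) * (1 - c (s • ξ)))

/-- A smooth cutoff function: equal to `1` on the ball of radius `2`, and supported in the ball of
radius `3`. -/
structure IsCutoff (c : E4 → ℂ) : Prop where
  smooth : ContDiff ℝ ∞ c
  one : ∀ ξ, ‖ξ‖ < 2 → c ξ = 1
  supp : ∀ ξ, c ξ ≠ 0 → ‖ξ‖ ≤ 3
  norm_le : ∀ ξ, ‖c ξ‖ ≤ 1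

lemma exists_isCutoff : ∃ c : E4 → ℂ, IsCutoff c := by
  obtain ⟨χ, h1, h2, h3⟩ := exists_cutoff 1 one_pos
  refine ⟨χ, χ.smooth ⊤, fun ξ hξ => ?_, fun ξ hξ => by simpa using h2 ξ hξ, h3⟩
  simpa using (h1 ξ (by simpa using hξ)).eq_of_nhds

lemma IsCutoff.hasCompactSupport {c : E4 → ℂ} (hc : IsCutoff c) : HasCompactSupport c :=
  HasCompactSupport.of_support_subset_isCompact (isCompact_closedBall (0 : E4) 3) fun ξ hξ => by
    simpa using hc.supp ξ hξ

section trunc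

variable {c : E4 → ℂ} (hc : IsCutoff c) {σ s R : ℝ}
include hc

lemma contDiff_truncSymbol : ContDiff ℝ ∞ (truncSymbol c σ s R) :=
  (Complex.ofRealCLM.contDiff.comp (contDiff_bracketSymbol σ)).mul
    ((hc.smooth.comp (contDiff_const_smul R⁻¹)).mul
      (contDiff_const.sub (hc.smooth.comp (contDiff_const_smul s))))

lemma truncSymbol_eq_zero_of_lt (hs : 0 < s) {ξ : E4} (hξ : ‖ξ‖ < 2 / s) :
    truncSymbol c σ s R ξ = 0 := by
  have : c (s • ξ) = 1 := hc.one _ (by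
    rw [norm_smul, Real.norm_of_nonneg hs.le]
    rwa [lt_div_iff₀ hs, mul_comm] at hξ)
  simp [truncSymbol, this]

lemma norm_le_of_truncSymbol_ne_zero (hR : 0 < R) {ξ : E4} (hξ : truncSymbol c σ s R ξ ≠ 0) :
    ‖ξ‖ ≤ 3 * R := by
  have h1 : c (R⁻¹ • ξ) ≠ 0 := left_ne_zero_of_mul (right_ne_zero_of_mul hξ)
  have := hc.supp _ h1
  rwa [norm_smul, norm_inv, Real.norm_of_nonneg hR.le, inv_mul_le_iff₀ hR, mul_comm] at this

lemma isTest_truncSymbol (hs : 0 < s) (hR : 0 < R) : IsTest (truncSymbol c σ s R) := by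
  refine ⟨contDiff_truncSymbol hc, HasCompactSupport.of_support_subset_isCompact
    (isCompact_closedBall (0 : E4) (3 * R)) fun ξ hξ => ?_, ?_⟩
  · simpa using norm_le_of_truncSymbol_ne_zero hc hR hξ
  · rw [notMem_tsupport_iff_eventuallyEq]
    filter_upwards [Metric.ball_mem_nhds (0 : E4) (by positivity : 0 < 2 / s)] with ξ hξ
    exact truncSymbol_eq_zero_of_lt hc hs (by simpa using hξ)

end trunc

/-- The truncated symbols are symbols of order zero, with a constant that grows polynomially in the
upper frequency bound. -/
lemma exists_jetSize_truncSymbol_le {c : E4 → ℂ} (hc : IsCutoff c) :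
    ∃ C : ℝ, 0 < C ∧ ∀ σ, 0 ≤ σ → σ ≤ 20 → ∀ s, 0 < s → ∀ R, 1 ≤ R → ∀ ξ,
      jetSize (truncSymbol c σ s R) ξ ≤ C * R ^ 20 := by
  obtain ⟨C, hC, hCb⟩ := exists_jetSize_le hc.smooth hc.hasCompactSupport
  refine ⟨2 * (421 * 400 ^ 10 * (2 * (C * (1 + C)))), by positivity,
    fun σ hσ0 hσ s hs R hR ξ => ?_⟩
  have hR0 : 0 < R := by linarith
  have cR : ContDiff ℝ ∞ fun ξ : E4 => c (R⁻¹ • ξ) := hc.smooth.comp (contDiff_const_smul R⁻¹)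
  have cs : ContDiff ℝ ∞ fun ξ : E4 => c (s • ξ) := hc.smooth.comp (contDiff_const_smul s)
  have hw : ContDiff ℝ ∞ fun ξ : E4 => (bracketSymbol σ ξ : ℂ) :=
    Complex.ofRealCLM.contDiff.comp (contDiff_bracketSymbol σ)
  have j1 : jetSize (fun ξ => c (R⁻¹ • ξ)) ξ ≤ C := by
    rw [jetSize_comp_smul hc.smooth (by positivity)]; exact hCb _
  have j2 : jetSize (fun ξ => 1 - c (s • ξ)) ξ ≤ 1 + C := by
    have e : jetSize (fun ξ => c (s • ξ)) ξ ≤ C := by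
      rw [jetSize_comp_smul hc.smooth hs.le]; exact hCb _
    have e1 : ∀ ξ, fderiv ℝ (fun ξ => 1 - c (s • ξ)) ξ = -fderiv ℝ (fun ξ => c (s • ξ)) ξ :=
      fun ξ => fderiv_const_sub 1
    have e2 : fderiv ℝ (fun ξ => 1 - c (s • ξ)) = fun ξ => -fderiv ℝ (fun ξ => c (s • ξ)) ξ :=
      funext e1
    have e3 : ‖fderiv ℝ (fun ξ => -fderiv ℝ (fun ξ => c (s • ξ)) ξ) ξ‖
        = ‖fderiv ℝ (fderiv ℝ (fun ξ => c (s • ξ))) ξ‖ := by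
      have := fderiv_fun_neg (𝕜 := ℝ) (f := fderiv ℝ (fun ξ => c (s • ξ))) (x := ξ)
      rw [this]
      exact norm_neg (E := E4 →L[ℝ] E4 →L[ℝ] ℂ) _
    unfold jetSize at e ⊢
    rw [e2, e3, norm_neg]
    have := norm_sub_le (1 : ℂ) (c (s • ξ))
    rw [norm_one] at this
    linarith
  have j3 : jetSize (fun ξ => c (R⁻¹ • ξ) * (1 - c (s • ξ))) ξ ≤ 2 * (C * (1 + C)) := by
    refine (jetSize_mul cR (contDiff_const.sub cs) ξ).trans ?_
    have := jetSize_nonneg (fun ξ => 1 - c (s • ξ)) ξ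
    gcongr
  by_cases hξ : ‖ξ‖ ≤ 3 * R
  · refine (jetSize_mul hw (cR.mul (contDiff_const.sub cs)) ξ).trans ?_
    have h1 := (jetSize_bracketSymbol_le hσ0 hσ ξ).trans
      (mul_le_mul_of_nonneg_left (bracketSymbol_le hσ hR hξ) (by norm_num))
    have := jetSize_nonneg (fun ξ => c (R⁻¹ • ξ) * (1 - c (s • ξ))) ξ
    calc _ ≤ 2 * ((421 * (400 ^ 10 * R ^ 20)) * (2 * (C * (1 + C)))) := by gcongr
      _ = _ := by ring
  · have hz : truncSymbol c σ s R =ᶠ[nhds ξ] fun _ => 0 := by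
      filter_upwards [(isOpen_lt continuous_const continuous_norm).mem_nhds
        (show 3 * R < ‖ξ‖ from not_le.mp hξ)] with η hη
      by_contra h
      exact absurd (norm_le_of_truncSymbol_ne_zero hc hR0 h) (not_le.mpr hη)
    have h0 : jetSize (truncSymbol c σ s R) ξ = 0 := by
      unfold jetSize
      have hz2 : ‖fderiv ℝ (fderiv ℝ fun _ : E4 => (0 : ℂ)) ξ‖ = 0 := by
        rw [norm_fderiv_fderiv_eq]
        simp
      rw [hz.fderiv_eq, hz.fderiv.fderiv_eq, hz.eq_of_nhds, hz2]
      simp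
    rw [h0]
    positivity

/-! ### The adjoint of the radial derivative -/

/-- The components of the radial unit vector field `ξ / |ξ|`. -/
def unitDir (j : Fin 4) (ξ : E4) : ℂ := ((ξ j * ‖ξ‖⁻¹ : ℝ) : ℂ)

/-- The radial frequency variable `2π|ξ|`. -/
def radialVar (ξ : E4) : ℂ := ((2 * π * ‖ξ‖ : ℝ) : ℂ)

/-- The symbol `e^{2πiτ|ξ|}` of the half-wave propagator `e^{iτ|D|}`. -/
def halfPhase (τ : ℝ) (ξ : E4) : ℂ := Complex.exp (Complex.I * (τ * radialVar ξ))

lemma norm_halfPhase (τ : ℝ) (ξ : E4) : ‖halfPhase τ ξ‖ = 1 := by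
  unfold halfPhase radialVar
  rw [← Complex.ofReal_mul, mul_comm, Complex.norm_exp_ofReal_mul_I]

lemma continuous_halfPhase (τ : ℝ) : Continuous (halfPhase τ) := by
  unfold halfPhase radialVar
  fun_prop

lemma halfPhase_add (τ τ' : ℝ) (ξ : E4) :
    halfPhase (τ + τ') ξ = halfPhase τ ξ * halfPhase τ' ξ := by
  unfold halfPhase
  rw [← Complex.exp_add]
  push_cast
  ring_nf

lemma halfPhase_zero (ξ : E4) : halfPhase 0 ξ = 1 := by simp [halfPhase]

lemma halfPhase_neg_mul (τ : ℝ) (ξ : E4) : halfPhase (-τ) ξ * halfPhase τ ξ = 1 := by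
  rw [← halfPhase_add, neg_add_cancel, halfPhase_zero]

lemma conj_halfPhase (τ : ℝ) (ξ : E4) :
    (starRingEnd ℂ) (halfPhase τ ξ) = halfPhase (-τ) ξ := by
  unfold halfPhase radialVar
  rw [← Complex.exp_conj, map_mul, map_mul, Complex.conj_I, Complex.conj_ofReal,
    Complex.conj_ofReal]
  push_cast
  ring_nf

lemma contDiffOn_unitDir (j : Fin 4) : ContDiffOn ℝ ∞ (unitDir j) {0}ᶜ := by
  refine Complex.ofRealCLM.contDiff.comp_contDiffOn fun ξ hξ => ?_
  have h0 : ‖ξ‖ ≠ 0 := norm_ne_zero_iff.mpr hξ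
  have hn : ContDiffAt ℝ ∞ (fun ξ : E4 => ‖ξ‖) ξ := contDiffAt_norm ℝ hξ
  exact (((EuclideanSpace.proj j : E4 →L[ℝ] ℝ).contDiff.contDiffAt).mul
    (hn.inv h0)).contDiffWithinAt

lemma contDiffOn_radialVar : ContDiffOn ℝ ∞ radialVar {0}ᶜ := by
  refine Complex.ofRealCLM.contDiff.comp_contDiffOn fun ξ hξ => ?_
  have hn : ContDiffAt ℝ ∞ (fun ξ : E4 => ‖ξ‖) ξ := contDiffAt_norm ℝ hξ
  exact (contDiffAt_const.mul hn).contDiffWithinAt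

lemma contDiffOn_halfPhase (τ : ℝ) : ContDiffOn ℝ ∞ (halfPhase τ) {0}ᶜ :=
  (contDiffOn_const.mul (contDiffOn_const.mul contDiffOn_radialVar)).cexp

lemma norm_unitDir_le (j : Fin 4) (ξ : E4) : ‖unitDir j ξ‖ ≤ 1 := by
  unfold unitDir
  rw [Complex.norm_real, norm_mul, norm_inv, norm_norm]
  exact mul_inv_le_one_of_le₀ (PiLp.norm_apply_le ξ j) (norm_nonneg _)

lemma IsTest.unitDir_mul {φ : E4 → ℂ} (hφ : IsTest φ) (j : Fin 4) :
    IsTest (fun ξ => unitDir j ξ * φ ξ) := hφ.mul_left (contDiffOn_unitDir j)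

lemma IsTest.radialVar_mul {φ : E4 → ℂ} (hφ : IsTest φ) :
    IsTest (fun ξ => radialVar ξ * φ ξ) := hφ.mul_left contDiffOn_radialVar

lemma IsTest.halfPhase_mul {φ : E4 → ℂ} (hφ : IsTest φ) (τ : ℝ) :
    IsTest (fun ξ => halfPhase τ ξ * φ ξ) := hφ.mul_left (contDiffOn_halfPhase τ)

/-- The formal adjoint of the derivative with respect to the radial variable `2π|ξ|`. -/
def radialAdj (φ : E4 → ℂ) (ξ : E4) : ℂ :=
  -(2 * π : ℂ)⁻¹ * ∑ j, fderiv ℝ (fun η => unitDir j η * φ η) ξ (coordDir j)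

lemma IsTest.radialAdj {φ : E4 → ℂ} (hφ : IsTest φ) : IsTest (radialAdj φ) :=
  (IsTest.sum Finset.univ fun j => (hφ.unitDir_mul j).fderiv_apply (coordDir j)).const_mul _

/-- The product rule for the adjoint of the radial derivative. -/
lemma radialAdj_mul {φ c : E4 → ℂ} (hφ : IsTest φ) (hc : ContDiffOn ℝ ∞ c {0}ᶜ) (d : E4 → ℂ)
    (hd : ∀ ξ ≠ 0, fderiv ℝ c ξ (‖ξ‖⁻¹ • ξ) = 2 * π * d ξ) (ξ : E4) :
    radialAdj (fun ξ => c ξ * φ ξ) ξ = c ξ * radialAdj φ ξ - d ξ * φ ξ := by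
  by_cases h0 : ξ = 0
  · rw [h0, (hφ.mul_left hc).radialAdj.eq_zero_of_eq_zero, hφ.radialAdj.eq_zero_of_eq_zero,
      hφ.eq_zero_of_eq_zero]
    ring
  · have hcd : DifferentiableAt ℝ c ξ :=
      (hc.contDiffAt (isOpen_compl_singleton.mem_nhds h0)).differentiableAt (by simp)
    have h1 : ∀ j, fderiv ℝ (fun η => unitDir j η * (c η * φ η)) ξ (coordDir j)
        = c ξ * fderiv ℝ (fun η => unitDir j η * φ η) ξ (coordDir j)
          + unitDir j ξ * fderiv ℝ c ξ (coordDir j) * φ ξ := fun j => by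
      have : (fun η => unitDir j η * (c η * φ η)) = fun η => c η * (unitDir j η * φ η) := by
        ext η; ring
      rw [this, fderiv_fun_mul hcd ((hφ.unitDir_mul j).smooth.differentiable (by simp) ξ)]
      simp
      ring
    have h2 : ∑ j, unitDir j ξ * fderiv ℝ c ξ (coordDir j) = 2 * π * d ξ := by
      rw [← hd ξ h0]
      have hy : ‖ξ‖⁻¹ • ξ = ∑ j, (ξ j * ‖ξ‖⁻¹) • coordDir j := by
        refine (congrArg (‖ξ‖⁻¹ • ·) (eq_sum_coordDir ξ)).trans ?_
        beta_reduce
        rw [Finset.smul_sum]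
        exact Finset.sum_congr rfl fun j _ => by rw [smul_smul, mul_comm]
      rw [hy, map_sum]
      refine Finset.sum_congr rfl fun j _ => ?_
      rw [map_smul, Complex.real_smul]
      rfl
    have hpi : (π : ℂ) ≠ 0 := by exact_mod_cast pi_ne_zero
    unfold MaxwellDecay.radialAdj
    simp only [h1, Finset.sum_add_distrib, ← Finset.mul_sum, ← Finset.sum_mul, h2]
    field_simp
    ring

/-- The derivative in the radial direction is read off along the ray through `ξ`. -/
lemma fderiv_radial {c : E4 → ℂ} (hc : ContDiffOn ℝ ∞ c {0}ᶜ) {ξ : E4} (h0 : ξ ≠ 0) {d : ℂ}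
    (hd : HasDerivAt (fun t : ℝ => c ((1 + t * ‖ξ‖⁻¹) • ξ)) d 0) :
    fderiv ℝ c ξ (‖ξ‖⁻¹ • ξ) = d := by
  have hcd : DifferentiableAt ℝ c ξ :=
    (hc.contDiffAt (isOpen_compl_singleton.mem_nhds h0)).differentiableAt (by simp)
  have hl : HasDerivAt (fun t : ℝ => (1 + t * ‖ξ‖⁻¹) • ξ) (‖ξ‖⁻¹ • ξ) 0 := by
    simpa using (((hasDerivAt_id (0 : ℝ)).mul_const ‖ξ‖⁻¹).const_add 1).smul_const ξ
  have hcd' : HasFDerivAt c (fderiv ℝ c ξ) ((1 + (0 : ℝ) * ‖ξ‖⁻¹) • ξ) := by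
    simpa using hcd.hasFDerivAt
  exact (hcd'.comp_hasDerivAt (0 : ℝ) hl).unique hd

lemma eventually_norm_ray {ξ : E4} (h0 : ξ ≠ 0) :
    ∀ᶠ t : ℝ in nhds 0, 0 < 1 + t * ‖ξ‖⁻¹ ∧ ‖(1 + t * ‖ξ‖⁻¹) • ξ‖ = ‖ξ‖ + t := by
  have hc : ContinuousAt (fun t : ℝ => 1 + t * ‖ξ‖⁻¹) 0 := by fun_prop
  have : ∀ᶠ t : ℝ in nhds 0, 0 < 1 + t * ‖ξ‖⁻¹ := hc.eventually_const_lt (by simp)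
  filter_upwards [this] with t ht
  refine ⟨ht, ?_⟩
  have hr : ‖ξ‖ ≠ 0 := norm_ne_zero_iff.mpr h0
  rw [norm_smul, Real.norm_of_nonneg ht.le]
  field_simp

lemma radialAdj_unitDir {φ : E4 → ℂ} (hφ : IsTest φ) (j : Fin 4) (ξ : E4) :
    radialAdj (fun ξ => unitDir j ξ * φ ξ) ξ = unitDir j ξ * radialAdj φ ξ := by
  have := radialAdj_mul hφ (contDiffOn_unitDir j) (fun _ => 0) (fun ξ h0 => ?_) ξ
  · simpa using this
  · rw [mul_zero]
    refine fderiv_radial (contDiffOn_unitDir j) h0 ?_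
    refine (hasDerivAt_const (0 : ℝ) (unitDir j ξ)).congr_of_eventuallyEq ?_
    filter_upwards [eventually_norm_ray h0] with t ht
    have hr : ‖ξ‖ ≠ 0 := norm_ne_zero_iff.mpr h0
    unfold unitDir
    rw [norm_smul, Real.norm_of_nonneg ht.1.le, PiLp.smul_apply, smul_eq_mul]
    congr 1
    have := ht.1.ne'
    generalize 1 + t * ‖ξ‖⁻¹ = x at this
    field_simp

lemma radialAdj_radialVar {φ : E4 → ℂ} (hφ : IsTest φ) (ξ : E4) :
    radialAdj (fun ξ => radialVar ξ * φ ξ) ξ = radialVar ξ * radialAdj φ ξ - φ ξ := by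
  have := radialAdj_mul hφ contDiffOn_radialVar (fun _ => 1) (fun ξ h0 => ?_) ξ
  · simpa using this
  · refine fderiv_radial contDiffOn_radialVar h0 ?_
    have h : HasDerivAt (fun t : ℝ => ((2 * π * (‖ξ‖ + t) : ℝ) : ℂ)) (2 * π * 1) 0 := by
      have := (((hasDerivAt_id (0 : ℝ)).const_add ‖ξ‖).const_mul (2 * π)).ofReal_comp
      simpa using this
    refine h.congr_of_eventuallyEq ?_
    filter_upwards [eventually_norm_ray h0] with t ht
    rw [radialVar, ht.2]

lemma radialAdj_halfPhase {φ : E4 → ℂ} (hφ : IsTest φ) (τ : ℝ) (ξ : E4) :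
    radialAdj (fun ξ => halfPhase τ ξ * φ ξ) ξ
      = halfPhase τ ξ * radialAdj φ ξ - Complex.I * τ * (halfPhase τ ξ * φ ξ) := by
  have := radialAdj_mul hφ (contDiffOn_halfPhase τ) (fun ξ => Complex.I * τ * halfPhase τ ξ)
    (fun ξ h0 => ?_) ξ
  · rw [this]; ring
  · refine fderiv_radial (contDiffOn_halfPhase τ) h0 ?_
    have h : HasDerivAt (fun t : ℝ => Complex.exp (Complex.I * (τ * ((2 * π * (‖ξ‖ + t) : ℝ) : ℂ))))
        (2 * π * (Complex.I * τ * halfPhase τ ξ)) 0 := by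
      have h1 : HasDerivAt (fun t : ℝ => ((2 * π * (‖ξ‖ + t) : ℝ) : ℂ)) (2 * π) 0 := by
        have := (((hasDerivAt_id (0 : ℝ)).const_add ‖ξ‖).const_mul (2 * π)).ofReal_comp
        simpa using this
      have h2 := ((h1.const_mul (τ : ℂ)).const_mul Complex.I).cexp
      convert h2 using 1
      simp only [halfPhase, radialVar, add_zero]
      ring
    refine h.congr_of_eventuallyEq ?_
    filter_upwards [eventually_norm_ray h0] with t ht
    rw [halfPhase, radialVar, ht.2]

/-- The `L²` norm of `|ξ|^{-k} φ`. -/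
def negNorm (k : ℕ) (φ : E4 → ℂ) : ℝ :=
  (eLpNorm (fun ξ => ((‖ξ‖ ^ (-k : ℤ) : ℝ) : ℂ) * φ ξ) 2 volume).toReal

lemma negNorm_nonneg (k : ℕ) (φ : E4 → ℂ) : 0 ≤ negNorm k φ := ENNReal.toReal_nonneg

lemma negNorm_mono {φ ψ : E4 → ℂ} (hψ : IsTest ψ) (k : ℕ) (h : ∀ ξ, ‖φ ξ‖ ≤ ‖ψ ξ‖) :
    negNorm k φ ≤ negNorm k ψ := by
  refine ENNReal.toReal_mono ((hψ.weight_div k).memLp 2).2.ne (eLpNorm_mono fun ξ => ?_)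
  rw [norm_mul, norm_mul]
  gcongr
  exact h ξ

lemma negNorm_radialVar {φ : E4 → ℂ} (hφ : IsTest φ) :
    negNorm 2 (fun ξ => radialVar ξ * φ ξ) = 2 * π * negNorm 1 φ := by
  have h : (fun ξ => ((‖ξ‖ ^ (-(2 : ℕ) : ℤ) : ℝ) : ℂ) * (radialVar ξ * φ ξ))
      = (2 * π : ℂ) • fun ξ => ((‖ξ‖ ^ (-(1 : ℕ) : ℤ) : ℝ) : ℂ) * φ ξ := by
    ext ξ
    simp only [Pi.smul_apply, smul_eq_mul]
    by_cases h0 : ξ = 0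
    · rw [h0, hφ.eq_zero_of_eq_zero]; simp
    · have hr : (‖ξ‖ : ℂ) ≠ 0 := by exact_mod_cast norm_ne_zero_iff.mpr h0
      simp only [radialVar, zpow_neg, zpow_natCast]
      push_cast
      field_simp
  have he : ‖(2 * π : ℂ)‖ₑ = ENNReal.ofReal (2 * π) := by
    rw [← ofReal_norm, norm_mul, Complex.norm_ofNat, Complex.norm_real,
      Real.norm_of_nonneg pi_pos.le]
  unfold negNorm
  rw [h, eLpNorm_const_smul, he, ENNReal.toReal_mul, ENNReal.toReal_ofReal (by positivity)]

lemma norm_integral_le_negNorm {k : ℕ} {f φ : E4 → ℂ} {M : ℝ} (hM : 0 ≤ M) (hf : MemWeight k f)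
    (hfM : eLpNorm (fun ξ => ((‖ξ‖ ^ k : ℝ) : ℂ) * f ξ) 2 volume ≤ ENNReal.ofReal M)
    (hφ : IsTest φ) : ‖∫ ξ, φ ξ * f ξ‖ ≤ negNorm k φ * M := by
  have h := (hf.enorm_integral_le hφ).trans (mul_le_mul_right hfM _)
  have hfin := ((hφ.weight_div k).memLp 2).2.ne
  rw [← ofReal_norm, ← ENNReal.ofReal_toReal hfin, ← ENNReal.ofReal_mul ENNReal.toReal_nonneg] at h
  exact (ENNReal.ofReal_le_ofReal_iff (mul_nonneg ENNReal.toReal_nonneg hM)).mp h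

section pairing

variable {f : E4 → ℂ} {f₁ : Fin 4 → E4 → ℂ} {f₂ : Fin 4 → Fin 4 → E4 → ℂ} {M : ℝ}

lemma integral_radialAdj {f : E4 → ℂ} {f₁ : Fin 4 → E4 → ℂ} {k : ℕ} (hf : MemWeight k f)
    (h : ∀ j, WeakDerivOff (coordDir j) f (f₁ j)) {φ : E4 → ℂ} (hφ : IsTest φ) :
    ∫ ξ, radialAdj φ ξ * f ξ = (2 * π : ℂ)⁻¹ * ∑ j, ∫ ξ, (unitDir j ξ * φ ξ) * f₁ j ξ := by
  have hi : ∀ j, Integrable (fun ξ => fderiv ℝ (fun η => unitDir j η * φ η) ξ (coordDir j) * f ξ)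
      volume := fun j => hf.integrable ((hφ.unitDir_mul j).fderiv_apply _)
  have h1 : ∀ j, ∫ ξ, (unitDir j ξ * φ ξ) * f₁ j ξ
      = -∫ ξ, fderiv ℝ (fun η => unitDir j η * φ η) ξ (coordDir j) * f ξ := fun j => by
    rw [h j _ (hφ.unitDir_mul j), neg_neg]
  simp only [h1, Finset.sum_neg_distrib]
  rw [← integral_finsetSum _ fun j _ => hi j, ← neg_mul_comm, ← integral_const_mul]
  refine integral_congr_ae (ae_of_all _ fun ξ => ?_)
  simp only [radialAdj, Finset.mul_sum, Finset.sum_mul]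
  exact Finset.sum_congr rfl fun j _ => by ring

/-- One radial integration by parts costs one weight `|ξ|⁻¹` on the test function. -/
lemma HasJet.norm_integral_radialAdj_le (h : HasJet f f₁ f₂ M) (hM : 0 ≤ M) {φ : E4 → ℂ}
    (hφ : IsTest φ) : ‖∫ ξ, radialAdj φ ξ * f ξ‖ ≤ M * negNorm 1 φ := by
  rw [integral_radialAdj h.mem h.deriv₁ hφ, norm_mul, norm_inv, norm_mul, Complex.norm_ofNat,
    Complex.norm_real, Real.norm_of_nonneg pi_pos.le]
  have hj : ∀ j, ‖∫ ξ, (unitDir j ξ * φ ξ) * f₁ j ξ‖ ≤ negNorm 1 φ * M := fun j => by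
    refine (norm_integral_le_negNorm hM (h.mem₁ j) (h.norm₁ j) (hφ.unitDir_mul j)).trans ?_
    refine mul_le_mul_of_nonneg_right (negNorm_mono hφ 1 fun ξ => ?_) hM
    rw [norm_mul]
    exact mul_le_of_le_one_left (norm_nonneg _) (norm_unitDir_le j ξ)
  have hs := (norm_sum_le Finset.univ fun j => ∫ ξ, (unitDir j ξ * φ ξ) * f₁ j ξ).trans
    (Finset.sum_le_sum fun j _ => hj j)
  rw [Finset.sum_const, Finset.card_univ, Fintype.card_fin, nsmul_eq_mul] at hs
  have hN := mul_nonneg (negNorm_nonneg 1 φ) hM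
  rw [inv_mul_le_iff₀ (by positivity)]
  push_cast at hs
  nlinarith [pi_gt_three]

lemma HasJet.norm_integral_radialAdj_radialAdj_le (h : HasJet f f₁ f₂ M) (hM : 0 ≤ M)
    {φ : E4 → ℂ} (hφ : IsTest φ) :
    ‖∫ ξ, radialAdj (radialAdj φ) ξ * f ξ‖ ≤ M * negNorm 2 φ := by
  rw [integral_radialAdj h.mem h.deriv₁ hφ.radialAdj, norm_mul, norm_inv, norm_mul,
    Complex.norm_ofNat, Complex.norm_real, Real.norm_of_nonneg pi_pos.le]
  have hj : ∀ j, ‖∫ ξ, (unitDir j ξ * radialAdj φ ξ) * f₁ j ξ‖ ≤ negNorm 2 φ * M := fun j => by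
    simp only [← radialAdj_unitDir hφ j]
    rw [integral_radialAdj (h.mem₁ j) (fun i => h.deriv₂ i j) (hφ.unitDir_mul j), norm_mul,
      norm_inv, norm_mul, Complex.norm_ofNat, Complex.norm_real, Real.norm_of_nonneg pi_pos.le]
    have hi : ∀ i, ‖∫ ξ, (unitDir i ξ * (unitDir j ξ * φ ξ)) * f₂ i j ξ‖ ≤ negNorm 2 φ * M :=
      fun i => by
      refine (norm_integral_le_negNorm hM (h.mem₂ i j) (h.norm₂ i j)
        ((hφ.unitDir_mul j).unitDir_mul i)).trans ?_
      refine mul_le_mul_of_nonneg_right (negNorm_mono hφ 2 fun ξ => ?_) hM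
      rw [norm_mul, norm_mul]
      exact (mul_le_of_le_one_left (by positivity) (norm_unitDir_le i ξ)).trans
        (mul_le_of_le_one_left (norm_nonneg _) (norm_unitDir_le j ξ))
    have hs := (norm_sum_le Finset.univ fun i =>
      ∫ ξ, (unitDir i ξ * (unitDir j ξ * φ ξ)) * f₂ i j ξ).trans
        (Finset.sum_le_sum fun i _ => hi i)
    rw [Finset.sum_const, Finset.card_univ, Fintype.card_fin, nsmul_eq_mul] at hs
    have hN := mul_nonneg (negNorm_nonneg 2 φ) hM
    rw [inv_mul_le_iff₀ (by positivity)]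
    push_cast at hs
    nlinarith [pi_gt_three]
  have hs := (norm_sum_le Finset.univ fun j => ∫ ξ, (unitDir j ξ * radialAdj φ ξ) * f₁ j ξ).trans
    (Finset.sum_le_sum fun j _ => hj j)
  rw [Finset.sum_const, Finset.card_univ, Fintype.card_fin, nsmul_eq_mul] at hs
  have hN := mul_nonneg (negNorm_nonneg 2 φ) hM
  rw [inv_mul_le_iff₀ (by positivity)]
  push_cast at hs
  nlinarith [pi_gt_three]

end pairing

/-! ### Differentiation of integrals with an oscillating factor -/

lemma norm_exp_I_mul_sub_one_sub_le (x : ℝ) :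
    ‖Complex.exp (Complex.I * x) - 1 - Complex.I * x‖ ≤ 3 * x ^ 2 := by
  rcases le_or_gt |x| 1 with h | h
  · have hx : ‖Complex.I * (x : ℂ)‖ = |x| := by simp
    have := Complex.norm_exp_sub_one_sub_id_le (x := Complex.I * x) (by rwa [hx])
    rw [hx, sq_abs] at this
    nlinarith [sq_nonneg x]
  · calc ‖Complex.exp (Complex.I * x) - 1 - Complex.I * x‖
        ≤ ‖Complex.exp (Complex.I * x) - 1‖ + ‖Complex.I * (x : ℂ)‖ := norm_sub_le _ _
      _ ≤ |x| + |x| := by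
        gcongr
        · exact Real.norm_exp_I_mul_ofReal_sub_one_le
        · simp
      _ ≤ 3 * x ^ 2 := by rw [← sq_abs x]; nlinarith

/-- The class in `L²` of a test function multiplied by a half-wave phase. -/
def phaseLp {θ : E4 → ℂ} (hθ : IsTest θ) (τ : ℝ) : L2C := ((hθ.halfPhase_mul τ).memLp 2).toLp _

lemma coeFn_phaseLp {θ : E4 → ℂ} (hθ : IsTest θ) (τ : ℝ) :
    ∀ᵐ ξ, phaseLp hθ τ ξ = halfPhase τ ξ * θ ξ := MemLp.coeFn_toLp _

lemma hasDerivAt_phaseLp {θ : E4 → ℂ} (hθ : IsTest θ) (τ : ℝ) :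
    HasDerivAt (phaseLp hθ) (Complex.I • phaseLp hθ.radialVar_mul τ) τ := by
  rw [hasDerivAt_iff_isLittleO_nhds_zero]
  set N : L2C := (hθ.radialVar_mul.radialVar_mul.memLp 2).toLp _ with hN
  have hb : ∀ h : ℝ, ‖phaseLp hθ (τ + h) - phaseLp hθ τ
      - h • (Complex.I • phaseLp hθ.radialVar_mul τ)‖ ≤ 3 * ‖N‖ * ‖h ^ 2‖ := fun h => by
    have hle : ‖phaseLp hθ (τ + h) - phaseLp hθ τ
        - h • (Complex.I • phaseLp hθ.radialVar_mul τ)‖ ≤ 3 * h ^ 2 * ‖N‖ := by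
      refine Lp.norm_le_mul_norm_of_ae_le_mul ?_
      filter_upwards [Lp.coeFn_sub (phaseLp hθ (τ + h) - phaseLp hθ τ)
          (h • (Complex.I • phaseLp hθ.radialVar_mul τ)),
        Lp.coeFn_sub (phaseLp hθ (τ + h)) (phaseLp hθ τ),
        Lp.coeFn_smul h (Complex.I • phaseLp hθ.radialVar_mul τ),
        Lp.coeFn_smul Complex.I (phaseLp hθ.radialVar_mul τ), coeFn_phaseLp hθ (τ + h),
        coeFn_phaseLp hθ τ, coeFn_phaseLp hθ.radialVar_mul τ,
        MemLp.coeFn_toLp (hθ.radialVar_mul.radialVar_mul.memLp 2)] with ξ e1 e2 e3 e4 e5 e6 e7 e8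
      rw [e1, Pi.sub_apply, e2, Pi.sub_apply, e3, Pi.smul_apply, e4, Pi.smul_apply, e5, e6, e7,
        hN, e8, halfPhase_add]
      set x : ℝ := h * (2 * π * ‖ξ‖) with hx
      have hph : halfPhase h ξ = Complex.exp (Complex.I * x) := by
        rw [halfPhase, radialVar, hx]; push_cast; rfl
      have hrw : halfPhase τ ξ * halfPhase h ξ * θ ξ - halfPhase τ ξ * θ ξ
          - h • Complex.I • (halfPhase τ ξ * (radialVar ξ * θ ξ))
          = halfPhase τ ξ * (Complex.exp (Complex.I * x) - 1 - Complex.I * x) * θ ξ := by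
        rw [hph, Complex.real_smul, smul_eq_mul, hx, radialVar]
        push_cast
        ring
      rw [hrw, norm_mul, norm_mul, norm_halfPhase, one_mul]
      have hrad : ‖radialVar ξ‖ = 2 * π * ‖ξ‖ := by
        rw [radialVar, Complex.norm_real, Real.norm_of_nonneg (by positivity)]
      calc _ ≤ 3 * x ^ 2 * ‖θ ξ‖ := by gcongr; exact norm_exp_I_mul_sub_one_sub_le x
        _ = _ := by rw [norm_mul, norm_mul, hrad, hx]; ring
    refine hle.trans (le_of_eq ?_)
    rw [Real.norm_of_nonneg (sq_nonneg h)]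
    ring
  have hO : (fun h : ℝ => phaseLp hθ (τ + h) - phaseLp hθ τ
      - h • (Complex.I • phaseLp hθ.radialVar_mul τ)) =O[nhds 0] fun h : ℝ => h ^ 2 :=
    Asymptotics.IsBigO.of_bound (3 * ‖N‖) (Filter.Eventually.of_forall hb)
  refine hO.trans_isLittleO ?_
  simpa using (Asymptotics.isLittleO_pow_id (𝕜 := ℝ) (n := 2) (by norm_num))

lemma IsTest.conj {θ : E4 → ℂ} (hθ : IsTest θ) : IsTest (fun ξ => (starRingEnd ℂ) (θ ξ)) := by
  have hs : Function.support (fun ξ => (starRingEnd ℂ) (θ ξ)) ⊆ Function.support θ :=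
    fun ξ hξ h0 => hξ (by simp [h0])
  exact ⟨Complex.conjCLE.contDiff.comp hθ.smooth, hθ.compact.comp_left (map_zero _), fun h =>
    hθ.zero_notMem (closure_mono hs h)⟩

lemma inner_phaseLp {θ : E4 → ℂ} (hθ : IsTest θ) (τ : ℝ) (u : L2C) :
    inner ℂ (phaseLp hθ.conj τ) u = ∫ ξ, (halfPhase (-τ) ξ * θ ξ) * u ξ := by
  rw [MeasureTheory.L2.inner_def]
  refine integral_congr_ae ?_
  filter_upwards [coeFn_phaseLp hθ.conj τ] with ξ hξ
  rw [hξ, RCLike.inner_apply, map_mul, conj_halfPhase, Complex.conj_conj]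
  ring

/-- Differentiation of `∫ e^{-2πiσs|ξ|} θ â(s)` along a differentiable curve in `L²`. -/
lemma hasDerivWithinAt_integral_phase {θ : E4 → ℂ} (hθ : IsTest θ) {a : ℝ → L2C} {b : L2C}
    {S : Set ℝ} {s σ : ℝ} (ha : HasDerivWithinAt a b S s) :
    HasDerivWithinAt (fun s => ∫ ξ, (halfPhase (-(σ * s)) ξ * θ ξ) * a s ξ)
      ((∫ ξ, (halfPhase (-(σ * s)) ξ * θ ξ) * b ξ)
        - Complex.I * σ * ∫ ξ, (halfPhase (-(σ * s)) ξ * (radialVar ξ * θ ξ)) * a s ξ) S s := by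
  have h1 : HasDerivAt (fun s : ℝ => phaseLp hθ.conj (σ * s))
      (σ • (Complex.I • phaseLp hθ.conj.radialVar_mul (σ * s))) s := by
    have hl : HasDerivAt (fun s : ℝ => σ * s) σ s := by
      simpa using (hasDerivAt_id s).const_mul σ
    exact (hasDerivAt_phaseLp hθ.conj (σ * s)).scomp s hl
  have h2 := h1.hasDerivWithinAt.inner (𝕜 := ℂ) (s := S) ha
  have hf : (fun s => ∫ ξ, (halfPhase (-(σ * s)) ξ * θ ξ) * a s ξ)
      = fun s => inner ℂ (phaseLp hθ.conj (σ * s)) (a s) :=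
    funext fun s => (inner_phaseLp hθ (σ * s) (a s)).symm
  rw [hf]
  refine h2.congr_deriv ?_
  have hr : phaseLp hθ.conj.radialVar_mul (σ * s) = phaseLp hθ.radialVar_mul.conj (σ * s) := by
    unfold phaseLp
    congr 1
    ext ξ
    simp only [map_mul]
    rw [show (starRingEnd ℂ) (radialVar ξ) = radialVar ξ from Complex.conj_ofReal _]
  have h3 : σ • (Complex.I • phaseLp hθ.conj.radialVar_mul (σ * s))
      = ((σ : ℂ) * Complex.I) • phaseLp hθ.radialVar_mul.conj (σ * s) := by
    rw [hr, mul_smul]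
    exact RCLike.real_smul_eq_coe_smul (K := ℂ) σ _
  rw [h3, inner_smul_left, inner_phaseLp hθ, inner_phaseLp hθ.radialVar_mul, map_mul,
    Complex.conj_ofReal, Complex.conj_I]
  ring

/-! ### Time increments of the profiles tested against smooth functions -/

lemma radialAdj_sub_const_mul {u v : E4 → ℂ} (hu : IsTest u) (hv : IsTest v) (c : ℂ) (ξ : E4) :
    radialAdj (fun ξ => u ξ - c * v ξ) ξ = radialAdj u ξ - c * radialAdj v ξ := by
  have h : ∀ j, fderiv ℝ (fun η => unitDir j η * (u η - c * v η)) ξ (coordDir j)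
      = fderiv ℝ (fun η => unitDir j η * u η) ξ (coordDir j)
        - c * fderiv ℝ (fun η => unitDir j η * v η) ξ (coordDir j) := fun j => by
    have e : (fun η => unitDir j η * (u η - c * v η))
        = fun η => unitDir j η * u η - c * (unitDir j η * v η) := by ext η; ring
    have du := (hu.unitDir_mul j).smooth.differentiable (by simp) ξ
    have dv := (hv.unitDir_mul j).smooth.differentiable (by simp) ξ
    rw [e, fderiv_fun_sub du (dv.const_mul c), fderiv_const_mul dv]
    simp
  unfold radialAdj
  simp only [h, Finset.sum_sub_distrib, ← Finset.mul_sum]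
  ring

section conjugation

variable {φ : E4 → ℂ} (hφ : IsTest φ) (τ : ℝ)
include hφ

/-- Integration by parts against the phase: the radial derivative of `e^{-2iτ|D|}` produces the
factor `2iτ`, which is large for large times. -/
lemma halfPhase_mul_radialAdj (ξ : E4) :
    halfPhase (-(2 * τ)) ξ * radialAdj φ ξ
      = radialAdj (fun ξ => halfPhase (-(2 * τ)) ξ * φ ξ) ξ
        - 2 * Complex.I * τ * (halfPhase (-(2 * τ)) ξ * φ ξ) := by
  rw [radialAdj_halfPhase hφ]
  push_cast
  ring

lemma halfPhase_mul_radialAdj_radialAdj (ξ : E4) :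
    halfPhase (-(2 * τ)) ξ * radialAdj (radialAdj φ) ξ
      = radialAdj (radialAdj (fun ξ => halfPhase (-(2 * τ)) ξ * φ ξ)) ξ
        - 4 * Complex.I * τ * radialAdj (fun ξ => halfPhase (-(2 * τ)) ξ * φ ξ) ξ
        - 4 * τ ^ 2 * (halfPhase (-(2 * τ)) ξ * φ ξ) := by
  rw [halfPhase_mul_radialAdj hφ.radialAdj, halfPhase_mul_radialAdj hφ]
  have h : (fun ξ => halfPhase (-(2 * τ)) ξ * radialAdj φ ξ)
      = fun ξ => radialAdj (fun ξ => halfPhase (-(2 * τ)) ξ * φ ξ) ξ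
        - 2 * Complex.I * τ * (halfPhase (-(2 * τ)) ξ * φ ξ) :=
    funext fun ξ => halfPhase_mul_radialAdj hφ τ ξ
  rw [h, radialAdj_sub_const_mul (hφ.halfPhase_mul _).radialAdj (hφ.halfPhase_mul _)]
  linear_combination (4 * τ ^ 2 * (halfPhase (-(2 * τ)) ξ * φ ξ)) * Complex.I_sq

lemma radialVar_mul_radialAdj_radialAdj (ξ : E4) :
    radialVar ξ * radialAdj (radialAdj φ) ξ
      = radialAdj (radialAdj (fun ξ => radialVar ξ * φ ξ)) ξ + 2 * radialAdj φ ξ := by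
  have h : radialAdj (fun ξ => radialVar ξ * φ ξ)
      = fun ξ => radialVar ξ * radialAdj φ ξ - 1 * φ ξ :=
    funext fun ξ => by rw [radialAdj_radialVar hφ, one_mul]
  rw [h, radialAdj_sub_const_mul hφ.radialAdj.radialVar_mul hφ, radialAdj_radialVar hφ.radialAdj]
  ring

end conjugation

/-- At one time, the two half waves with Fourier transforms `e^{iσs|D|} g` and `e^{-iσs|D|} h` add
up to the field `a`, and the time derivative `b` of the field is the corresponding combination. -/
structure IsWavePair (σ s : ℝ) (a b : E4 → ℂ) (g h : E4 → ℂ) : Prop where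
  field : ∀ᵐ ξ, a ξ = halfPhase (σ * s) ξ * g ξ + halfPhase (-(σ * s)) ξ * h ξ
  deriv : ∀ᵐ ξ, b ξ = Complex.I * σ * radialVar ξ *
    (halfPhase (σ * s) ξ * g ξ - halfPhase (-(σ * s)) ξ * h ξ)

section pair

variable {σ s : ℝ} {a b g h : E4 → ℂ}

/-- Conjugating the field with the phase of one half wave isolates its profile; the other half wave
remains with twice the phase. -/
lemma IsWavePair.integral_field (hw : IsWavePair σ s a b g h) (hg : MemWeight 0 g)
    (hh : MemWeight 0 h) {θ : E4 → ℂ} (hθ : IsTest θ) :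
    ∫ ξ, (halfPhase (-(σ * s)) ξ * θ ξ) * a ξ
      = (∫ ξ, θ ξ * g ξ) + ∫ ξ, (halfPhase (-(2 * (σ * s))) ξ * θ ξ) * h ξ := by
  rw [← integral_add (hg.integrable hθ) (hh.integrable (hθ.halfPhase_mul _))]
  refine integral_congr_ae ?_
  filter_upwards [hw.field] with ξ hξ
  rw [hξ, show -(2 * (σ * s)) = -(σ * s) + -(σ * s) by ring, halfPhase_add]
  linear_combination (θ ξ * g ξ) * halfPhase_neg_mul (σ * s) ξ

/-- The derivative of the conjugated field in time sees only the other half wave. -/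
lemma IsWavePair.integral_deriv (hw : IsWavePair σ s a b g h) (hg : MemWeight 0 g)
    (hh : MemWeight 0 h) {θ : E4 → ℂ} (hθ : IsTest θ) :
    (∫ ξ, (halfPhase (-(σ * s)) ξ * θ ξ) * b ξ)
      - Complex.I * σ * ∫ ξ, (halfPhase (-(σ * s)) ξ * (radialVar ξ * θ ξ)) * a ξ
      = -(2 * Complex.I * σ) *
        ∫ ξ, (halfPhase (-(2 * (σ * s))) ξ * (radialVar ξ * θ ξ)) * h ξ := by
  have hb : ∫ ξ, (halfPhase (-(σ * s)) ξ * θ ξ) * b ξ = Complex.I * σ *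
      ((∫ ξ, (radialVar ξ * θ ξ) * g ξ)
        - ∫ ξ, (halfPhase (-(2 * (σ * s))) ξ * (radialVar ξ * θ ξ)) * h ξ) := by
    rw [← integral_sub (hg.integrable hθ.radialVar_mul)
      (hh.integrable (hθ.radialVar_mul.halfPhase_mul _)), ← integral_const_mul]
    refine integral_congr_ae ?_
    filter_upwards [hw.deriv] with ξ hξ
    rw [hξ, show -(2 * (σ * s)) = -(σ * s) + -(σ * s) by ring, halfPhase_add]
    linear_combination (Complex.I * σ * radialVar ξ * θ ξ * g ξ) * halfPhase_neg_mul (σ * s) ξ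
  rw [hb, hw.integral_field hg hh hθ.radialVar_mul]
  ring

end pair

section pairing

variable {h : E4 → ℂ} {h₁ : Fin 4 → E4 → ℂ} {h₂ : Fin 4 → Fin 4 → E4 → ℂ} {M : ℝ}
  {φ : E4 → ℂ}

lemma integral_halfPhase_radialAdj (hh : ∀ θ, IsTest θ → Integrable (fun ξ => θ ξ * h ξ) volume)
    (hφ : IsTest φ) (τ : ℝ) :
    ∫ ξ, (halfPhase (-(2 * τ)) ξ * radialAdj φ ξ) * h ξ
      = (∫ ξ, radialAdj (fun ξ => halfPhase (-(2 * τ)) ξ * φ ξ) ξ * h ξ)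
        - 2 * Complex.I * τ * ∫ ξ, (halfPhase (-(2 * τ)) ξ * φ ξ) * h ξ := by
  have hψ := hφ.halfPhase_mul (-(2 * τ))
  rw [← integral_const_mul, ← integral_sub (hh _ hψ.radialAdj)
    ((hh _ hψ).const_mul _)]
  refine integral_congr_ae (ae_of_all _ fun ξ => ?_)
  beta_reduce
  rw [halfPhase_mul_radialAdj hφ]
  ring

lemma integral_halfPhase_radialAdj_radialAdj
    (hh : ∀ θ, IsTest θ → Integrable (fun ξ => θ ξ * h ξ) volume)
    (hφ : IsTest φ) (τ : ℝ) :
    ∫ ξ, (halfPhase (-(2 * τ)) ξ * radialAdj (radialAdj φ) ξ) * h ξ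
      = (∫ ξ, radialAdj (radialAdj (fun ξ => halfPhase (-(2 * τ)) ξ * φ ξ)) ξ * h ξ)
        - 4 * Complex.I * τ * (∫ ξ, radialAdj (fun ξ => halfPhase (-(2 * τ)) ξ * φ ξ) ξ * h ξ)
        - 4 * τ ^ 2 * ∫ ξ, (halfPhase (-(2 * τ)) ξ * φ ξ) * h ξ := by
  have hψ := hφ.halfPhase_mul (-(2 * τ))
  have i2 := hh _ hψ.radialAdj.radialAdj
  have i1 := (hh _ hψ.radialAdj).const_mul (4 * Complex.I * τ)
  have i0 := (hh _ hψ).const_mul (4 * (τ : ℂ) ^ 2)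
  have i21 : Integrable (fun ξ =>
      radialAdj (radialAdj (fun ξ => halfPhase (-(2 * τ)) ξ * φ ξ)) ξ * h ξ
        - 4 * Complex.I * τ * (radialAdj (fun ξ => halfPhase (-(2 * τ)) ξ * φ ξ) ξ * h ξ))
      volume := i2.sub i1
  rw [← integral_const_mul, ← integral_const_mul, ← integral_sub i2 i1, ← integral_sub i21 i0]
  refine integral_congr_ae (ae_of_all _ fun ξ => ?_)
  beta_reduce
  rw [halfPhase_mul_radialAdj_radialAdj hφ]
  ring

lemma integral_radialVar_radialAdj_radialAdj (hh : MemWeight 0 h) (hφ : IsTest φ) :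
    ∫ ξ, (radialVar ξ * radialAdj (radialAdj φ) ξ) * h ξ
      = (∫ ξ, radialAdj (radialAdj (fun ξ => radialVar ξ * φ ξ)) ξ * h ξ)
        + 2 * ∫ ξ, radialAdj φ ξ * h ξ := by
  rw [← integral_const_mul, ← integral_add (hh.integrable hφ.radialVar_mul.radialAdj.radialAdj)
    ((hh.integrable hφ.radialAdj).const_mul _)]
  refine integral_congr_ae (ae_of_all _ fun ξ => ?_)
  beta_reduce
  rw [radialVar_mul_radialAdj_radialAdj hφ]
  ring

end pairing

/-- The corrected pairing of the profile of `a` with `φ`, from which the contribution of the other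
half wave has been removed to second order by integration by parts in the radial variable. -/
def corrected (σ : ℝ) (a : ℝ → L2C) (φ : E4 → ℂ) (s : ℝ) : ℂ :=
  (∫ ξ, (halfPhase (-(σ * s)) ξ * φ ξ) * a s ξ)
    + -(Complex.I * σ) * ((s⁻¹ : ℝ) : ℂ) * (∫ ξ, (halfPhase (-(σ * s)) ξ * radialAdj φ ξ) * a s ξ)
    + -(1 / 4) * ((s⁻¹ ^ 2 : ℝ) : ℂ) *
      ∫ ξ, (halfPhase (-(σ * s)) ξ * radialAdj (radialAdj φ) ξ) * a s ξ

section corrected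

variable {σ s : ℝ} {a : ℝ → L2C} {b : L2C} {g h : E4 → ℂ} {φ : E4 → ℂ}

/-- The coefficients of the correction are such that all contributions of `h` cancel, except for the
one in which both radial derivatives have moved to `h`; that one carries a factor `s⁻²`. -/
lemma corrected_eq (hσ : σ ^ 2 = 1) (hs : s ≠ 0) (hw : IsWavePair σ s (a s) b g h)
    (hg : MemWeight 0 g) (hh : MemWeight 0 h) (hφ : IsTest φ) :
    corrected σ a φ s = (∫ ξ, φ ξ * g ξ)
      - Complex.I * σ * ((s⁻¹ : ℝ) : ℂ) * (∫ ξ, radialAdj φ ξ * g ξ)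
      - 1 / 4 * ((s⁻¹ : ℝ) : ℂ) ^ 2 * (∫ ξ, radialAdj (radialAdj φ) ξ * g ξ)
      - 1 / 4 * ((s⁻¹ : ℝ) : ℂ) ^ 2 *
        ∫ ξ, radialAdj (radialAdj (fun ξ => halfPhase (-(2 * (σ * s))) ξ * φ ξ)) ξ * h ξ := by
  unfold corrected
  rw [hw.integral_field hg hh hφ, hw.integral_field hg hh hφ.radialAdj,
    hw.integral_field hg hh hφ.radialAdj.radialAdj,
    integral_halfPhase_radialAdj (fun _ => hh.integrable) hφ,
    integral_halfPhase_radialAdj_radialAdj (fun _ => hh.integrable) hφ]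
  have hI := Complex.I_sq
  have hu : ((s⁻¹ : ℝ) : ℂ) * s = 1 := by
    rw [← Complex.ofReal_mul, inv_mul_cancel₀ hs, Complex.ofReal_one]
  have hσ' : (σ : ℂ) ^ 2 = 1 := by exact_mod_cast hσ
  push_cast at hu ⊢
  generalize (∫ ξ, φ ξ * g ξ) = G₀
  generalize (∫ ξ, radialAdj φ ξ * g ξ) = G₁
  generalize (∫ ξ, radialAdj (radialAdj φ) ξ * g ξ) = G₂
  generalize (∫ ξ, (halfPhase (-(2 * (σ * s))) ξ * φ ξ) * h ξ) = P₀
  generalize (∫ ξ, radialAdj (fun ξ => halfPhase (-(2 * (σ * s))) ξ * φ ξ) ξ * h ξ) = P₁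
  generalize (∫ ξ, radialAdj (radialAdj (fun ξ => halfPhase (-(2 * (σ * s))) ξ * φ ξ)) ξ * h ξ) = P₂
  generalize (s : ℂ)⁻¹ = u at *
  generalize Complex.I = i at *
  generalize (s : ℂ) = s at *
  generalize (σ : ℂ) = σ at *
  grind

/-- In the derivative of the corrected pairing, the same coefficients cancel all terms with fewer
than two radial derivatives on `h`; the remaining terms are of order `s⁻²`. -/
lemma hasDerivWithinAt_corrected {S : Set ℝ} (hσ : σ ^ 2 = 1) (hs : s ≠ 0)
    (ha : HasDerivWithinAt a b S s) (hw : IsWavePair σ s (a s) b g h)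
    (hg : MemWeight 0 g) (hh : MemWeight 0 h) (hφ : IsTest φ) :
    HasDerivWithinAt (corrected σ a φ)
      (Complex.I * σ / 2 * ((s⁻¹ : ℝ) : ℂ) ^ 2 * (∫ ξ, radialAdj (radialAdj
        (fun ξ => radialVar ξ * (halfPhase (-(2 * (σ * s))) ξ * φ ξ))) ξ * h ξ)
      + Complex.I * σ * ((s⁻¹ : ℝ) : ℂ) ^ 2 * (∫ ξ, radialAdj φ ξ * g ξ)
      + 1 / 2 * ((s⁻¹ : ℝ) : ℂ) ^ 3 * (∫ ξ, radialAdj (radialAdj φ) ξ * g ξ)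
      + 1 / 2 * ((s⁻¹ : ℝ) : ℂ) ^ 3 *
        ∫ ξ, radialAdj (radialAdj (fun ξ => halfPhase (-(2 * (σ * s))) ξ * φ ξ)) ξ * h ξ) S s := by
  have d0 := hasDerivWithinAt_integral_phase hφ (σ := σ) ha
  have d1 := hasDerivWithinAt_integral_phase hφ.radialAdj (σ := σ) ha
  have d2 := hasDerivWithinAt_integral_phase hφ.radialAdj.radialAdj (σ := σ) ha
  rw [hw.integral_deriv hg hh] at d0 d1 d2
  rotate_left
  · exact hφ.radialAdj.radialAdj
  · exact hφ.radialAdj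
  · exact hφ
  have c1 : HasDerivWithinAt (fun s : ℝ => ((s⁻¹ : ℝ) : ℂ)) ((-(s ^ 2)⁻¹ : ℝ) : ℂ) S s :=
    ((hasDerivAt_inv hs).ofReal_comp).hasDerivWithinAt
  have c2 : HasDerivWithinAt (fun s : ℝ => ((s⁻¹ ^ 2 : ℝ) : ℂ))
      ((2 * s⁻¹ * -(s ^ 2)⁻¹ : ℝ) : ℂ) S s := by
    have := ((hasDerivAt_inv hs).pow 2).ofReal_comp
    simpa using this.hasDerivWithinAt
  have hd := (d0.add ((c1.const_mul (-(Complex.I * σ))).mul d1)).add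
    ((c2.const_mul (-(1 / 4))).mul d2)
  refine HasDerivWithinAt.congr_deriv (f := corrected σ a φ) hd ?_
  have hρ : ∀ θ, IsTest θ → Integrable (fun ξ => θ ξ * (radialVar ξ * h ξ)) volume :=
    fun θ hθ => (hh.integrable hθ.radialVar_mul).congr (ae_of_all _ fun ξ => by ring)
  have hrv : ∀ θ : E4 → ℂ, ∫ ξ, (halfPhase (-(2 * (σ * s))) ξ * (radialVar ξ * θ ξ)) * h ξ
      = ∫ ξ, (halfPhase (-(2 * (σ * s))) ξ * θ ξ) * (radialVar ξ * h ξ) := fun θ =>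
    integral_congr_ae (ae_of_all _ fun ξ => by ring)
  have hrz : ∫ ξ, radialAdj (radialAdj (fun ξ => halfPhase (-(2 * (σ * s))) ξ * φ ξ)) ξ
      * (radialVar ξ * h ξ) = (∫ ξ, radialAdj (radialAdj
        (fun ξ => radialVar ξ * (halfPhase (-(2 * (σ * s))) ξ * φ ξ))) ξ * h ξ)
        + 2 * ∫ ξ, radialAdj (fun ξ => halfPhase (-(2 * (σ * s))) ξ * φ ξ) ξ * h ξ := by
    rw [← integral_radialVar_radialAdj_radialAdj hh (hφ.halfPhase_mul _)]
    exact integral_congr_ae (ae_of_all _ fun ξ => by ring)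
  rw [hrv, hrv, hrv, hw.integral_field hg hh hφ.radialAdj,
    hw.integral_field hg hh hφ.radialAdj.radialAdj,
    integral_halfPhase_radialAdj (fun _ => hh.integrable) hφ,
    integral_halfPhase_radialAdj_radialAdj (fun _ => hh.integrable) hφ,
    integral_halfPhase_radialAdj hρ hφ, integral_halfPhase_radialAdj_radialAdj hρ hφ, hrz]
  have hI := Complex.I_sq
  have hu : ((s⁻¹ : ℝ) : ℂ) * s = 1 := by
    rw [← Complex.ofReal_mul, inv_mul_cancel₀ hs, Complex.ofReal_one]
  have hσ' : (σ : ℂ) ^ 2 = 1 := by exact_mod_cast hσ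
  push_cast at hu ⊢
  rw [← inv_pow]
  generalize (∫ ξ, radialAdj φ ξ * g ξ) = G₁
  generalize (∫ ξ, radialAdj (radialAdj φ) ξ * g ξ) = G₂
  generalize (∫ ξ, (halfPhase (-(2 * (σ * s))) ξ * φ ξ) * h ξ) = P₀
  generalize (∫ ξ, radialAdj (fun ξ => halfPhase (-(2 * (σ * s))) ξ * φ ξ) ξ * h ξ) = P₁
  generalize (∫ ξ, radialAdj (radialAdj (fun ξ => halfPhase (-(2 * (σ * s))) ξ * φ ξ)) ξ * h ξ) = P₂
  generalize (∫ ξ, radialAdj (radialAdj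
    (fun ξ => radialVar ξ * (halfPhase (-(2 * (σ * s))) ξ * φ ξ))) ξ * h ξ) = P₃
  generalize (∫ ξ, (halfPhase (-(2 * (σ * s))) ξ * φ ξ) * (radialVar ξ * h ξ)) = R₀
  generalize (∫ ξ, radialAdj (fun ξ => halfPhase (-(2 * (σ * s))) ξ * φ ξ) ξ
    * (radialVar ξ * h ξ)) = R₁
  generalize (s : ℂ)⁻¹ = u at *
  generalize Complex.I = i at *
  generalize (s : ℂ) = s at *
  generalize (σ : ℂ) = σ at *
  grind

end corrected

lemma negNorm_halfPhase {φ : E4 → ℂ} (k : ℕ) (τ : ℝ) :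
    negNorm k (fun ξ => halfPhase τ ξ * φ ξ) = negNorm k φ := by
  unfold negNorm
  congr 1
  refine eLpNorm_congr_norm_ae (ae_of_all _ fun ξ => ?_)
  rw [norm_mul, norm_mul, norm_mul, norm_halfPhase, one_mul]

section increment

variable {σ t₁ t₂ M : ℝ} {a b : ℝ → L2C} {g h : ℝ → E4 → ℂ} {g₁ h₁ : ℝ → Fin 4 → E4 → ℂ}
  {g₂ h₂ : ℝ → Fin 4 → Fin 4 → E4 → ℂ} {φ : E4 → ℂ}

/-- The correction itself is of order `s⁻¹`, at one weight `|ξ|⁻¹` for each power of `s⁻¹`. -/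
lemma norm_corrected_sub_le {s : ℝ} (hσ : σ ^ 2 = 1) (hs : 0 < s) (hM : 0 ≤ M)
    (hw : IsWavePair σ s (a s) (b s) (g s) (h s)) (hg : HasJet (g s) (g₁ s) (g₂ s) M)
    (hh : HasJet (h s) (h₁ s) (h₂ s) M) (hφ : IsTest φ) :
    ‖(∫ ξ, φ ξ * g s ξ) - corrected σ a φ s‖
      ≤ M * (negNorm 1 φ * s⁻¹ + negNorm 2 φ * s⁻¹ ^ 2) := by
  rw [corrected_eq hσ hs.ne' hw hg.mem hh.mem hφ]
  have hψ := hφ.halfPhase_mul (-(2 * (σ * s)))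
  have b1 := hg.norm_integral_radialAdj_le hM hφ
  have b2 := hg.norm_integral_radialAdj_radialAdj_le hM hφ
  have b3 := hh.norm_integral_radialAdj_radialAdj_le hM hψ
  rw [negNorm_halfPhase] at b3
  have hσn : ‖(σ : ℂ)‖ = 1 := by
    rw [Complex.norm_real, Real.norm_eq_abs]
    exact (pow_eq_one_iff_of_nonneg (abs_nonneg σ) two_ne_zero).mp (by rwa [sq_abs])
  have hu : ‖((s⁻¹ : ℝ) : ℂ)‖ = s⁻¹ := by
    rw [Complex.norm_real, Real.norm_of_nonneg (by positivity)]
  generalize (∫ ξ, φ ξ * g s ξ) = G₀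
  generalize (∫ ξ, radialAdj φ ξ * g s ξ) = G₁ at *
  generalize (∫ ξ, radialAdj (radialAdj φ) ξ * g s ξ) = G₂ at *
  generalize (∫ ξ, radialAdj (radialAdj
    (fun ξ => halfPhase (-(2 * (σ * s))) ξ * φ ξ)) ξ * h s ξ) = P₂ at *
  have hN := negNorm_nonneg 2 φ
  calc _ = ‖Complex.I * σ * ((s⁻¹ : ℝ) : ℂ) * G₁ + 1 / 4 * ((s⁻¹ : ℝ) : ℂ) ^ 2 * G₂
        + 1 / 4 * ((s⁻¹ : ℝ) : ℂ) ^ 2 * P₂‖ := by congr 1; ring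
    _ ≤ s⁻¹ * ‖G₁‖ + 1 / 4 * s⁻¹ ^ 2 * ‖G₂‖ + 1 / 4 * s⁻¹ ^ 2 * ‖P₂‖ := by
        refine (norm_add₃_le).trans (le_of_eq ?_)
        simp only [norm_mul, norm_pow, hu, hσn, Complex.norm_I, one_mul]
        norm_num
    _ ≤ s⁻¹ * (M * negNorm 1 φ) + 1 / 4 * s⁻¹ ^ 2 * (M * negNorm 2 φ)
        + 1 / 4 * s⁻¹ ^ 2 * (M * negNorm 2 φ) := by gcongr
    _ ≤ _ := by
        have : 0 ≤ s⁻¹ ^ 2 * (M * negNorm 2 φ) := by positivity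
        nlinarith

/-- The time increments of the Fourier transform of a profile decay, measured against test
functions. Only the splitting of the field and of its time derivative into two half waves enters,
through the derivative of the corrected pairing: the profile itself need not be differentiable in
time. -/
lemma norm_integral_increment_le (hσ : σ ^ 2 = 1) (ht₁ : 0 < t₁) (ht : t₁ ≤ t₂) (ht₂ : t₂ ≤ 2 * t₁)
    (hM : 0 ≤ M) (ha : ∀ s ∈ Set.Icc t₁ t₂, HasDerivWithinAt a (b s) (Set.Icc t₁ t₂) s)
    (hw : ∀ s ∈ Set.Icc t₁ t₂, IsWavePair σ s (a s) (b s) (g s) (h s))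
    (hg : ∀ s ∈ Set.Icc t₁ t₂, HasJet (g s) (g₁ s) (g₂ s) M)
    (hh : ∀ s ∈ Set.Icc t₁ t₂, HasJet (h s) (h₁ s) (h₂ s) M) (hφ : IsTest φ) :
    ‖(∫ ξ, φ ξ * g t₂ ξ) - ∫ ξ, φ ξ * g t₁ ξ‖
      ≤ 7 * M * (negNorm 1 φ * t₁⁻¹ + negNorm 2 φ * t₁⁻¹ ^ 2) := by
  have hN1 := negNorm_nonneg 1 φ
  have hN2 := negNorm_nonneg 2 φ
  have hder := fun s (hs : s ∈ Set.Icc t₁ t₂) =>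
    hasDerivWithinAt_corrected hσ (ht₁.trans_le hs.1).ne' (ha s hs) (hw s hs) (hg s hs).mem
      (hh s hs).mem hφ
  have hσn : ‖(σ : ℂ)‖ = 1 := by
    rw [Complex.norm_real, Real.norm_eq_abs]
    exact (pow_eq_one_iff_of_nonneg (abs_nonneg σ) two_ne_zero).mp (by rwa [sq_abs])
  have hbound : ∀ s ∈ Set.Ico t₁ t₂,
      ‖Complex.I * σ / 2 * ((s⁻¹ : ℝ) : ℂ) ^ 2 * (∫ ξ, radialAdj (radialAdj
          (fun ξ => radialVar ξ * (halfPhase (-(2 * (σ * s))) ξ * φ ξ))) ξ * h s ξ)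
      + Complex.I * σ * ((s⁻¹ : ℝ) : ℂ) ^ 2 * (∫ ξ, radialAdj φ ξ * g s ξ)
      + 1 / 2 * ((s⁻¹ : ℝ) : ℂ) ^ 3 * (∫ ξ, radialAdj (radialAdj φ) ξ * g s ξ)
      + 1 / 2 * ((s⁻¹ : ℝ) : ℂ) ^ 3 *
        ∫ ξ, radialAdj (radialAdj (fun ξ => halfPhase (-(2 * (σ * s))) ξ * φ ξ)) ξ * h s ξ‖ ≤
      M * (5 * (negNorm 1 φ * t₁⁻¹ ^ 2) + negNorm 2 φ * t₁⁻¹ ^ 3) := fun s hs => by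
    have hs' := Set.Ico_subset_Icc_self hs
    have hs0 : 0 < s := ht₁.trans_le hs.1
    have hinv : s⁻¹ ≤ t₁⁻¹ := inv_anti₀ ht₁ hs.1
    have hψ := hφ.halfPhase_mul (-(2 * (σ * s)))
    have b1 := (hg s hs').norm_integral_radialAdj_le hM hφ
    have b2 := (hg s hs').norm_integral_radialAdj_radialAdj_le hM hφ
    have b3 := (hh s hs').norm_integral_radialAdj_radialAdj_le hM hψ
    have b4 := (hh s hs').norm_integral_radialAdj_radialAdj_le hM hψ.radialVar_mul
    rw [negNorm_halfPhase] at b3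
    rw [negNorm_radialVar hψ, negNorm_halfPhase] at b4
    have hu : ‖((s⁻¹ : ℝ) : ℂ)‖ = s⁻¹ := by
      rw [Complex.norm_real, Real.norm_of_nonneg (by positivity)]
    generalize (∫ ξ, radialAdj φ ξ * g s ξ) = G₁ at *
    generalize (∫ ξ, radialAdj (radialAdj φ) ξ * g s ξ) = G₂ at *
    generalize (∫ ξ, radialAdj (radialAdj
      (fun ξ => halfPhase (-(2 * (σ * s))) ξ * φ ξ)) ξ * h s ξ) = P₂ at *
    generalize (∫ ξ, radialAdj (radialAdj
      (fun ξ => radialVar ξ * (halfPhase (-(2 * (σ * s))) ξ * φ ξ))) ξ * h s ξ) = P₃ at *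
    calc _ ≤ 1 / 2 * s⁻¹ ^ 2 * ‖P₃‖ + s⁻¹ ^ 2 * ‖G₁‖ + 1 / 2 * s⁻¹ ^ 3 * ‖G₂‖
          + 1 / 2 * s⁻¹ ^ 3 * ‖P₂‖ := by
          refine (norm_add_le _ _).trans ((add_le_add norm_add₃_le le_rfl).trans (le_of_eq ?_))
          simp only [norm_mul, norm_div, norm_pow, hu, hσn, Complex.norm_I, one_mul, norm_one,
            Complex.norm_ofNat]
      _ ≤ 1 / 2 * t₁⁻¹ ^ 2 * (M * (2 * π * negNorm 1 φ)) + t₁⁻¹ ^ 2 * (M * negNorm 1 φ)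
          + 1 / 2 * t₁⁻¹ ^ 3 * (M * negNorm 2 φ) + 1 / 2 * t₁⁻¹ ^ 3 * (M * negNorm 2 φ) := by
          gcongr
      _ ≤ _ := by
          have : 0 ≤ (4 - π) * (t₁⁻¹ ^ 2 * (M * negNorm 1 φ)) :=
            mul_nonneg (by linarith [pi_lt_four]) (by positivity)
          nlinarith
  -- The derivative is `O(s⁻²)` on an interval of length at most `t₁`.
  have hmv := norm_image_sub_le_of_norm_deriv_le_segment' hder hbound t₂ ⟨ht, le_rfl⟩
  have e1 := norm_corrected_sub_le hσ ht₁ hM (hw t₁ ⟨le_rfl, ht⟩) (hg t₁ ⟨le_rfl, ht⟩)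
    (hh t₁ ⟨le_rfl, ht⟩) hφ
  have e2 := norm_corrected_sub_le hσ (ht₁.trans_le ht) hM (hw t₂ ⟨ht, le_rfl⟩)
    (hg t₂ ⟨ht, le_rfl⟩) (hh t₂ ⟨ht, le_rfl⟩) hφ
  have hinv : t₂⁻¹ ≤ t₁⁻¹ := inv_anti₀ ht₁ ht
  have ht₂0 : 0 < t₂ := ht₁.trans_le ht
  have e2' : M * (negNorm 1 φ * t₂⁻¹ + negNorm 2 φ * t₂⁻¹ ^ 2)
      ≤ M * (negNorm 1 φ * t₁⁻¹ + negNorm 2 φ * t₁⁻¹ ^ 2) := by gcongr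
  have hmv' : M * (5 * (negNorm 1 φ * t₁⁻¹ ^ 2) + negNorm 2 φ * t₁⁻¹ ^ 3) * (t₂ - t₁)
      ≤ M * (5 * (negNorm 1 φ * t₁⁻¹) + negNorm 2 φ * t₁⁻¹ ^ 2) := by
    calc _ ≤ M * (5 * (negNorm 1 φ * t₁⁻¹ ^ 2) + negNorm 2 φ * t₁⁻¹ ^ 3) * t₁ := by
          gcongr; linarith
      _ = _ := by field_simp
  have htri : ‖(∫ ξ, φ ξ * g t₂ ξ) - ∫ ξ, φ ξ * g t₁ ξ‖
      ≤ ‖(∫ ξ, φ ξ * g t₂ ξ) - corrected σ a φ t₂‖ + ‖corrected σ a φ t₂ - corrected σ a φ t₁‖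
        + ‖(∫ ξ, φ ξ * g t₁ ξ) - corrected σ a φ t₁‖ := by
    rw [norm_sub_rev (∫ ξ, φ ξ * g t₁ ξ)]
    refine le_trans (le_of_eq ?_) norm_add₃_le
    congr 1
    ring
  have p2 : 0 ≤ M * (negNorm 2 φ * t₁⁻¹ ^ 2) := by positivity
  nlinarith

end increment

/-! ### Time increments of the profiles in `L²` -/

/-- An `L²` function is controlled by its pairings with smooth square integrable functions. -/
lemma eLpNorm_le_of_forall_pairing {u : E4 → ℂ} (hu : MemLp u 2 volume) {k : ℝ}
    (hk0 : 0 ≤ k) (h : ∀ θ : E4 → ℂ, ContDiff ℝ ∞ θ → MemLp θ 2 volume →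
      ‖∫ ξ, θ ξ * u ξ‖ ≤ k * (eLpNorm θ 2 volume).toReal) :
    eLpNorm u 2 volume ≤ ENNReal.ofReal k := by
  set U : L2C := hu.toLp u with hU
  have hS : ∀ V : L2C, ‖inner ℂ V U‖ ≤ k * ‖V‖ := by
    have hd := SchwartzMap.denseRange_toLpCLM (E := E4) (F := ℂ) (p := 2) (μ := volume)
      (by norm_num)
    refine fun V => hd.induction_on (p := fun V : L2C => ‖inner ℂ V U‖ ≤ k * ‖V‖) V
      (isClosed_le (by fun_prop) (by fun_prop)) fun f => ?_
    have hf : ContDiff ℝ ∞ fun ξ => (starRingEnd ℂ) (f ξ) :=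
      Complex.conjCLE.contDiff.comp (f.smooth ⊤)
    have hcn : ∀ ξ, ‖(starRingEnd ℂ) (f ξ)‖ = ‖f ξ‖ := fun ξ => RCLike.norm_conj _
    have hfm : MemLp (fun ξ => (starRingEnd ℂ) (f ξ)) 2 volume :=
      (memLp_congr_norm hf.continuous.aestronglyMeasurable f.continuous.aestronglyMeasurable
        (ae_of_all _ hcn)).mpr (f.memLp 2 volume)
    have h1 := h _ hf hfm
    have h2 : inner ℂ (SchwartzMap.toLpCLM ℝ ℂ 2 volume f) U
        = ∫ ξ, (starRingEnd ℂ) (f ξ) * u ξ := by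
      rw [MeasureTheory.L2.inner_def]
      refine integral_congr_ae ?_
      filter_upwards [f.coeFn_toLp 2 volume, hu.coeFn_toLp] with ξ e1 e2
      rw [hU, e2, SchwartzMap.toLpCLM_apply, e1, RCLike.inner_apply, mul_comm]
    have h3 : ‖SchwartzMap.toLpCLM ℝ ℂ 2 volume f‖
        = (eLpNorm (fun ξ => (starRingEnd ℂ) (f ξ)) 2 volume).toReal := by
      rw [SchwartzMap.toLpCLM_apply, SchwartzMap.norm_toLp]
      congr 1
      exact eLpNorm_congr_norm_ae (ae_of_all _ fun ξ => (hcn ξ).symm)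
    rw [h2, h3]
    exact h1
  have h1 := hS U
  rw [inner_self_eq_norm_sq_to_K, norm_pow] at h1
  simp only [RCLike.norm_ofReal, abs_norm] at h1
  have hk : ‖U‖ ≤ k := by
    rcases (norm_nonneg U).eq_or_lt with h0 | h0
    · rwa [← h0]
    · nlinarith
  rw [hU, Lp.norm_toLp] at hk
  exact (ENNReal.le_ofReal_iff_toReal_le hu.2.ne (ENNReal.toReal_nonneg.trans hk)).mpr hk

lemma HasJet.mono {f : E4 → ℂ} {f₁ : Fin 4 → E4 → ℂ} {f₂ : Fin 4 → Fin 4 → E4 → ℂ} {M M' : ℝ}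
    (h : HasJet f f₁ f₂ M) (hM : M ≤ M') : HasJet f f₁ f₂ M' :=
  ⟨h.mem, h.mem₁, h.mem₂, h.deriv₁, h.deriv₂, h.norm.trans (ENNReal.ofReal_le_ofReal hM),
    fun j => (h.norm₁ j).trans (ENNReal.ofReal_le_ofReal hM),
    fun i j => (h.norm₂ i j).trans (ENNReal.ofReal_le_ofReal hM)⟩

/-- The Fourier transforms `g`, `h` of the profiles of a pair of half waves on `[0, T]`, together
with the bounds that grow at most like `⟨s⟩^{1/8}`. -/
structure WaveData (n T L σ : ℝ) (a b : ℝ → L2C) (g h : ℝ → E4 → ℂ)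
    (g₁ h₁ : ℝ → Fin 4 → E4 → ℂ) (g₂ h₂ : ℝ → Fin 4 → Fin 4 → E4 → ℂ) : Prop where
  jet : ∀ s ∈ Set.Icc 0 T, HasJet (g s) (g₁ s) (g₂ s) (L * bracket s ^ (1 / 8 : ℝ))
  jet' : ∀ s ∈ Set.Icc 0 T, HasJet (h s) (h₁ s) (h₂ s) (L * bracket s ^ (1 / 8 : ℝ))
  high : ∀ s ∈ Set.Icc 0 T, eLpNorm (fun ξ => (bracketSymbol n ξ : ℂ) * g s ξ) 2 volume
    ≤ ENNReal.ofReal (L * bracket s ^ (1 / 8 : ℝ))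
  deriv : ∀ s ∈ Set.Icc 0 T, HasDerivWithinAt a (b s) (Set.Icc 0 T) s
  pair : ∀ s ∈ Set.Icc 0 T, IsWavePair σ s (a s) (b s) (g s) (h s)

lemma bracket_pos (t : ℝ) : 0 < bracket t := Real.sqrt_pos.mpr (by positivity)

lemma bracket_rpow_le {s τ : ℝ} (hs : 1 ≤ s) (hτ0 : 0 ≤ τ) (hτ : τ ≤ 2 * s) :
    bracket τ ^ (1 / 8 : ℝ) ≤ 2 * s ^ (1 / 8 : ℝ) := by
  have h1 : bracket τ ≤ 3 * s := by
    unfold bracket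
    rw [Real.sqrt_le_left (by linarith)]
    nlinarith
  have h3 : (3 : ℝ) ^ (1 / 8 : ℝ) ≤ 2 := by
    calc (3 : ℝ) ^ (1 / 8 : ℝ) ≤ (2 ^ (8 : ℝ)) ^ (1 / 8 : ℝ) := by
          gcongr; norm_num
      _ = 2 := by rw [← rpow_mul (by norm_num)]; norm_num
  calc bracket τ ^ (1 / 8 : ℝ) ≤ (3 * s) ^ (1 / 8 : ℝ) := by
        gcongr; exact (bracket_pos τ).le
    _ = 3 ^ (1 / 8 : ℝ) * s ^ (1 / 8 : ℝ) := mul_rpow (by norm_num) (by linarith)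
    _ ≤ _ := by gcongr

/-- The increment estimate on dyadic time intervals, in `L²` with weight `|ξ|`, by duality. The
symbol `m` vanishes for `|ξ| < 2/s`, so that the second-order term `(s|ξ|)⁻²` is absorbed by
`(s|ξ|)⁻¹`. -/
lemma WaveData.eLpNorm_increment_le {n T L σ : ℝ} {a b : ℝ → L2C} {g h : ℝ → E4 → ℂ}
    {g₁ h₁ : ℝ → Fin 4 → E4 → ℂ} {g₂ h₂ : ℝ → Fin 4 → Fin 4 → E4 → ℂ} (hσ : σ ^ 2 = 1)
    (hL : 0 ≤ L) (hd : WaveData n T L σ a b g h g₁ h₁ g₂ h₂) {s : ℝ} (hs : 1 ≤ s)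
    (hsT : 2 * s ≤ T) {m : E4 → ℂ} (hm : IsTest m) {B : ℝ} (hB : ∀ ξ, ‖m ξ‖ ≤ B)
    (hms : ∀ ξ, ‖ξ‖ < 2 / s → m ξ = 0) :
    eLpNorm (fun ξ => (‖ξ‖ : ℂ) * (m ξ * (g (2 * s) ξ - g s ξ))) 2 volume
      ≤ ENNReal.ofReal (28 * L * B * s ^ (1 / 8 : ℝ) * s⁻¹) := by
  have hs0 : 0 < s := by linarith
  have hB0 : 0 ≤ B := (norm_nonneg _).trans (hB 0)
  set M : ℝ := L * (2 * s ^ (1 / 8 : ℝ)) with hM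
  have hM0 : 0 ≤ M := by positivity
  have hsub : Set.Icc s (2 * s) ⊆ Set.Icc 0 T := Set.Icc_subset_Icc hs0.le hsT
  have hle : ∀ τ ∈ Set.Icc s (2 * s), L * bracket τ ^ (1 / 8 : ℝ) ≤ M := fun τ hτ =>
    mul_le_mul_of_nonneg_left (bracket_rpow_le hs (hs0.le.trans hτ.1) hτ.2) hL
  have hmem : s ∈ Set.Icc s (2 * s) := ⟨le_rfl, by linarith⟩
  have hmem' : 2 * s ∈ Set.Icc s (2 * s) := ⟨by linarith, le_rfl⟩
  have hg1 := (hd.jet s (hsub hmem)).mem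
  have hg2 := (hd.jet (2 * s) (hsub hmem')).mem
  have hrm : IsTest (fun ξ => ((‖ξ‖ ^ (1 : ℤ) : ℝ) : ℂ) * m ξ) :=
    hm.mul_left (contDiffOn_norm_zpow 1)
  have hu : MemLp (fun ξ => (‖ξ‖ : ℂ) * (m ξ * (g (2 * s) ξ - g s ξ))) 2 volume := by
    refine ((hg2.memLp_mul hrm).sub (hg1.memLp_mul hrm)).ae_eq (ae_of_all _ fun ξ => ?_)
    simp only [Pi.sub_apply, zpow_one]
    ring
  refine eLpNorm_le_of_forall_pairing hu (by positivity) fun θ hθ hθ2 => ?_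
  have hφ : IsTest (fun ξ => θ ξ * (((‖ξ‖ ^ (1 : ℤ) : ℝ) : ℂ) * m ξ)) :=
    hrm.mul_left hθ.contDiffOn
  have hinc := norm_integral_increment_le hσ hs0 (by linarith) le_rfl hM0
    (fun τ hτ => (hd.deriv τ (hsub hτ)).mono hsub) (fun τ hτ => hd.pair τ (hsub hτ))
    (fun τ hτ => (hd.jet τ (hsub hτ)).mono (hle τ hτ))
    (fun τ hτ => (hd.jet' τ (hsub hτ)).mono (hle τ hτ)) hφ
  have heq : ∫ ξ, θ ξ * ((‖ξ‖ : ℂ) * (m ξ * (g (2 * s) ξ - g s ξ)))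
      = (∫ ξ, (θ ξ * (((‖ξ‖ ^ (1 : ℤ) : ℝ) : ℂ) * m ξ)) * g (2 * s) ξ)
        - ∫ ξ, (θ ξ * (((‖ξ‖ ^ (1 : ℤ) : ℝ) : ℂ) * m ξ)) * g s ξ := by
    rw [← integral_sub (hg2.integrable hφ) (hg1.integrable hφ)]
    refine integral_congr_ae (ae_of_all _ fun ξ => ?_)
    simp only [zpow_one]
    ring
  rw [heq]
  refine hinc.trans ?_
  set N : ℝ := (eLpNorm θ 2 volume).toReal with hN
  have hN0 : 0 ≤ N := ENNReal.toReal_nonneg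
  have hneg : ∀ (k : ℕ) (c : ℝ), 0 ≤ c →
      (∀ ξ, ‖(((‖ξ‖ ^ (-k : ℤ) : ℝ) : ℂ) * (θ ξ * (((‖ξ‖ ^ (1 : ℤ) : ℝ) : ℂ) * m ξ)))‖
        ≤ c * ‖θ ξ‖) →
      negNorm k (fun ξ => θ ξ * (((‖ξ‖ ^ (1 : ℤ) : ℝ) : ℂ) * m ξ)) ≤ c * N := by
    intro k c hc hk
    have h1 := eLpNorm_le_mul_eLpNorm_of_ae_le_mul (p := 2) (ae_of_all volume hk)
    have h2 := ENNReal.toReal_mono (ENNReal.mul_ne_top ENNReal.ofReal_ne_top hθ2.2.ne) h1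
    rwa [ENNReal.toReal_mul, ENNReal.toReal_ofReal hc] at h2
  have n1 := hneg 1 B hB0 fun ξ => by
    by_cases h0 : ξ = 0
    · rw [h0, hm.eq_zero_of_eq_zero]; simp; positivity
    · have hr : ‖ξ‖ ≠ 0 := norm_ne_zero_iff.mpr h0
      rw [norm_mul, norm_mul, norm_mul, Complex.norm_real, Complex.norm_real, norm_zpow, norm_zpow,
        norm_norm, zpow_neg, zpow_natCast, zpow_one, pow_one]
      calc _ = ‖m ξ‖ * ‖θ ξ‖ := by field_simp
        _ ≤ _ := by gcongr; exact hB ξ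
  have n2 := hneg 2 (B * s) (by positivity) fun ξ => by
    by_cases h0 : ‖ξ‖ < 2 / s
    · rw [hms ξ h0]; simp; positivity
    · have hr' : 2 / s ≤ ‖ξ‖ := not_lt.mp h0
      have hr : 0 < ‖ξ‖ := lt_of_lt_of_le (by positivity) hr'
      rw [norm_mul, norm_mul, norm_mul, Complex.norm_real, Complex.norm_real, norm_zpow, norm_zpow,
        norm_norm, zpow_neg, zpow_natCast, zpow_one]
      have hinv : ‖ξ‖⁻¹ ≤ s := by
        rw [inv_le_comm₀ hr hs0]
        refine le_trans ?_ hr'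
        rw [inv_eq_one_div]
        gcongr
        norm_num
      calc _ = ‖m ξ‖ * ‖ξ‖⁻¹ * ‖θ ξ‖ := by field_simp
        _ ≤ _ := by gcongr; exact hB ξ
  calc _ ≤ 7 * M * (B * N * s⁻¹ + B * s * N * s⁻¹ ^ 2) := by gcongr
    _ = _ := by rw [hM]; field_simp; ring

/-! ### The dyadic step in time -/

lemma one_le_bracketSymbol_base (ξ : E4) : 1 ≤ 1 + ‖(2 * π) • ξ‖ ^ 2 := by
  linarith [sq_nonneg ‖(2 * π) • ξ‖]

lemma bracketSymbol_mono {σ σ' : ℝ} (h : σ ≤ σ') (ξ : E4) :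
    bracketSymbol σ ξ ≤ bracketSymbol σ' ξ :=
  rpow_le_rpow_of_exponent_le (one_le_bracketSymbol_base ξ) (by linarith)

lemma bracketSymbol_add (σ σ' : ℝ) (ξ : E4) :
    bracketSymbol (σ + σ') ξ = bracketSymbol σ ξ * bracketSymbol σ' ξ := by
  unfold bracketSymbol
  rw [← rpow_add (bracketSymbol_base_pos ξ)]
  ring_nf

lemma norm_le_bracketSymbol_one (ξ : E4) : ‖ξ‖ ≤ bracketSymbol 1 ξ := by
  unfold bracketSymbol
  rw [← Real.sqrt_eq_rpow]
  refine Real.le_sqrt_of_sq_le ?_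
  rw [norm_smul, mul_pow ‖2 * π‖, Real.norm_eq_abs, sq_abs]
  have h : 1 ≤ (2 * π) ^ 2 := by nlinarith [pi_gt_three]
  nlinarith [mul_le_mul_of_nonneg_right h (sq_nonneg ‖ξ‖)]

lemma bracketSymbol_neg_le {k R : ℝ} (hk : 0 ≤ k) (hR : 0 < R) {ξ : E4} (hξ : R ≤ ‖ξ‖) :
    bracketSymbol (-k) ξ ≤ R ^ (-k) := by
  have h : bracketSymbol (-k) ξ = bracketSymbol 1 ξ ^ (-k) := by
    unfold bracketSymbol
    rw [← rpow_mul (bracketSymbol_base_pos ξ).le]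
    ring_nf
  rw [h]
  exact rpow_le_rpow_of_nonpos hR (hξ.trans (norm_le_bracketSymbol_one ξ)) (by linarith)

/-- The upper frequency bound `s^{1/200}` used at time `s`. The symbols of order at most `20` are
then bounded by `s^{1/10}`, which together with the growth `s^{1/8}` of the profile norms stays
below the gain `s^{1/4}` in a dyadic step. -/
def freqBound (s : ℝ) : ℝ := s ^ (1 / 200 : ℝ)

lemma one_le_freqBound {s : ℝ} (hs : 1 ≤ s) : 1 ≤ freqBound s := one_le_rpow hs (by norm_num)

/-- The symbol `⟨2πξ⟩^σ` truncated to the frequencies that matter at time `s`. -/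
def timeSymbol (c : E4 → ℂ) (σ s : ℝ) : E4 → ℂ := truncSymbol c σ s (freqBound s)

lemma IsCutoff.eq_zero {c : E4 → ℂ} (hc : IsCutoff c) {ξ : E4} (hξ : 3 < ‖ξ‖) : c ξ = 0 := by
  by_contra h
  exact absurd (hc.supp ξ h) (not_le.mpr hξ)

lemma norm_timeSymbol_le {c : E4 → ℂ} (hc : IsCutoff c) (σ s : ℝ) (ξ : E4) :
    ‖timeSymbol c σ s ξ‖ ≤ 2 * bracketSymbol σ ξ := by
  have h1 := hc.norm_le ((freqBound s)⁻¹ • ξ)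
  have h2 : ‖1 - c (s • ξ)‖ ≤ 2 := (norm_sub_le _ _).trans (by
    rw [norm_one]; linarith [hc.norm_le (s • ξ)])
  unfold timeSymbol truncSymbol
  rw [norm_mul, norm_mul, Complex.norm_real, Real.norm_of_nonneg (bracketSymbol_pos σ ξ).le]
  calc _ ≤ bracketSymbol σ ξ * (1 * 2) := by
        have := (bracketSymbol_pos σ ξ).le
        gcongr
    _ = _ := by ring

lemma timeSymbol_eq {c : E4 → ℂ} (hc : IsCutoff c) (σ : ℝ) {s : ℝ} (hs : 0 < s) {ξ : E4}
    (h1 : ‖ξ‖ < 2 * freqBound s) (h2 : 3 / s < ‖ξ‖) :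
    timeSymbol c σ s ξ = bracketSymbol σ ξ := by
  have hR : 0 < freqBound s := rpow_pos_of_pos hs _
  have e1 : c ((freqBound s)⁻¹ • ξ) = 1 := hc.one _ (by
    rw [norm_smul, norm_inv, Real.norm_of_nonneg hR.le, inv_mul_lt_iff₀ hR]
    linarith)
  have e2 : c (s • ξ) = 0 := hc.eq_zero (by
    rw [norm_smul, Real.norm_of_nonneg hs.le]
    rwa [div_lt_iff₀ hs, mul_comm] at h2)
  simp [timeSymbol, truncSymbol, e1, e2]

lemma freqBound_rpow_le {s k : ℝ} (hs : 1 ≤ s) {j : ℝ} (hk : 200 * j ≤ k) :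
    freqBound s ^ (-k) ≤ s ^ (-j) := by
  unfold freqBound
  rw [← rpow_mul (by linarith)]
  exact rpow_le_rpow_of_exponent_le hs (by linarith)

/-- Changing the truncation between the times `s` and `2s` affects only frequencies of size at most
`3/s`, where the weight `|ξ|` is small, and frequencies above `s^{1/200}`, where the regularity `n`
pays. -/
lemma norm_mul_timeSymbol_sub_le {c : E4 → ℂ} (hc : IsCutoff c) {σ n : ℝ} (hσ : σ ≤ 20)
    (hn : 221 ≤ n) {s : ℝ} (hs : 1 ≤ s) (ξ : E4) :
    ‖ξ‖ * ‖timeSymbol c σ (2 * s) ξ - timeSymbol c σ s ξ‖ ≤ 12 * s⁻¹ * bracketSymbol n ξ := by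
  have hs0 : 0 < s := by linarith
  have hw := (bracketSymbol_pos σ ξ).le
  have hwn := (bracketSymbol_pos n ξ).le
  have hd : ‖timeSymbol c σ (2 * s) ξ - timeSymbol c σ s ξ‖ ≤ 4 * bracketSymbol σ ξ := by
    refine (norm_sub_le _ _).trans ?_
    linarith [norm_timeSymbol_le hc σ (2 * s) ξ, norm_timeSymbol_le hc σ s ξ]
  have hRmono : freqBound s ≤ freqBound (2 * s) :=
    rpow_le_rpow hs0.le (by linarith) (by norm_num)
  rcases le_or_gt ‖ξ‖ (3 / s) with h1 | h1
  · calc _ ≤ 3 / s * (4 * bracketSymbol σ ξ) := by gcongr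
      _ ≤ 3 / s * (4 * bracketSymbol n ξ) := by
        gcongr
        exact bracketSymbol_mono (by linarith) ξ
      _ = _ := by field_simp; ring
  rcases lt_or_ge ‖ξ‖ (2 * freqBound s) with h2 | h2
  · have h1' : 3 / (2 * s) < ‖ξ‖ := lt_of_le_of_lt (by gcongr; linarith) h1
    rw [timeSymbol_eq hc σ (by positivity) (by linarith) h1', timeSymbol_eq hc σ hs0 h2 h1]
    simp only [sub_self, norm_zero, mul_zero]
    positivity
  · have hR1 := one_le_freqBound hs
    have hlow : bracketSymbol (-(n - 21)) ξ ≤ s⁻¹ := by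
      refine (bracketSymbol_neg_le (by linarith) (by linarith) (R := freqBound s)
        (by linarith)).trans ?_
      rw [← rpow_neg_one]
      exact freqBound_rpow_le hs (by linarith)
    calc _ ≤ bracketSymbol 1 ξ * (4 * bracketSymbol 20 ξ) := by
          gcongr
          · exact (bracketSymbol_pos 1 ξ).le
          · exact norm_le_bracketSymbol_one ξ
          · exact hd.trans (by gcongr; exact bracketSymbol_mono hσ ξ)
      _ = 4 * (bracketSymbol n ξ * bracketSymbol (-(n - 21)) ξ) := by
          rw [← bracketSymbol_add n, show n + -(n - 21) = 1 + 20 by ring, bracketSymbol_add]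
          ring
      _ ≤ 4 * (bracketSymbol n ξ * s⁻¹) := by gcongr
      _ ≤ _ := by
          have : 0 ≤ bracketSymbol n ξ * s⁻¹ := by positivity
          linarith

lemma weakJet_sub_le (u v : E4 → ℂ) (u₁ v₁ : Fin 4 → E4 → ℂ) (u₂ v₂ : Fin 4 → Fin 4 → E4 → ℂ)
    (ξ : E4) :
    weakJet (fun ξ => u ξ - v ξ) (fun j ξ => u₁ j ξ - v₁ j ξ) (fun i j ξ => u₂ i j ξ - v₂ i j ξ) ξ
      ≤ weakJet u u₁ u₂ ξ + weakJet v v₁ v₂ ξ := by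
  have s1 : ∑ j, ‖u₁ j ξ - v₁ j ξ‖ ≤ ∑ j, ‖u₁ j ξ‖ + ∑ j, ‖v₁ j ξ‖ := by
    rw [← Finset.sum_add_distrib]
    exact Finset.sum_le_sum fun j _ => norm_sub_le _ _
  have s2 : ∑ i, ∑ j, ‖u₂ i j ξ - v₂ i j ξ‖ ≤ ∑ i, ∑ j, ‖u₂ i j ξ‖ + ∑ i, ∑ j, ‖v₂ i j ξ‖ := by
    simp only [← Finset.sum_add_distrib]
    exact Finset.sum_le_sum fun i _ => Finset.sum_le_sum fun j _ => norm_sub_le _ _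
  unfold weakJet
  calc _ ≤ (‖u ξ‖ + ‖v ξ‖) + ‖ξ‖ * (∑ j, ‖u₁ j ξ‖ + ∑ j, ‖v₁ j ξ‖)
        + ‖ξ‖ ^ 2 * (∑ i, ∑ j, ‖u₂ i j ξ‖ + ∑ i, ∑ j, ‖v₂ i j ξ‖) := by
        gcongr
        exact norm_sub_le _ _
    _ = _ := by ring

lemma cut_eq_zero {m f : E4 → ℂ} {f₁ : Fin 4 → E4 → ℂ} {f₂ : Fin 4 → Fin 4 → E4 → ℂ} {R : ℝ}
    (hm : ∀ ξ, m ξ ≠ 0 → ‖ξ‖ ≤ R) {ξ : E4} (hξ : R < ‖ξ‖) :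
    m ξ * f ξ = 0 ∧ (∀ j, cut₁ m f f₁ j ξ = 0) ∧ ∀ i j, cut₂ m f f₁ f₂ i j ξ = 0 := by
  have hz : m =ᶠ[nhds ξ] fun _ => (0 : ℂ) := by
    filter_upwards [(isOpen_lt continuous_const continuous_norm).mem_nhds
      (show R < ‖ξ‖ from hξ)] with η hη
    by_contra h
    exact absurd (hm η h) (not_le.mpr hη)
  have h0 : m ξ = 0 := hz.eq_of_nhds
  have hd : fderiv ℝ m =ᶠ[nhds ξ] fun _ => (0 : E4 →L[ℝ] ℂ) := by
    filter_upwards [hz.fderiv (𝕜 := ℝ)] with η hη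
    rw [hη]
    exact fderiv_const_apply (0 : ℂ)
  have h1 : fderiv ℝ m ξ = (0 : E4 →L[ℝ] ℂ) := hd.eq_of_nhds
  have h2 : ∀ j, fderiv ℝ (fun ξ => fderiv ℝ m ξ (coordDir j)) ξ = (0 : E4 →L[ℝ] ℂ) := fun j => by
    have h3 : (fun ξ => fderiv ℝ m ξ (coordDir j)) =ᶠ[nhds ξ] fun _ => (0 : ℂ) := by
      filter_upwards [hd] with η hη
      rw [hη]
      rfl
    rw [h3.fderiv_eq (𝕜 := ℝ)]
    exact fderiv_const_apply (0 : ℂ)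
  refine ⟨by simp [h0], fun j => by simp [cut₁, h0, h1], fun i j => by simp [cut₂, h0, h1, h2]⟩

/-- The contribution of one dyadic step in time to the oscillatory integral at the final time `t`.
The difference of the profiles at the times `2s` and `s` is small in the first norm of the
dispersive estimate, and no larger than the profiles in the second one. -/
lemma exists_dyadic_step {c : E4 → ℂ} (hc : IsCutoff c) :
    ∃ C : ℝ, 0 < C ∧ ∀ {n T L σ : ℝ} {a b : ℝ → L2C} {g h : ℝ → E4 → ℂ}
      {g₁ h₁ : ℝ → Fin 4 → E4 → ℂ} {g₂ h₂ : ℝ → Fin 4 → Fin 4 → E4 → ℂ}, σ ^ 2 = 1 → 0 ≤ L →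
      221 ≤ n → WaveData n T L σ a b g h g₁ h₁ g₂ h₂ → ∀ s, 1 ≤ s → 2 * s ≤ T →
      ∀ ν, 0 ≤ ν → ν ≤ 20 → ∀ (x : E4) (t : ℝ), t ≠ 0 →
      ‖∫ ξ, wavePhase x t ξ * (timeSymbol c ν (2 * s) ξ * g (2 * s) ξ
          - timeSymbol c ν s ξ * g s ξ)‖ₑ
        ≤ ENNReal.ofReal (C * |t| ^ (-(3 / 2) : ℝ) * L * s ^ (-(19 / 800) : ℝ)) := by
  obtain ⟨c₀, hc₀, hdisp⟩ := exists_dispersive_weak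
  obtain ⟨c₁, hc₁, hjet⟩ := exists_jetSize_truncSymbol_le hc
  refine ⟨c₀ * 3 ^ (1 / 4 : ℝ) * 2 * ((56 * c₁ + 24) + 3528 * c₁), by positivity, ?_⟩
  intro n T L σ a b g h g₁ h₁ g₂ h₂ hσ hL hn hd s hs hsT ν hν0 hν x t ht
  have hs0 : 0 < s := by linarith
  have hmem : s ∈ Set.Icc 0 T := ⟨hs0.le, by linarith⟩
  have hmem' : 2 * s ∈ Set.Icc 0 T := ⟨by linarith, hsT⟩
  set S : ℝ := s ^ (1 / 8 : ℝ) with hS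
  have hS0 : 0 < S := rpow_pos_of_pos hs0 _
  set B : ℝ := c₁ * (2 * s ^ (1 / 10 : ℝ)) with hB
  have hB0 : 0 ≤ B := by positivity
  have hjs : ∀ τ, 1 ≤ τ → τ ≤ 2 * s → ∀ ξ, jetSize (timeSymbol c ν τ) ξ ≤ B := by
    intro τ hτ1 hτ ξ
    refine (hjet ν hν0 hν τ (by linarith) _ (one_le_freqBound hτ1) ξ).trans ?_
    rw [hB]
    gcongr
    unfold freqBound
    rw [← rpow_natCast, ← rpow_mul (by linarith)]
    calc τ ^ (1 / 200 * ((20 : ℕ) : ℝ)) ≤ (2 * s) ^ (1 / 200 * ((20 : ℕ) : ℝ)) := by gcongr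
      _ = 2 ^ (1 / 10 : ℝ) * s ^ (1 / 10 : ℝ) := by
          rw [mul_rpow (by norm_num) hs0.le]; norm_num
      _ ≤ 2 ^ (1 : ℝ) * s ^ (1 / 10 : ℝ) := by gcongr <;> norm_num
      _ = _ := by rw [rpow_one]
  have hm1 : IsTest (timeSymbol c ν s) :=
    isTest_truncSymbol hc hs0 (by linarith [one_le_freqBound hs])
  have hm2 : IsTest (timeSymbol c ν (2 * s)) :=
    isTest_truncSymbol hc (by positivity) (by linarith [one_le_freqBound (s := 2 * s) (by linarith)])
  set M : ℝ := L * (2 * S) with hM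
  have hM0 : 0 ≤ M := by positivity
  have hj1 : HasJet (g s) (g₁ s) (g₂ s) M := (hd.jet s hmem).mono
    (mul_le_mul_of_nonneg_left (bracket_rpow_le hs hs0.le (by linarith)) hL)
  have hle2 : L * bracket (2 * s) ^ (1 / 8 : ℝ) ≤ M :=
    mul_le_mul_of_nonneg_left (bracket_rpow_le hs (by linarith) le_rfl) hL
  have hj2 : HasJet (g (2 * s)) (g₁ (2 * s)) (g₂ (2 * s)) M := (hd.jet (2 * s) hmem').mono hle2
  set R : ℝ := 3 * freqBound (2 * s) with hR
  have hR0 : 0 < R := by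
    have := one_le_freqBound (s := 2 * s) (by linarith)
    rw [hR]; linarith
  have hRmono : freqBound s ≤ freqBound (2 * s) :=
    rpow_le_rpow hs0.le (by linarith) (by norm_num)
  have hsupp1 : ∀ ξ, timeSymbol c ν s ξ ≠ 0 → ‖ξ‖ ≤ R := fun ξ hξ =>
    (norm_le_of_truncSymbol_ne_zero hc (by linarith [one_le_freqBound hs]) hξ).trans
      (by rw [hR]; gcongr)
  have hsupp2 : ∀ ξ, timeSymbol c ν (2 * s) ξ ≠ 0 → ‖ξ‖ ≤ R := fun ξ hξ =>
    norm_le_of_truncSymbol_ne_zero hc (by linarith [one_le_freqBound hs]) hξ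
  have hA : 0 < s ^ (1 / 2 : ℝ) := rpow_pos_of_pos hs0 _
  -- The increment is smaller than the jets by a factor `s⁻¹`, so that `A = s^{1/2}` balances
  -- `A^{3/2} s⁻¹` against `A^{-1/2}`; both equal `s^{-1/4}`.
  have hmain := hdisp
    (fun ξ => timeSymbol c ν (2 * s) ξ * g (2 * s) ξ - timeSymbol c ν s ξ * g s ξ)
    (fun j ξ => cut₁ (timeSymbol c ν (2 * s)) (g (2 * s)) (g₁ (2 * s)) j ξ
      - cut₁ (timeSymbol c ν s) (g s) (g₁ s) j ξ)
    (fun i j ξ => cut₂ (timeSymbol c ν (2 * s)) (g (2 * s)) (g₁ (2 * s)) (g₂ (2 * s)) i j ξ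
      - cut₂ (timeSymbol c ν s) (g s) (g₁ s) (g₂ s) i j ξ) R hR0
    ((hj2.memLp_cut hm2).sub (hj1.memLp_cut hm1))
    (fun j => (hj2.memLp_cut₁ hm2 j).sub (hj1.memLp_cut₁ hm1 j))
    (fun i j => (hj2.memLp_cut₂ hm2 i j).sub (hj1.memLp_cut₂ hm1 i j))
    (fun j => (hj2.weakDeriv_cut hm2 j).sub (hj1.weakDeriv_cut hm1 j) (hj2.memLp_cut hm2)
      (hj2.memLp_cut₁ hm2 j) (hj1.memLp_cut hm1) (hj1.memLp_cut₁ hm1 j))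
    (fun i j => (hj2.weakDeriv_cut₁ hm2 i j).sub (hj1.weakDeriv_cut₁ hm1 i j)
      (hj2.memLp_cut₁ hm2 j) (hj2.memLp_cut₂ hm2 i j) (hj1.memLp_cut₁ hm1 j)
      (hj1.memLp_cut₂ hm1 i j))
    (fun ξ hξ => by
      obtain ⟨p0, p1, p2⟩ := cut_eq_zero (f := g (2 * s)) (f₁ := g₁ (2 * s)) (f₂ := g₂ (2 * s))
        hsupp2 hξ
      obtain ⟨q0, q1, q2⟩ := cut_eq_zero (f := g s) (f₁ := g₁ s) (f₂ := g₂ s) hsupp1 hξ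
      exact ⟨by rw [p0, q0, sub_zero], fun j => by rw [p1, q1, sub_zero],
        fun i j => by rw [p2, q2, sub_zero]⟩)
    x t _ ht hA
  have hweak : eLpNorm (weakJet
      (fun ξ => timeSymbol c ν (2 * s) ξ * g (2 * s) ξ - timeSymbol c ν s ξ * g s ξ)
      (fun j ξ => cut₁ (timeSymbol c ν (2 * s)) (g (2 * s)) (g₁ (2 * s)) j ξ
        - cut₁ (timeSymbol c ν s) (g s) (g₁ s) j ξ)
      (fun i j ξ => cut₂ (timeSymbol c ν (2 * s)) (g (2 * s)) (g₁ (2 * s)) (g₂ (2 * s)) i j ξ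
        - cut₂ (timeSymbol c ν s) (g s) (g₁ s) (g₂ s) i j ξ)) 2 volume
      ≤ ENNReal.ofReal (882 * B * M) := by
    have w2 := hj2.eLpNorm_weakJet_cut_le hm2 hB0 (hjs (2 * s) (by linarith) le_rfl)
    have w1 := hj1.eLpNorm_weakJet_cut_le hm1 hB0 (hjs s hs (by linarith))
    refine (eLpNorm_mono_real fun ξ => ?_).trans ((eLpNorm_add_le
      (aestronglyMeasurable_weakJet (hj2.memLp_cut hm2).1 (fun j => (hj2.memLp_cut₁ hm2 j).1)
        (fun i j => (hj2.memLp_cut₂ hm2 i j).1))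
      (aestronglyMeasurable_weakJet (hj1.memLp_cut hm1).1 (fun j => (hj1.memLp_cut₁ hm1 j).1)
        (fun i j => (hj1.memLp_cut₂ hm1 i j).1)) (by norm_num)).trans ?_)
    · rw [Real.norm_of_nonneg (by unfold weakJet; positivity)]
      exact weakJet_sub_le _ _ _ _ _ _ ξ
    · refine (add_le_add w2 w1).trans (le_of_eq ?_)
      rw [← ENNReal.ofReal_add (by positivity) (by positivity)]
      ring_nf
  have hrad : eLpNorm (fun ξ => ‖ξ‖ *
      ‖timeSymbol c ν (2 * s) ξ * g (2 * s) ξ - timeSymbol c ν s ξ * g s ξ‖) 2 volume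
      ≤ ENNReal.ofReal ((14 * B + 12) * M * s⁻¹) := by
    have r1 := hd.eLpNorm_increment_le hσ hL hs hsT hm1
      (fun ξ => (norm_le_jetSize _ ξ).trans (hjs s hs (by linarith) ξ))
      (fun ξ hξ => truncSymbol_eq_zero_of_lt hc hs0 hξ)
    have r2 : eLpNorm (fun ξ => (‖ξ‖ : ℂ) * ((timeSymbol c ν (2 * s) ξ - timeSymbol c ν s ξ)
        * g (2 * s) ξ)) 2 volume ≤ ENNReal.ofReal (12 * s⁻¹ * M) := by
      have hp : ∀ ξ, ‖(‖ξ‖ : ℂ) * ((timeSymbol c ν (2 * s) ξ - timeSymbol c ν s ξ)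
          * g (2 * s) ξ)‖ ≤ 12 * s⁻¹ * ‖(bracketSymbol n ξ : ℂ) * g (2 * s) ξ‖ := fun ξ => by
        rw [norm_mul, norm_mul, norm_mul, Complex.norm_real, Complex.norm_real, norm_norm,
          Real.norm_of_nonneg (bracketSymbol_pos n ξ).le, ← mul_assoc, ← mul_assoc]
        exact mul_le_mul_of_nonneg_right (norm_mul_timeSymbol_sub_le hc hν hn hs ξ)
          (norm_nonneg _)
      refine (eLpNorm_le_mul_eLpNorm_of_ae_le_mul (ae_of_all _ hp) 2).trans ?_
      rw [ENNReal.ofReal_mul (p := 12 * s⁻¹) (by positivity)]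
      gcongr
      exact (hd.high _ hmem').trans (ENNReal.ofReal_le_ofReal hle2)
    have m1 : AEStronglyMeasurable (fun ξ => (‖ξ‖ : ℂ) *
        (timeSymbol c ν s ξ * (g (2 * s) ξ - g s ξ))) volume := by
      have hcn : Continuous fun ξ : E4 => (‖ξ‖ : ℂ) := by fun_prop
      exact hcn.aestronglyMeasurable.mul (hm1.smooth.continuous.aestronglyMeasurable.mul
        (hj2.memLp.1.sub hj1.memLp.1))
    have m2 : AEStronglyMeasurable (fun ξ => (‖ξ‖ : ℂ) * ((timeSymbol c ν (2 * s) ξ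
        - timeSymbol c ν s ξ) * g (2 * s) ξ)) volume := by
      have hcn : Continuous fun ξ : E4 => (‖ξ‖ : ℂ) := by fun_prop
      exact hcn.aestronglyMeasurable.mul (((hm2.smooth.continuous.sub
        hm1.smooth.continuous).aestronglyMeasurable).mul hj2.memLp.1)
    have he : eLpNorm (fun ξ => ‖ξ‖ *
        ‖timeSymbol c ν (2 * s) ξ * g (2 * s) ξ - timeSymbol c ν s ξ * g s ξ‖) 2 volume
        = eLpNorm (fun ξ => (‖ξ‖ : ℂ) * (timeSymbol c ν s ξ * (g (2 * s) ξ - g s ξ))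
          + (‖ξ‖ : ℂ) * ((timeSymbol c ν (2 * s) ξ - timeSymbol c ν s ξ) * g (2 * s) ξ))
          2 volume := by
      refine eLpNorm_congr_norm_ae (ae_of_all _ fun ξ => ?_)
      rw [← mul_add, norm_mul, norm_mul, Complex.norm_real, norm_norm, norm_norm]
      congr 2
      ring
    rw [he]
    refine (eLpNorm_add_le m1 m2 (by norm_num)).trans ((add_le_add r1 r2).trans (le_of_eq ?_))
    rw [← ENNReal.ofReal_add (by positivity) (by positivity), hM, hS]
    ring_nf
  refine hmain.trans ?_
  have hk0 : 0 ≤ c₀ * |t| ^ (-(3 / 2) : ℝ) * R ^ (1 / 4 : ℝ) := by positivity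
  have hA1 : 0 ≤ (s ^ (1 / 2 : ℝ)) ^ (3 / 2 : ℝ) := by positivity
  have hA2 : 0 ≤ (s ^ (1 / 2 : ℝ)) ^ (-(1 / 2) : ℝ) := by positivity
  calc _ ≤ ENNReal.ofReal (c₀ * |t| ^ (-(3 / 2) : ℝ) * R ^ (1 / 4 : ℝ)) *
        (ENNReal.ofReal ((s ^ (1 / 2 : ℝ)) ^ (3 / 2 : ℝ)) *
          ENNReal.ofReal ((14 * B + 12) * M * s⁻¹)
        + ENNReal.ofReal ((s ^ (1 / 2 : ℝ)) ^ (-(1 / 2) : ℝ)) *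
          ENNReal.ofReal (882 * B * M)) := by gcongr
    _ = ENNReal.ofReal (c₀ * |t| ^ (-(3 / 2) : ℝ) * R ^ (1 / 4 : ℝ) *
        ((s ^ (1 / 2 : ℝ)) ^ (3 / 2 : ℝ) * ((14 * B + 12) * M * s⁻¹)
          + (s ^ (1 / 2 : ℝ)) ^ (-(1 / 2) : ℝ) * (882 * B * M))) := by
        rw [ENNReal.ofReal_mul hk0, ENNReal.ofReal_add (by positivity) (by positivity),
          ENNReal.ofReal_mul hA1, ENNReal.ofReal_mul hA2]
    _ ≤ _ := by
        refine ENNReal.ofReal_le_ofReal ?_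
        have e1 : (s ^ (1 / 2 : ℝ)) ^ (3 / 2 : ℝ) * s⁻¹ = s ^ (-(1 / 4) : ℝ) := by
          rw [← rpow_mul hs0.le, ← rpow_neg_one, ← rpow_add hs0]; norm_num
        have e2 : (s ^ (1 / 2 : ℝ)) ^ (-(1 / 2) : ℝ) = s ^ (-(1 / 4) : ℝ) := by
          rw [← rpow_mul hs0.le]; norm_num
        have e3 : R ^ (1 / 4 : ℝ) ≤ 3 ^ (1 / 4 : ℝ) * (2 * s ^ (1 / 800 : ℝ)) := by
          rw [hR, mul_rpow (by norm_num) (by unfold freqBound; positivity)]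
          gcongr
          unfold freqBound
          rw [← rpow_mul (by positivity), mul_rpow (by norm_num) hs0.le]
          calc (2 : ℝ) ^ (1 / 200 * (1 / 4) : ℝ) * s ^ (1 / 200 * (1 / 4) : ℝ)
              ≤ 2 ^ (1 : ℝ) * s ^ (1 / 200 * (1 / 4) : ℝ) := by gcongr <;> norm_num
            _ = _ := by rw [rpow_one]; norm_num
        have hp10 : 1 ≤ s ^ (1 / 10 : ℝ) := one_le_rpow hs (by norm_num)
        have e4 : (14 * B + 12) + 882 * B
            ≤ ((28 * c₁ + 12) + 1764 * c₁) * s ^ (1 / 10 : ℝ) := by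
          rw [hB]; nlinarith
        have e5 : s ^ (1 / 800 : ℝ) * s ^ (-(1 / 4) : ℝ) * s ^ (1 / 10 : ℝ) * S
            = s ^ (-(19 / 800) : ℝ) := by
          rw [hS, ← rpow_add hs0, ← rpow_add hs0, ← rpow_add hs0]; norm_num
        calc _ = c₀ * |t| ^ (-(3 / 2) : ℝ) * R ^ (1 / 4 : ℝ) *
              (s ^ (-(1 / 4) : ℝ) * M * ((14 * B + 12) + 882 * B)) := by
              rw [e2]
              linear_combination (c₀ * |t| ^ (-(3 / 2) : ℝ) * R ^ (1 / 4 : ℝ) *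
                ((14 * B + 12) * M)) * e1
          _ ≤ c₀ * |t| ^ (-(3 / 2) : ℝ) * (3 ^ (1 / 4 : ℝ) * (2 * s ^ (1 / 800 : ℝ))) *
              (s ^ (-(1 / 4) : ℝ) * M *
                (((28 * c₁ + 12) + 1764 * c₁) * s ^ (1 / 10 : ℝ))) := by gcongr
          _ = c₀ * 3 ^ (1 / 4 : ℝ) * 2 * ((56 * c₁ + 24) + 3528 * c₁) *
              |t| ^ (-(3 / 2) : ℝ) * L *
              (s ^ (1 / 800 : ℝ) * s ^ (-(1 / 4) : ℝ) * s ^ (1 / 10 : ℝ) * S) := by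
              rw [hM]; ring
          _ = _ := by rw [e5]

/-! ### Summation of the dyadic steps -/

lemma enorm_le_ofReal_iff {z : ℂ} {r : ℝ} (hr : 0 ≤ r) : ‖z‖ₑ ≤ ENNReal.ofReal r ↔ ‖z‖ ≤ r := by
  rw [← ofReal_norm, ENNReal.ofReal_le_ofReal_iff hr]

/-- The oscillatory integral at time `t` with the profile taken at a time `s` of order one. -/
lemma exists_dyadic_base {c : E4 → ℂ} (hc : IsCutoff c) :
    ∃ C : ℝ, 0 < C ∧ ∀ {n T L σ : ℝ} {a b : ℝ → L2C} {g h : ℝ → E4 → ℂ}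
      {g₁ h₁ : ℝ → Fin 4 → E4 → ℂ} {g₂ h₂ : ℝ → Fin 4 → Fin 4 → E4 → ℂ}, 0 ≤ L →
      WaveData n T L σ a b g h g₁ h₁ g₂ h₂ → ∀ s, 1 ≤ s → s ≤ 2 → s ≤ T →
      ∀ ν, 0 ≤ ν → ν ≤ 20 → ∀ (x : E4) (t : ℝ), t ≠ 0 →
      ‖∫ ξ, wavePhase x t ξ * (timeSymbol c ν s ξ * g s ξ)‖
        ≤ C * |t| ^ (-(3 / 2) : ℝ) * L := by
  obtain ⟨c₀, hc₀, hdisp⟩ := exists_dispersive_weak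
  obtain ⟨c₁, hc₁, hjet⟩ := exists_jetSize_truncSymbol_le hc
  refine ⟨c₀ * 6 ^ (1 / 4 : ℝ) * (7 * (441 * (c₁ * 2) * 4)), by positivity, ?_⟩
  intro n T L σ a b g h g₁ h₁ g₂ h₂ hL hd s hs hs2 hsT ν hν0 hν x t ht
  have hs0 : 0 < s := by linarith
  have hf1 := one_le_freqBound hs
  have hroot : ∀ p : ℝ, 0 ≤ p → p ≤ 1 → s ^ p ≤ 2 := fun p hp0 hp => by
    calc s ^ p ≤ s ^ (1 : ℝ) := rpow_le_rpow_of_exponent_le hs hp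
      _ ≤ 2 := by rwa [rpow_one]
  have hf2 : freqBound s ≤ 2 := hroot _ (by norm_num) (by norm_num)
  have hB : ∀ ξ, jetSize (timeSymbol c ν s) ξ ≤ c₁ * 2 := fun ξ => by
    refine (hjet ν hν0 hν s hs0 _ hf1 ξ).trans ?_
    gcongr
    unfold freqBound
    rw [← rpow_natCast, ← rpow_mul hs0.le]
    exact hroot _ (by norm_num) (by norm_num)
  have hm : IsTest (timeSymbol c ν s) := isTest_truncSymbol hc hs0 (by linarith)
  have hj : HasJet (g s) (g₁ s) (g₂ s) (L * 4) := (hd.jet s ⟨hs0.le, hsT⟩).mono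
    (mul_le_mul_of_nonneg_left ((bracket_rpow_le hs hs0.le (by linarith)).trans
      (by linarith [hroot (1 / 8) (by norm_num) (by norm_num)])) hL)
  have hsupp : ∀ ξ, timeSymbol c ν s ξ ≠ 0 → ‖ξ‖ ≤ 6 := fun ξ hξ =>
    (norm_le_of_truncSymbol_ne_zero hc (by linarith) hξ).trans (by linarith)
  have hmain := hdisp (fun ξ => timeSymbol c ν s ξ * g s ξ) (cut₁ (timeSymbol c ν s) (g s) (g₁ s))
    (cut₂ (timeSymbol c ν s) (g s) (g₁ s) (g₂ s)) 6 (by norm_num) (hj.memLp_cut hm)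
    (hj.memLp_cut₁ hm) (hj.memLp_cut₂ hm) (hj.weakDeriv_cut hm) (hj.weakDeriv_cut₁ hm)
    (fun ξ hξ => cut_eq_zero hsupp hξ) x t 1 ht one_pos
  have hw := hj.eLpNorm_weakJet_cut_le hm (by positivity) hB
  have hr : eLpNorm (fun ξ => ‖ξ‖ * ‖timeSymbol c ν s ξ * g s ξ‖) 2 volume
      ≤ ENNReal.ofReal 6 * ENNReal.ofReal (441 * (c₁ * 2) * (L * 4)) := by
    refine (eLpNorm_le_mul_eLpNorm_of_ae_le_mul (c := 6) (ae_of_all _ fun ξ => ?_) 2).trans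
      (mul_le_mul_right hw _)
    have hle : ‖timeSymbol c ν s ξ * g s ξ‖ ≤ weakJet (fun ξ => timeSymbol c ν s ξ * g s ξ)
        (cut₁ (timeSymbol c ν s) (g s) (g₁ s)) (cut₂ (timeSymbol c ν s) (g s) (g₁ s) (g₂ s)) ξ := by
      have : 0 ≤ ‖ξ‖ * ∑ j, ‖cut₁ (timeSymbol c ν s) (g s) (g₁ s) j ξ‖ := by positivity
      have : 0 ≤ ‖ξ‖ ^ 2 * ∑ i, ∑ j, ‖cut₂ (timeSymbol c ν s) (g s) (g₁ s) (g₂ s) i j ξ‖ := by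
        positivity
      unfold weakJet
      linarith
    rw [Real.norm_of_nonneg (by positivity), Real.norm_of_nonneg ((norm_nonneg _).trans hle)]
    by_cases h0 : timeSymbol c ν s ξ = 0
    · rw [h0, zero_mul, norm_zero, mul_zero]
      exact mul_nonneg (by norm_num) ((norm_nonneg _).trans hle)
    · exact mul_le_mul (hsupp ξ h0) hle (norm_nonneg _) (by norm_num)
  rw [← enorm_le_ofReal_iff (by positivity)]
  refine hmain.trans ?_
  rw [one_rpow, one_rpow, ENNReal.ofReal_one, one_mul, one_mul]
  refine (mul_le_mul_right (add_le_add hr hw) _).trans (le_of_eq ?_)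
  rw [← ENNReal.ofReal_mul (by norm_num), ← ENNReal.ofReal_add (by positivity) (by positivity),
    ← ENNReal.ofReal_mul (by positivity)]
  ring_nf

/-- Summation of a geometrically decaying sequence of dyadic increments. -/
lemma le_of_dyadic_increments {F : ℝ → ℝ} {T D C q : ℝ} (hC : 0 ≤ C) (hq : 0 < q)
    (hbase : ∀ s, 1 ≤ s → s ≤ 2 → s ≤ T → F s ≤ D)
    (hstep : ∀ s, 1 ≤ s → 2 * s ≤ T → F (2 * s) ≤ F s + C * s ^ (-q)) {s : ℝ} (hs : 1 ≤ s)
    (hsT : s ≤ T) : F s ≤ D + C / (1 - 2 ^ (-q)) := by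
  have h2 : (2 : ℝ) ^ (-q) < 1 := rpow_lt_one_of_one_lt_of_neg (by norm_num) (by linarith)
  set b : ℝ := C / (1 - 2 ^ (-q)) with hb
  have hb0 : 0 ≤ b := div_nonneg hC (by linarith)
  have hbC : b * (1 - 2 ^ (-q)) = C := div_mul_cancel₀ _ (by linarith)
  have key : ∀ k : ℕ, ∀ s, 1 ≤ s → s ≤ 2 ^ (k + 1) → s ≤ T → F s ≤ D + b - b * s ^ (-q) := by
    intro k
    induction k with
    | zero =>
      intro s hs hs2 hsT
      have h1 : s ^ (-q) ≤ 1 := rpow_le_one_of_one_le_of_nonpos hs (by linarith)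
      have := hbase s hs (by simpa using hs2) hsT
      nlinarith
    | succ k ih =>
      intro s hs hs2 hsT
      rcases le_or_gt s 2 with h | h
      · have h1 : s ^ (-q) ≤ 1 := rpow_le_one_of_one_le_of_nonpos hs (by linarith)
        have := hbase s hs h hsT
        nlinarith
      · have i1 := ih (s / 2) (by linarith) (by rw [pow_succ] at hs2; linarith) (by linarith)
        have i2 := hstep (s / 2) (by linarith) (by linarith)
        have i3 : s ^ (-q) = 2 ^ (-q) * (s / 2) ^ (-q) := by
          rw [← mul_rpow (by norm_num) (by linarith)]
          ring_nf
        rw [show 2 * (s / 2) = s by ring] at i2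
        rw [i3]
        calc F s ≤ (D + b - b * (s / 2) ^ (-q)) + C * (s / 2) ^ (-q) := i2.trans (by linarith)
          _ = _ := by rw [← hbC]; ring
  obtain ⟨k, hk⟩ := pow_unbounded_of_one_lt s (by norm_num : (1 : ℝ) < 2)
  have := key k s hs (hk.le.trans (by rw [pow_succ]; linarith [pow_pos (two_pos (α := ℝ)) k])) hsT
  have : 0 ≤ b * s ^ (-q) := mul_nonneg hb0 (rpow_nonneg (by linarith) _)
  linarith

lemma memLp_bracketSymbol_neg_three : MemLp (bracketSymbol (-3)) 2 volume := by
  have h1 : Integrable (fun ξ : E4 => (1 + ‖ξ‖ ^ 2) ^ (-6 / 2 : ℝ)) volume :=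
    integrable_rpow_neg_one_add_norm_sq (by simp; norm_num)
  have h2 := h1.comp_smul (R := 2 * π) (by positivity)
  have hm : AEStronglyMeasurable (bracketSymbol (-3)) volume :=
    (contDiff_bracketSymbol (-3)).continuous.aestronglyMeasurable
  rw [memLp_two_iff_integrable_sq hm]
  refine h2.congr (ae_of_all _ fun ξ => ?_)
  unfold bracketSymbol
  simp only
  rw [← rpow_two (_ ^ _), ← rpow_mul (bracketSymbol_base_pos ξ).le]
  norm_num

/-- Cauchy-Schwarz after splitting off the symbol of order `n`. -/
lemma lintegral_symbol_mul_le {n : ℝ} {p f : E4 → ℂ} {V : E4 → ℝ}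
    (hV : AEStronglyMeasurable V volume) (hf : AEStronglyMeasurable f volume)
    (hp : ∀ ξ, ‖p ξ‖ ≤ V ξ * bracketSymbol n ξ) :
    ∫⁻ ξ, ‖p ξ * f ξ‖ₑ ≤ eLpNorm V 2 volume *
      eLpNorm (fun ξ => (bracketSymbol n ξ : ℂ) * f ξ) 2 volume := by
  have hm : AEStronglyMeasurable (fun ξ => (bracketSymbol n ξ : ℂ) * f ξ) volume :=
    (Complex.continuous_ofReal.comp
      (contDiff_bracketSymbol n).continuous).aestronglyMeasurable.mul hf
  have h := eLpNorm_smul_le_mul_eLpNorm (p := 2) (q := 2) (r := 1) hm hV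
  rw [eLpNorm_one_eq_lintegral_enorm] at h
  refine le_trans (lintegral_mono fun ξ => ?_) h
  have hb := (bracketSymbol_pos n ξ).le
  rw [← ofReal_norm, ← ofReal_norm]
  refine ENNReal.ofReal_le_ofReal ?_
  simp only [Pi.smul_apply', norm_mul, norm_smul, Complex.norm_real, Real.norm_of_nonneg hb]
  rw [← mul_assoc]
  gcongr
  exact (hp ξ).trans (mul_le_mul_of_nonneg_right (le_abs_self _) hb)

/-- The part of the symbol that is removed by the truncation at time `s` consists of frequencies
below `3/s`, which occupy a small volume, and of high frequencies. -/
lemma norm_symbol_sub_timeSymbol_le {c : E4 → ℂ} (hc : IsCutoff c) {ν n s : ℝ} (hν : ν ≤ 20)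
    (hn : 423 ≤ n) (hs : 1 ≤ s) (ξ : E4) :
    ‖(bracketSymbol ν ξ : ℂ) - timeSymbol c ν s ξ‖ ≤
      ((Metric.closedBall (0 : E4) (3 / s)).indicator (fun _ => (3 : ℝ)) ξ
        + (3 * s ^ (-2 : ℝ)) * bracketSymbol (-3) ξ) * bracketSymbol n ξ := by
  have hs0 : 0 < s := by linarith
  have h3 := (bracketSymbol_pos (-3) ξ).le
  have hwn := (bracketSymbol_pos n ξ).le
  have hle : ‖(bracketSymbol ν ξ : ℂ) - timeSymbol c ν s ξ‖ ≤ 3 * bracketSymbol 20 ξ := by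
    refine (norm_sub_le _ _).trans ?_
    rw [Complex.norm_real, Real.norm_of_nonneg (bracketSymbol_pos ν ξ).le]
    linarith [norm_timeSymbol_le hc ν s ξ, bracketSymbol_mono hν ξ]
  have hq : 0 ≤ (3 * s ^ (-2 : ℝ)) * bracketSymbol (-3) ξ := by positivity
  rcases le_or_gt ‖ξ‖ (3 / s) with h1 | h1
  · rw [Set.indicator_of_mem (by simpa using h1)]
    calc _ ≤ 3 * bracketSymbol n ξ := hle.trans (by
          gcongr; exact bracketSymbol_mono (by linarith) ξ)
      _ ≤ _ := by gcongr; linarith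
  rw [Set.indicator_of_notMem (by simpa using h1), zero_add]
  rcases lt_or_ge ‖ξ‖ (2 * freqBound s) with h2 | h2
  · rw [timeSymbol_eq hc ν hs0 h2 h1, sub_self, norm_zero]
    positivity
  · have hR1 := one_le_freqBound hs
    have hlow : bracketSymbol (-(n - 23)) ξ ≤ s ^ (-2 : ℝ) :=
      (bracketSymbol_neg_le (by linarith) (by linarith) (R := freqBound s) (by linarith)).trans
        (freqBound_rpow_le hs (by linarith))
    calc _ ≤ 3 * bracketSymbol 20 ξ := hle
      _ = 3 * (bracketSymbol (-(n - 23)) ξ * bracketSymbol (-3) ξ) * bracketSymbol n ξ := by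
          rw [← bracketSymbol_add, mul_assoc, ← bracketSymbol_add]
          ring_nf
      _ ≤ 3 * (s ^ (-2 : ℝ) * bracketSymbol (-3) ξ) * bracketSymbol n ξ := by gcongr
      _ = _ := by ring

lemma exists_eLpNorm_remainder_le : ∃ C : ℝ, 0 < C ∧ ∀ s : ℝ, 1 ≤ s →
    eLpNorm (fun ξ => (Metric.closedBall (0 : E4) (3 / s)).indicator (fun _ => (3 : ℝ)) ξ
        + (3 * s ^ (-2 : ℝ)) * bracketSymbol (-3) ξ) 2 volume
      ≤ ENNReal.ofReal (C * s ^ (-2 : ℝ)) := by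
  set D : ℝ := (eLpNorm (bracketSymbol (-3)) 2 volume).toReal with hD
  set v : ℝ := (volume (Metric.ball (0 : E4) 1)).toReal with hv
  refine ⟨27 * v ^ (1 / 2 : ℝ) + 3 * D + 1, by positivity, fun s hs => ?_⟩
  have hs0 : 0 < s := by linarith
  have hm1 : AEStronglyMeasurable ((Metric.closedBall (0 : E4) (3 / s)).indicator
      (fun _ => (3 : ℝ))) volume :=
    aestronglyMeasurable_const.indicator Metric.isClosed_closedBall.measurableSet
  have hm2 : AEStronglyMeasurable ((3 * s ^ (-2 : ℝ)) • bracketSymbol (-3)) volume :=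
    memLp_bracketSymbol_neg_three.1.const_smul _
  refine (eLpNorm_add_le hm1 hm2 (by norm_num)).trans ?_
  have hvol : volume (Metric.closedBall (0 : E4) (3 / s)) = ENNReal.ofReal ((3 / s) ^ 4 * v) := by
    rw [Measure.addHaar_closedBall _ _ (by positivity), ENNReal.ofReal_mul (by positivity), hv,
      ENNReal.ofReal_toReal measure_ball_lt_top.ne]
    simp
  have e1 : eLpNorm ((Metric.closedBall (0 : E4) (3 / s)).indicator (fun _ => (3 : ℝ))) 2 volume
      = ENNReal.ofReal (27 * v ^ (1 / 2 : ℝ) * s ^ (-2 : ℝ)) := by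
    rw [eLpNorm_indicator_const Metric.isClosed_closedBall.measurableSet (by norm_num)
      (by norm_num), hvol, ENNReal.toReal_ofNat,
      ENNReal.ofReal_rpow_of_nonneg (by positivity) (by norm_num),
      Real.enorm_of_nonneg (by norm_num), ← ENNReal.ofReal_mul (by norm_num)]
    congr 1
    rw [mul_rpow (by positivity) (by positivity), ← rpow_natCast, ← rpow_mul (by positivity),
      div_rpow (by norm_num) hs0.le, rpow_neg hs0.le]
    norm_num
    field_simp
    norm_num
    ring
  have e2 : eLpNorm ((3 * s ^ (-2 : ℝ)) • bracketSymbol (-3)) 2 volume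
      = ENNReal.ofReal (3 * D * s ^ (-2 : ℝ)) := by
    rw [eLpNorm_const_smul, Real.enorm_of_nonneg (by positivity),
      ← ENNReal.ofReal_toReal memLp_bracketSymbol_neg_three.2.ne, ← hD,
      ← ENNReal.ofReal_mul (by positivity)]
    ring_nf
  rw [e1, e2, ← ENNReal.ofReal_add (by positivity) (by positivity)]
  refine ENNReal.ofReal_le_ofReal ?_
  have : 0 ≤ s ^ (-2 : ℝ) := by positivity
  linarith

lemma WaveData.lintegral_symbol_le {n T L σ : ℝ} {a b : ℝ → L2C} {g h : ℝ → E4 → ℂ}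
    {g₁ h₁ : ℝ → Fin 4 → E4 → ℂ} {g₂ h₂ : ℝ → Fin 4 → Fin 4 → E4 → ℂ} (hn : 423 ≤ n)
    (hd : WaveData n T L σ a b g h g₁ h₁ g₂ h₂) {t : ℝ} (ht : t ∈ Set.Icc 0 T) {ν : ℝ}
    (hν : ν ≤ 20) : ∫⁻ ξ, ‖(bracketSymbol ν ξ : ℂ) * g t ξ‖ₑ
      ≤ eLpNorm (bracketSymbol (-3)) 2 volume * ENNReal.ofReal (L * bracket t ^ (1 / 8 : ℝ)) := by
  refine (lintegral_symbol_mul_le (n := n) memLp_bracketSymbol_neg_three.1 (hd.jet t ht).memLp.1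
    fun ξ => ?_).trans (mul_le_mul_right (hd.high t ht) _)
  rw [Complex.norm_real, Real.norm_of_nonneg (bracketSymbol_pos ν ξ).le, ← bracketSymbol_add]
  exact bracketSymbol_mono (by linarith) ξ

lemma WaveData.integrable_symbol {n T L σ : ℝ} {a b : ℝ → L2C} {g h : ℝ → E4 → ℂ}
    {g₁ h₁ : ℝ → Fin 4 → E4 → ℂ} {g₂ h₂ : ℝ → Fin 4 → Fin 4 → E4 → ℂ} (hn : 423 ≤ n)
    (hd : WaveData n T L σ a b g h g₁ h₁ g₂ h₂) {t : ℝ} (ht : t ∈ Set.Icc 0 T) {ν : ℝ}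
    (hν : ν ≤ 20) : Integrable (fun ξ => (bracketSymbol ν ξ : ℂ) * g t ξ) volume := by
  refine ⟨(Complex.continuous_ofReal.comp
    (contDiff_bracketSymbol ν).continuous).aestronglyMeasurable.mul (hd.jet t ht).memLp.1, ?_⟩
  exact (hd.lintegral_symbol_le hn ht hν).trans_lt
    (ENNReal.mul_lt_top memLp_bracketSymbol_neg_three.2 ENNReal.ofReal_lt_top)

lemma integrable_wavePhase_mul (x : E4) (t : ℝ) {f : E4 → ℂ} (hf : Integrable f volume) :
    Integrable (fun ξ => wavePhase x t ξ * f ξ) volume :=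
  hf.bdd_mul (c := 1) (continuous_wavePhase x t).aestronglyMeasurable
    (ae_of_all _ fun ξ => (norm_wavePhase x t ξ).le)

/-- The decay of the truncated oscillatory integral, by summation of its dyadic increments in the
time at which the profile is taken. -/
lemma exists_truncated_decay {c : E4 → ℂ} (hc : IsCutoff c) :
    ∃ C : ℝ, 0 < C ∧ ∀ {n T L σ : ℝ} {a b : ℝ → L2C} {g h : ℝ → E4 → ℂ}
      {g₁ h₁ : ℝ → Fin 4 → E4 → ℂ} {g₂ h₂ : ℝ → Fin 4 → Fin 4 → E4 → ℂ}, σ ^ 2 = 1 → 0 ≤ L →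
      221 ≤ n → WaveData n T L σ a b g h g₁ h₁ g₂ h₂ → ∀ s, 1 ≤ s → s ≤ T →
      ∀ ν, 0 ≤ ν → ν ≤ 20 → ∀ (x : E4) (t : ℝ), t ≠ 0 →
      ‖∫ ξ, wavePhase x t ξ * (timeSymbol c ν s ξ * g s ξ)‖
        ≤ C * |t| ^ (-(3 / 2) : ℝ) * L := by
  obtain ⟨C₀, hC₀, hbase⟩ := exists_dyadic_base hc
  obtain ⟨C₁, hC₁, hstep⟩ := exists_dyadic_step hc
  have h2 : (2 : ℝ) ^ (-(19 / 800) : ℝ) < 1 :=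
    rpow_lt_one_of_one_lt_of_neg (by norm_num) (by norm_num)
  have h2' : 0 < 1 - (2 : ℝ) ^ (-(19 / 800) : ℝ) := by linarith
  refine ⟨C₀ + C₁ / (1 - 2 ^ (-(19 / 800) : ℝ)), by positivity, ?_⟩
  intro n T L σ a b g h g₁ h₁ g₂ h₂ hσ hL hn hd s hs hsT ν hν0 hν x t ht
  have hint : ∀ s, 1 ≤ s → s ≤ T → Integrable
      (fun ξ => wavePhase x t ξ * (timeSymbol c ν s ξ * g s ξ)) volume := fun s hs hsT =>
    integrable_wavePhase_mul x t ((hd.jet s ⟨by linarith, hsT⟩).mem.integrable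
      (isTest_truncSymbol hc (by linarith) (by linarith [one_le_freqBound hs])))
  have := le_of_dyadic_increments (q := 19 / 800) (T := T)
    (F := fun s => ‖∫ ξ, wavePhase x t ξ * (timeSymbol c ν s ξ * g s ξ)‖)
    (D := C₀ * |t| ^ (-(3 / 2) : ℝ) * L) (C := C₁ * |t| ^ (-(3 / 2) : ℝ) * L) (by positivity)
    (by norm_num) (fun s hs hs2 hsT => hbase hL hd s hs hs2 hsT ν hν0 hν x t ht)
    (fun s hs hsT => by
      have h1 := hstep hσ hL hn hd s hs hsT ν hν0 hν x t ht
      have hs0 : 0 < s := by linarith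
      rw [enorm_le_ofReal_iff (by positivity)] at h1
      simp only [mul_sub] at h1
      rw [integral_sub (hint (2 * s) (by linarith) hsT) (hint s hs (by linarith))] at h1
      have h3 := norm_le_norm_add_norm_sub' (∫ ξ, wavePhase x t ξ * (timeSymbol c ν (2 * s) ξ
        * g (2 * s) ξ)) (∫ ξ, wavePhase x t ξ * (timeSymbol c ν s ξ * g s ξ))
      exact h3.trans (add_le_add le_rfl h1)) hs hsT
  refine this.trans (le_of_eq ?_)
  ring

/-- The pointwise decay of a half wave of positive or negative frequency, in terms of the Fourier
transform `g t` of its profile. -/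
lemma exists_decay :
    ∃ C : ℝ, 0 < C ∧ ∀ {n T L σ : ℝ} {a b : ℝ → L2C} {g h : ℝ → E4 → ℂ}
      {g₁ h₁ : ℝ → Fin 4 → E4 → ℂ} {g₂ h₂ : ℝ → Fin 4 → Fin 4 → E4 → ℂ}, σ ^ 2 = 1 → 0 ≤ L →
      423 ≤ n → WaveData n T L σ a b g h g₁ h₁ g₂ h₂ → ∀ t ∈ Set.Icc 0 T,
      ∀ ν, 0 ≤ ν → ν ≤ 20 → ∀ (x : E4) (τ : ℝ), |τ| = t →
      ‖∫ ξ, wavePhase x τ ξ * ((bracketSymbol ν ξ : ℂ) * g t ξ)‖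
        ≤ C * bracket t ^ (-(3 / 2) : ℝ) * L := by
  obtain ⟨c, hc⟩ := exists_isCutoff
  obtain ⟨C₀, hC₀, hmain⟩ := exists_truncated_decay hc
  obtain ⟨C₁, hC₁, hrem⟩ := exists_eLpNorm_remainder_le
  set D : ℝ := (eLpNorm (bracketSymbol (-3)) 2 volume).toReal with hD
  have hD0 : 0 ≤ D := ENNReal.toReal_nonneg
  refine ⟨4 * (C₀ + 2 * C₁ + 2 * D), by positivity, ?_⟩
  intro n T L σ a b g h g₁ h₁ g₂ h₂ hσ hL hn hd t ht ν hν0 hν x τ hτ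
  have hint := hd.integrable_symbol hn ht hν
  have hbp := bracket_pos t
  have h4 : (2 : ℝ) ^ (-(3 / 2) : ℝ) * 4 ≥ 1 := by
    have : (2 : ℝ) ^ (-2 : ℝ) ≤ 2 ^ (-(3 / 2) : ℝ) :=
      rpow_le_rpow_of_exponent_le (by norm_num) (by norm_num)
    norm_num at this ⊢
    linarith
  -- For `t < 1` the oscillatory integral is bounded trivially; for `t ≥ 1` it is split into the
  -- truncated part and the remainder, for which `t^{-2} ⟨t⟩^{1/8}` is more than enough.
  rcases le_or_gt 1 t with h1 | h1
  · have ht0 : 0 < t := by linarith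
    have hb : t ^ (-(3 / 2) : ℝ) ≤ 4 * bracket t ^ (-(3 / 2) : ℝ) := by
      have hle : bracket t ≤ 2 * t := by
        unfold bracket
        rw [Real.sqrt_le_left (by linarith)]
        nlinarith
      have h5 : (2 * t) ^ (-(3 / 2) : ℝ) ≤ bracket t ^ (-(3 / 2) : ℝ) :=
        rpow_le_rpow_of_nonpos hbp hle (by norm_num)
      rw [mul_rpow (by norm_num) ht0.le] at h5
      nlinarith [rpow_pos_of_pos ht0 (-(3 / 2))]
    have hm := hmain hσ hL (by linarith) hd t h1 ht.2 ν hν0 hν x τ (by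
      rw [← abs_ne_zero, hτ]; exact ht0.ne')
    rw [hτ] at hm
    have hit : Integrable (fun ξ => timeSymbol c ν t ξ * g t ξ) volume :=
      (hd.jet t ht).mem.integrable
        (isTest_truncSymbol hc ht0 (by linarith [one_le_freqBound h1]))
    have hr : ‖∫ ξ, wavePhase x τ ξ * (((bracketSymbol ν ξ : ℂ) - timeSymbol c ν t ξ) * g t ξ)‖
        ≤ 2 * C₁ * t ^ (-(3 / 2) : ℝ) * L := by
      rw [← enorm_le_ofReal_iff (by positivity)]
      refine (enorm_integral_le_lintegral_enorm _).trans ?_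
      have e1 : ∀ ξ, ‖wavePhase x τ ξ * (((bracketSymbol ν ξ : ℂ) - timeSymbol c ν t ξ) * g t ξ)‖ₑ
          = ‖((bracketSymbol ν ξ : ℂ) - timeSymbol c ν t ξ) * g t ξ‖ₑ := fun ξ => by
        rw [← ofReal_norm, norm_mul, norm_wavePhase, one_mul, ofReal_norm]
      simp only [e1]
      have hVm : AEStronglyMeasurable (fun ξ => (Metric.closedBall (0 : E4) (3 / t)).indicator
          (fun _ => (3 : ℝ)) ξ + (3 * t ^ (-2 : ℝ)) * bracketSymbol (-3) ξ) volume :=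
        (aestronglyMeasurable_const.indicator Metric.isClosed_closedBall.measurableSet).add
          (memLp_bracketSymbol_neg_three.1.const_mul _)
      refine (lintegral_symbol_mul_le (n := n) hVm (hd.jet t ht).memLp.1
        (norm_symbol_sub_timeSymbol_le hc hν hn h1)).trans ?_
      refine (mul_le_mul' (hrem t h1) (hd.high t ht)).trans ?_
      rw [← ENNReal.ofReal_mul (by positivity)]
      refine ENNReal.ofReal_le_ofReal ?_
      calc C₁ * t ^ (-2 : ℝ) * (L * bracket t ^ (1 / 8 : ℝ))
          ≤ C₁ * t ^ (-2 : ℝ) * (L * (2 * t ^ (1 / 2 : ℝ))) := by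
            have e2 := bracket_rpow_le h1 ht0.le (by linarith : t ≤ 2 * t)
            have e3 : t ^ (1 / 8 : ℝ) ≤ t ^ (1 / 2 : ℝ) :=
              rpow_le_rpow_of_exponent_le h1 (by norm_num)
            gcongr
            linarith
        _ = 2 * C₁ * (t ^ (-2 : ℝ) * t ^ (1 / 2 : ℝ)) * L := by ring
        _ = _ := by rw [← rpow_add ht0]; norm_num
    have hsplit : ∫ ξ, wavePhase x τ ξ * ((bracketSymbol ν ξ : ℂ) * g t ξ)
        = (∫ ξ, wavePhase x τ ξ * (timeSymbol c ν t ξ * g t ξ))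
          + ∫ ξ, wavePhase x τ ξ * (((bracketSymbol ν ξ : ℂ) - timeSymbol c ν t ξ) * g t ξ) := by
      rw [← integral_add (integrable_wavePhase_mul x τ hit)
        (integrable_wavePhase_mul x τ ((hint.sub hit).congr (ae_of_all _ fun ξ => by
          simp only [Pi.sub_apply]; ring)))]
      exact integral_congr_ae (ae_of_all _ fun ξ => by ring)
    rw [hsplit]
    refine (norm_add_le _ _).trans ?_
    calc _ ≤ C₀ * t ^ (-(3 / 2) : ℝ) * L + 2 * C₁ * t ^ (-(3 / 2) : ℝ) * L := add_le_add hm hr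
      _ = (C₀ + 2 * C₁) * L * t ^ (-(3 / 2) : ℝ) := by ring
      _ ≤ (C₀ + 2 * C₁) * L * (4 * bracket t ^ (-(3 / 2) : ℝ)) := by gcongr
      _ ≤ _ := by
          have : 0 ≤ D * L * bracket t ^ (-(3 / 2) : ℝ) := by positivity
          nlinarith
  · have hb2 : bracket t ≤ 2 := by
      unfold bracket
      rw [Real.sqrt_le_left (by norm_num)]
      nlinarith [ht.1]
    have h5 : (2 : ℝ) ^ (-(3 / 2) : ℝ) ≤ bracket t ^ (-(3 / 2) : ℝ) :=
      rpow_le_rpow_of_nonpos hbp hb2 (by norm_num)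
    have h6 : bracket t ^ (1 / 8 : ℝ) ≤ 2 := by
      calc bracket t ^ (1 / 8 : ℝ) ≤ 2 ^ (1 / 8 : ℝ) := by gcongr
        _ ≤ 2 ^ (1 : ℝ) := by gcongr <;> norm_num
        _ = 2 := rpow_one 2
    have hle : ‖∫ ξ, wavePhase x τ ξ * ((bracketSymbol ν ξ : ℂ) * g t ξ)‖ ≤ D * (L * 2) := by
      rw [← enorm_le_ofReal_iff (by positivity)]
      refine (enorm_integral_le_lintegral_enorm _).trans ?_
      have e1 : ∀ ξ, ‖wavePhase x τ ξ * ((bracketSymbol ν ξ : ℂ) * g t ξ)‖ₑ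
          = ‖(bracketSymbol ν ξ : ℂ) * g t ξ‖ₑ := fun ξ => by
        rw [← ofReal_norm, norm_mul, norm_wavePhase, one_mul, ofReal_norm]
      simp only [e1]
      refine (hd.lintegral_symbol_le hn ht hν).trans ?_
      rw [ENNReal.ofReal_mul hD0, hD, ENNReal.ofReal_toReal memLp_bracketSymbol_neg_three.2.ne]
      gcongr
    refine hle.trans ?_
    have h7 : 1 ≤ 4 * bracket t ^ (-(3 / 2) : ℝ) := by linarith
    calc D * (L * 2) ≤ (C₀ + 2 * C₁ + 2 * D) * L * 1 := by nlinarith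
      _ ≤ (C₀ + 2 * C₁ + 2 * D) * L * (4 * bracket t ^ (-(3 / 2) : ℝ)) := by gcongr
      _ = _ := by ring

/-! ### The Fourier transforms of half waves and profiles -/

lemma hasTemperateGrowth_bracketSymbol (σ : ℝ) :
    (fun ξ => (bracketSymbol σ ξ : ℂ)).HasTemperateGrowth := by
  have h1 := (Function.hasTemperateGrowth_one_add_norm_sq_rpow E4 (σ / 2)).comp
    ((2 * π) • ContinuousLinearMap.id ℝ E4).hasTemperateGrowth
  exact Complex.ofRealCLM.hasTemperateGrowth.comp h1

lemma bracketD_apply (σ : ℝ) (f : L2C) (φ : 𝓢(E4, ℂ)) :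
    bracketD σ (f : 𝓢'(E4, ℂ)) φ = ∫ ξ, ((bracketSymbol σ ξ : ℂ) * (𝓕⁻ φ) ξ) * (𝓕 f : L2C) ξ := by
  have h := integral_mul_fourier f (SchwartzMap.smulLeftCLM ℂ
    (fun ξ => (bracketSymbol σ ξ : ℂ)) (𝓕⁻ φ))
  simp only [SchwartzMap.smulLeftCLM_apply_apply (hasTemperateGrowth_bracketSymbol σ),
    smul_eq_mul] at h
  rw [h]
  change (f : 𝓢'(E4, ℂ)) (𝓕 (SchwartzMap.smulLeftCLM ℂ (fun ξ => (bracketSymbol σ ξ : ℂ)) (𝓕⁻ φ)))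
    = _
  rw [Lp.toTemperedDistribution_apply]
  rfl

lemma continuous_ofReal_bracketSymbol (σ : ℝ) : Continuous fun ξ => (bracketSymbol σ ξ : ℂ) :=
  Complex.continuous_ofReal.comp (contDiff_bracketSymbol σ).continuous

/-- Plancherel's identity for the `H^σ` norm. -/
lemma eLpNorm_bracketSymbol_le_sobolevNorm (σ : ℝ) (f : L2C) :
    eLpNorm (fun ξ => (bracketSymbol σ ξ : ℂ) * (𝓕 f : L2C) ξ) 2 volume
      ≤ sobolevNorm σ 2 (f : 𝓢'(E4, ℂ)) := by
  refine le_iInf₂ fun G hG => ?_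
  have hae : (fun ξ => (bracketSymbol σ ξ : ℂ) * (𝓕 f : L2C) ξ) =ᵐ[volume] (𝓕 G : L2C) := by
    refine ae_eq_of_forall_schwartz ((locallyIntegrable_L2C (𝓕 f)).continuous_mul
      (continuous_ofReal_bracketSymbol σ)) (locallyIntegrable_L2C _) fun φ => ?_
    have h1 := DFunLike.congr_fun hG (𝓕 φ)
    rw [bracketD_apply, Lp.toTemperedDistribution_apply, fourierInv_fourier_eq] at h1
    rw [integral_mul_fourier]
    simp only [smul_eq_mul] at h1
    rw [← h1]
    exact integral_congr_ae (ae_of_all _ fun ξ => by ring)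
  rw [eLpNorm_congr_ae hae, ← Lp.enorm_def, enorm_le_iff_norm_le, Lp.norm_fourier_eq]

/-- The Fourier transform turns the multiplication by a coordinate into a derivative. -/
lemma fourier_coordMul_apply (j : Fin 4) (u : 𝓢'(E4, ℂ)) (φ : 𝓢(E4, ℂ)) :
    (2 * π * Complex.I) * (𝓕 (coordMul j u) : 𝓢'(E4, ℂ)) φ
      = (𝓕 u : 𝓢'(E4, ℂ)) (∂_{coordDir j} φ : 𝓢(E4, ℂ)) := by
  have ht : (fun y : E4 => inner ℝ y (coordDir j)).HasTemperateGrowth := by fun_prop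
  have ht' : (fun y : E4 => ((y j : ℝ) : ℂ)).HasTemperateGrowth := by
    have := ht
    simp only [inner_coordDir] at this
    fun_prop
  have h1 : SchwartzMap.smulLeftCLM ℂ (fun y : E4 => inner ℝ y (coordDir j)) (𝓕 φ)
      = SchwartzMap.smulLeftCLM ℂ (fun y : E4 => ((y j : ℝ) : ℂ)) (𝓕 φ) := by
    ext y
    rw [SchwartzMap.smulLeftCLM_apply_apply ht, SchwartzMap.smulLeftCLM_apply_apply ht',
      inner_coordDir, Complex.real_smul, smul_eq_mul]
  rw [TemperedDistribution.fourier_apply, TemperedDistribution.fourier_apply,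
    SchwartzMap.fourier_lineDerivOp_eq, h1, map_smul, smul_eq_mul]
  rfl

/-- A test function as a Schwartz function. -/
def IsTest.toSchwartz {φ : E4 → ℂ} (hφ : IsTest φ) : 𝓢(E4, ℂ) :=
  hφ.compact.toSchwartzMap hφ.smooth

lemma IsTest.lineDerivOp_toSchwartz {φ : E4 → ℂ} (hφ : IsTest φ) (v : E4) :
    (∂_{v} hφ.toSchwartz : 𝓢(E4, ℂ)) = (hφ.fderiv_apply v).toSchwartz := by
  ext ξ
  rw [SchwartzMap.lineDerivOp_apply_eq_fderiv]
  rfl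

lemma FourierEqOffZero.apply {u : 𝓢'(E4, ℂ)} {G : E4 → ℂ} (h : FourierEqOffZero u G) {φ : E4 → ℂ}
    (hφ : IsTest φ) : (𝓕 u : 𝓢'(E4, ℂ)) hφ.toSchwartz = ∫ ξ, φ ξ * G ξ :=
  h.2 hφ.toSchwartz hφ.compact hφ.zero_notMem

lemma FourierEqOffZero.aestronglyMeasurable {u : 𝓢'(E4, ℂ)} {G : E4 → ℂ}
    (h : FourierEqOffZero u G) : AEStronglyMeasurable G volume := by
  have := h.1.aestronglyMeasurable
  rwa [restrict_compl_singleton] at this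

lemma exists_fourierEqOffZero {s : ℝ} {u : 𝓢'(E4, ℂ)} {M : ℝ} (hM : 0 < M)
    (h : homSobolevNorm s u ≤ ENNReal.ofReal M) : ∃ G, FourierEqOffZero u G ∧
      eLpNorm (fun ξ : E4 => (((2 * π * ‖ξ‖) ^ s : ℝ) : ℂ) * G ξ) 2 volume
        ≤ ENNReal.ofReal (2 * M) := by
  have h1 : homSobolevNorm s u < ENNReal.ofReal (2 * M) :=
    h.trans_lt ((ENNReal.ofReal_lt_ofReal_iff (by linarith)).mpr (by linarith))
  unfold homSobolevNorm at h1
  simp only [iInf_lt_iff] at h1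
  obtain ⟨G, hG, hlt⟩ := h1
  exact ⟨G, hG, hlt.le⟩

/-- Moment bounds of `F` give weighted bounds for the weak derivatives of the Fourier transform
of `F` away from the origin. -/
lemma exists_hasJet (F : L2C) {M : ℝ} (hM : 0 < M)
    (h0 : eLpNorm (𝓕 F : L2C) 2 volume ≤ ENNReal.ofReal M)
    (h1 : ∀ j, homSobolevNorm 1 (coordMul j (F : 𝓢'(E4, ℂ))) ≤ ENNReal.ofReal M)
    (h2 : ∀ i j, homSobolevNorm 2 (coordMul i (coordMul j (F : 𝓢'(E4, ℂ)))) ≤ ENNReal.ofReal M) :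
    ∃ f₁ f₂, HasJet (𝓕 F : L2C) f₁ f₂ (2 * M) := by
  choose G hG hGn using fun j => exists_fourierEqOffZero hM (h1 j)
  choose H hH hHn using fun i j => exists_fourierEqOffZero hM (h2 i j)
  set k : ℂ := 2 * π * Complex.I with hk
  have hkn : ‖k‖ = 2 * π := by
    rw [hk]
    simp [abs_of_pos pi_pos]
  have hF : ∀ {φ : E4 → ℂ} (hφ : IsTest φ),
      (𝓕 (F : 𝓢'(E4, ℂ)) : 𝓢'(E4, ℂ)) hφ.toSchwartz = ∫ ξ, φ ξ * (𝓕 F : L2C) ξ := fun hφ => by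
    rw [Lp.fourier_toTemperedDistribution_eq, Lp.toTemperedDistribution_apply]
    rfl
  have n1 : ∀ j, eLpNorm (fun ξ => ((‖ξ‖ ^ 1 : ℝ) : ℂ) * (-(k * G j ξ))) 2 volume
      ≤ ENNReal.ofReal (2 * M) := fun j => by
    refine (eLpNorm_congr_norm_ae (ae_of_all _ fun ξ => ?_)).trans_le (hGn j)
    rw [norm_mul, norm_neg, norm_mul k, norm_mul _ (G j ξ), hkn, Complex.norm_real,
      Complex.norm_real, rpow_one,
      pow_one, norm_norm, Real.norm_of_nonneg (by positivity)]
    ring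
  have n2 : ∀ i j, eLpNorm (fun ξ => ((‖ξ‖ ^ 2 : ℝ) : ℂ) * (k ^ 2 * H i j ξ)) 2 volume
      ≤ ENNReal.ofReal (2 * M) := fun i j => by
    refine (eLpNorm_congr_norm_ae (ae_of_all _ fun ξ => ?_)).trans_le (hHn i j)
    rw [norm_mul, norm_mul _ (H i j ξ), norm_mul _ (H i j ξ), norm_pow, hkn, Complex.norm_real,
      Complex.norm_real, rpow_two,
      Real.norm_of_nonneg (by positivity), Real.norm_of_nonneg (by positivity)]
    ring
  have d1 : ∀ j, ∀ φ : E4 → ℂ, IsTest φ → ∫ ξ, fderiv ℝ φ ξ (coordDir j) * (𝓕 F : L2C) ξ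
      = k * ∫ ξ, φ ξ * G j ξ := fun j φ hφ => by
    rw [← hF (hφ.fderiv_apply (coordDir j)), ← hφ.lineDerivOp_toSchwartz, ← fourier_coordMul_apply,
      (hG j).apply hφ]
  have d2 : ∀ i j, ∀ φ : E4 → ℂ, IsTest φ → ∫ ξ, fderiv ℝ φ ξ (coordDir i) * G j ξ
      = k * ∫ ξ, φ ξ * H i j ξ := fun i j φ hφ => by
    rw [← (hG j).apply (hφ.fderiv_apply (coordDir i)), ← hφ.lineDerivOp_toSchwartz,
      ← fourier_coordMul_apply, (hH i j).apply hφ]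
  refine ⟨fun j ξ => -(k * G j ξ), fun i j ξ => k ^ 2 * H i j ξ, ?_, fun j => ⟨?_, ?_⟩,
    fun i j => ⟨?_, ?_⟩, fun j φ hφ => ?_, fun i j φ hφ => ?_, ?_, n1, n2⟩
  · simpa [MemWeight] using Lp.memLp (𝓕 F : L2C)
  · exact Continuous.aestronglyMeasurable (by fun_prop) |>.mul
      ((hG j).aestronglyMeasurable.const_mul k).neg
  · exact (n1 j).trans_lt ENNReal.ofReal_lt_top
  · exact Continuous.aestronglyMeasurable (by fun_prop) |>.mul
      ((hH i j).aestronglyMeasurable.const_mul _)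
  · exact (n2 i j).trans_lt ENNReal.ofReal_lt_top
  · rw [d1 j φ hφ, ← integral_const_mul, ← integral_neg]
    exact integral_congr_ae (ae_of_all _ fun ξ => by ring)
  · have e1 : ∫ ξ, fderiv ℝ φ ξ (coordDir i) * -(k * G j ξ)
        = -(k * ∫ ξ, fderiv ℝ φ ξ (coordDir i) * G j ξ) := by
      rw [← integral_const_mul, ← integral_neg]
      exact integral_congr_ae (ae_of_all _ fun ξ => by ring)
    have e2 : ∫ ξ, φ ξ * (k ^ 2 * H i j ξ) = k * (k * ∫ ξ, φ ξ * H i j ξ) := by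
      rw [← mul_assoc, ← integral_const_mul]
      exact integral_congr_ae (ae_of_all _ fun ξ => by ring)
    rw [e1, e2, d2 i j φ hφ]
  · refine le_trans ?_ (h0.trans (ENNReal.ofReal_le_ofReal (by linarith)))
    simp

lemma homSobolevNorm_le_firstMoment (F : L2C) (j : Fin 4) :
    homSobolevNorm 1 (coordMul j (F : 𝓢'(E4, ℂ))) ≤ firstMoment F := by
  unfold firstMoment
  rw [one_div, ENNReal.le_rpow_inv_iff (by norm_num), ENNReal.rpow_two]
  exact Finset.single_le_sum (f := fun j => homSobolevNorm 1 (coordMul j (F : 𝓢'(E4, ℂ))) ^ 2)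
    (fun _ _ => zero_le) (Finset.mem_univ j)

lemma homSobolevNorm_le_secondMoment (F : L2C) (i j : Fin 4) :
    homSobolevNorm 2 (coordMul i (coordMul j (F : 𝓢'(E4, ℂ)))) ≤ secondMoment F := by
  unfold secondMoment
  rw [one_div, ENNReal.le_rpow_inv_iff (by norm_num), ENNReal.rpow_two]
  exact (Finset.single_le_sum
    (f := fun j => homSobolevNorm 2 (coordMul i (coordMul j (F : 𝓢'(E4, ℂ)))) ^ 2)
    (fun _ _ => zero_le) (Finset.mem_univ j)).trans
    (Finset.single_le_sum
      (f := fun i => ∑ j, homSobolevNorm 2 (coordMul i (coordMul j (F : 𝓢'(E4, ℂ)))) ^ 2)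
      (fun _ _ => zero_le) (Finset.mem_univ i))

lemma fourier_multiplier {m : E4 → ℂ} {f : L2C} (h : InMultiplierDomain m f) :
    (𝓕 (multiplier m f) : L2C) =ᵐ[volume] fun ξ => m ((2 * π) • ξ) * (𝓕 f : L2C) ξ := by
  unfold multiplier
  rw [dif_pos h, fourier_fourierInv_eq]
  exact MemLp.coeFn_toLp h

lemma halfWaveSymbol_eq (τ : ℝ) (ξ : E4) : halfWaveSymbol τ ((2 * π) • ξ) = halfPhase τ ξ := by
  unfold halfWaveSymbol halfPhase radialVar
  rw [norm_smul, Real.norm_of_nonneg (by positivity), mul_assoc]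

lemma inMultiplierDomain_halfWaveSymbol (τ : ℝ) (f : L2C) :
    InMultiplierDomain (halfWaveSymbol τ) f := by
  unfold InMultiplierDomain
  simp only [halfWaveSymbol_eq]
  exact ((memLp_congr_norm ((continuous_halfPhase τ).aestronglyMeasurable.mul
    (Lp.memLp (𝓕 f : L2C)).1) (Lp.memLp (𝓕 f : L2C)).1
    (ae_of_all _ fun ξ => by rw [Pi.mul_apply, norm_mul, norm_halfPhase, one_mul]))).mpr (Lp.memLp _)

lemma fourier_profile (T : ℝ) (a : ℝ → L2R) (κ : ℤˣ) (t : ℝ) :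
    (𝓕 (profile T a κ t) : L2C) =ᵐ[volume]
      fun ξ => halfPhase (-((κ : ℤ) : ℝ) * t) ξ * (𝓕 (halfWave T a κ t) : L2C) ξ := by
  have := fourier_multiplier (inMultiplierDomain_halfWaveSymbol (-((κ : ℤ) : ℝ) * t)
    (halfWave T a κ t))
  simp only [halfWaveSymbol_eq] at this
  exact this

lemma invAbs_smul (ξ : E4) : invAbs ((2 * π) • ξ) = (radialVar ξ)⁻¹ := by
  unfold invAbs radialVar
  rw [norm_smul, Real.norm_of_nonneg (by positivity), Complex.ofReal_inv]

lemma fourier_halfWave {T : ℝ} {a : ℝ → L2R} {t : ℝ}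
    (h : InMultiplierDomain invAbs (toComplex (timeDeriv T a t))) (κ : ℤˣ) :
    (𝓕 (halfWave T a κ t) : L2C) =ᵐ[volume] fun ξ =>
      1 / 2 * ((𝓕 (toComplex (a t)) : L2C) ξ + (((κ : ℤ) : ℂ) * (-Complex.I)) *
        ((radialVar ξ)⁻¹ * (𝓕 (toComplex (timeDeriv T a t)) : L2C) ξ)) := by
  unfold halfWave
  rw [FourierTransform.fourier_smul, FourierTransform.fourier_add, FourierTransform.fourier_smul]
  set U : L2C := 𝓕 (toComplex (a t))
  set V : L2C := 𝓕 (multiplier invAbs (toComplex (timeDeriv T a t))) with hV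
  have hm := fourier_multiplier h
  rw [← hV] at hm
  filter_upwards [hm, Lp.coeFn_smul (1 / 2 : ℂ) (U + (((κ : ℤ) : ℂ) * (-Complex.I)) • V),
    Lp.coeFn_add U ((((κ : ℤ) : ℂ) * (-Complex.I)) • V),
    Lp.coeFn_smul (((κ : ℤ) : ℂ) * (-Complex.I)) V] with ξ e1 e2 e3 e4
  rw [e2, Pi.smul_apply, e3, Pi.add_apply, e4, Pi.smul_apply, e1, invAbs_smul]
  rfl

lemma sign_sq (κ : ℤˣ) : (((κ : ℤ) : ℝ)) ^ 2 = 1 := by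
  rcases Int.units_eq_one_or κ with rfl | rfl <;> simp

/-- The half waves of the field are the sum and the difference that diagonalize the pair `(A, ∂ₜA)`;
no equation for `A` is used. -/
lemma isWavePair_profile {T : ℝ} {a : ℝ → L2R} {t : ℝ}
    (h : InMultiplierDomain invAbs (toComplex (timeDeriv T a t))) (κ : ℤˣ) :
    IsWavePair ((κ : ℤ) : ℝ) t (𝓕 (toComplex (a t)) : L2C)
      (𝓕 (toComplex (timeDeriv T a t)) : L2C) (𝓕 (profile T a κ t) : L2C)
      (𝓕 (profile T a (-κ) t) : L2C) := by
  have hκ : (((κ : ℤ) : ℝ) : ℂ) ^ 2 = 1 := by exact_mod_cast sign_sq κ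
  have hne : ∀ᵐ ξ : E4, ξ ≠ 0 := by simp [ae_iff]
  have key : ∀ (κ : ℤˣ), ∀ᵐ ξ, halfPhase (((κ : ℤ) : ℝ) * t) ξ * (𝓕 (profile T a κ t) : L2C) ξ
      = 1 / 2 * ((𝓕 (toComplex (a t)) : L2C) ξ + (((κ : ℤ) : ℂ) * (-Complex.I)) *
        ((radialVar ξ)⁻¹ * (𝓕 (toComplex (timeDeriv T a t)) : L2C) ξ)) := fun κ => by
    filter_upwards [fourier_profile T a κ t, fourier_halfWave h κ] with ξ e1 e2
    rw [e1, ← e2, ← mul_assoc, mul_comm (halfPhase _ _), neg_mul, halfPhase_neg_mul, one_mul]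
  have k2 := key (-κ)
  have hs : (((-κ : ℤˣ) : ℤ) : ℝ) * t = -(((κ : ℤ) : ℝ) * t) := by push_cast; ring
  rw [hs] at k2
  constructor
  · filter_upwards [key κ, k2] with ξ e1 e2
    rw [e1, e2]
    push_cast
    ring
  · filter_upwards [key κ, k2, hne] with ξ e1 e2 h0
    have hr : radialVar ξ ≠ 0 := by
      unfold radialVar
      exact_mod_cast (by positivity : (0 : ℝ) < 2 * π * ‖ξ‖).ne'
    rw [e1, e2]
    push_cast at hκ ⊢
    field_simp
    linear_combination (2 * (𝓕 (toComplex (timeDeriv T a t)) : L2C) ξ) *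
      (-hκ + ((κ : ℤ) : ℂ) ^ 2 * Complex.I_sq)

lemma hasDerivWithinAt_fourier_toComplex {T : ℝ} {a : ℝ → L2R}
    (h : DifferentiableOn ℝ a (Set.Icc 0 T)) {t : ℝ} (ht : t ∈ Set.Icc 0 T) :
    HasDerivWithinAt (fun t => (𝓕 (toComplex (a t)) : L2C))
      (𝓕 (toComplex (timeDeriv T a t)) : L2C) (Set.Icc 0 T) t := by
  have h1 := (h t ht).hasDerivWithinAt
  let A : L2R →L[ℝ] L2C := Complex.ofRealCLM.compLpL 2 volume
  let B : L2C →L[ℝ] L2C :=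
    (Lp.fourierTransformₗᵢ E4 ℂ).toContinuousLinearEquiv.toContinuousLinearMap.restrictScalars
      ℝ
  exact (B.comp A).hasFDerivAt.comp_hasDerivWithinAt t h1

/-! ### Decay of the half waves -/

lemma continuous_wavePhase_uncurry : Continuous fun p : E4 × E4 => wavePhase p.1 0 p.2 := by
  unfold wavePhase; fun_prop

/-- The inverse Fourier transform of an integrable function, as a tempered distribution. -/
lemma integral_mul_integral_wavePhase {v : E4 → ℂ} (hv : Integrable v volume) (φ : 𝓢(E4, ℂ)) :
    ∫ x, φ x * ∫ ξ, wavePhase x 0 ξ * v ξ = ∫ ξ, (𝓕⁻ φ) ξ * v ξ := by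
  have h1 : ∀ ξ, (𝓕⁻ φ) ξ = ∫ x, wavePhase x 0 ξ * φ x := fun ξ => by
    rw [SchwartzMap.fourierInv_coe, Real.fourierInv_eq']
    refine integral_congr_ae (ae_of_all _ fun x => ?_)
    simp only [wavePhase, zero_mul, add_zero, smul_eq_mul]
    rw [mul_comm Complex.I]
  have hint : Integrable (Function.uncurry fun x ξ => φ x * (wavePhase x 0 ξ * v ξ))
      (volume.prod volume) := by
    refine (((φ.integrable (μ := volume)).mul_prod hv).bdd_mul (c := 1)
      continuous_wavePhase_uncurry.aestronglyMeasurable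
      (ae_of_all _ fun p => (norm_wavePhase _ _ _).le)).congr (ae_of_all _ fun p => ?_)
    simp only [Function.uncurry]
    ring
  calc ∫ x, φ x * ∫ ξ, wavePhase x 0 ξ * v ξ = ∫ x, ∫ ξ, φ x * (wavePhase x 0 ξ * v ξ) := by
        simp only [integral_const_mul]
    _ = ∫ ξ, ∫ x, φ x * (wavePhase x 0 ξ * v ξ) := integral_integral_swap hint
    _ = _ := by
        refine integral_congr_ae (ae_of_all _ fun ξ => ?_)
        simp only
        rw [h1, ← integral_mul_const]
        exact integral_congr_ae (ae_of_all _ fun x => by ring)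

lemma continuous_integral_wavePhase {v : E4 → ℂ} (hv : Integrable v volume) :
    Continuous fun x => ∫ ξ, wavePhase x 0 ξ * v ξ := by
  refine continuous_of_dominated (bound := fun ξ => ‖v ξ‖)
    (fun x => (integrable_wavePhase_mul x 0 hv).1)
    (fun x => ae_of_all _ fun ξ => by rw [norm_mul, norm_wavePhase, one_mul]) hv.norm
    (ae_of_all _ fun ξ => ?_)
  exact (continuous_wavePhase_uncurry.comp (by fun_prop : Continuous fun x : E4 => (x, ξ))).mul
    continuous_const

/-- If `⟨D⟩^ν f` has an integrable Fourier transform, then it is given by the pointwise inversion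
formula, so that a uniform bound of the oscillatory integrals bounds the `W^{ν,∞}` norm. -/
lemma sobolevNorm_top_le {f : L2C} {ν B : ℝ}
    (hv : Integrable (fun ξ => (bracketSymbol ν ξ : ℂ) * (𝓕 f : L2C) ξ) volume)
    (hB : ∀ x, ‖∫ ξ, wavePhase x 0 ξ * ((bracketSymbol ν ξ : ℂ) * (𝓕 f : L2C) ξ)‖ ≤ B) :
    sobolevNorm ν ⊤ (f : 𝓢'(E4, ℂ)) ≤ ENNReal.ofReal B := by
  set G : E4 → ℂ := fun x => ∫ ξ, wavePhase x 0 ξ * ((bracketSymbol ν ξ : ℂ) * (𝓕 f : L2C) ξ)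
  have hG : MemLp G ⊤ volume :=
    memLp_top_of_bound (continuous_integral_wavePhase hv).aestronglyMeasurable B (ae_of_all _ hB)
  have heq : bracketD ν (f : 𝓢'(E4, ℂ)) = (hG.toLp G : 𝓢'(E4, ℂ)) := by
    ext φ
    rw [bracketD_apply, Lp.toTemperedDistribution_apply]
    have h1 : ∫ x, φ x • (hG.toLp G) x = ∫ x, φ x * G x := by
      refine integral_congr_ae ?_
      filter_upwards [hG.coeFn_toLp] with x hx
      rw [hx, smul_eq_mul]
    rw [h1, integral_mul_integral_wavePhase hv]
    exact integral_congr_ae (ae_of_all _ fun ξ => by ring)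
  refine (iInf₂_le (hG.toLp G) heq).trans ?_
  rw [Lp.enorm_toLp, eLpNorm_exponent_top]
  refine eLpNormEssSup_le_of_ae_bound (ae_of_all _ hB)

lemma one_le_bracket (t : ℝ) : 1 ≤ bracket t :=
  Real.one_le_sqrt.mpr (by linarith [sq_nonneg t])

lemma le_of_weight_mul_le {p t X : ℝ} {Y : ℝ≥0∞} (hp : p ≤ 1 / 8) (hX : 0 ≤ X)
    (h : ENNReal.ofReal (bracket t ^ (-p)) * Y ≤ ENNReal.ofReal X) :
    Y ≤ ENNReal.ofReal (X * bracket t ^ (1 / 8 : ℝ)) := by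
  have hb := bracket_pos t
  calc Y = ENNReal.ofReal (bracket t ^ p) * (ENNReal.ofReal (bracket t ^ (-p)) * Y) := by
        rw [← mul_assoc, ← ENNReal.ofReal_mul (by positivity), ← rpow_add hb]
        simp
    _ ≤ ENNReal.ofReal (bracket t ^ (1 / 8 : ℝ)) * ENNReal.ofReal X := by
        gcongr
        exact one_le_bracket t
    _ = _ := by rw [mul_comm, ENNReal.ofReal_mul hX]

/-- All weights in the a priori norm are at least `⟨t⟩^{-1/8}`, because `β + δ ≤ 1/4`. -/
lemma sigmaNorm_bounds {n β δ T X : ℝ} {a : ℝ → L2R} (hX : 0 ≤ X) (hβδ : β + δ ≤ 1 / 4)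
    (h : sigmaNorm n β δ T a ≤ ENNReal.ofReal X) (κ : ℤˣ) {t : ℝ} (ht : t ∈ Set.Icc 0 T) :
    sobolevNorm n 2 (halfWave T a κ t : 𝓢'(E4, ℂ)) ≤ ENNReal.ofReal (X * bracket t ^ (1 / 8 : ℝ)) ∧
    firstMoment (profile T a κ t) ≤ ENNReal.ofReal (X * bracket t ^ (1 / 8 : ℝ)) ∧
    secondMoment (profile T a κ t) ≤ ENNReal.ofReal (X * bracket t ^ (1 / 8 : ℝ)) := by
  have h1 : sigmaNormSign n β δ T a κ ≤ ENNReal.ofReal X := by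
    refine le_trans ?_ h
    unfold sigmaNorm
    rcases Int.units_eq_one_or κ with rfl | rfl
    · exact le_self_add
    · exact le_add_self
  have h2 := (le_iSup₂ (f := fun t (_ : t ∈ Set.Icc 0 T) =>
    (ENNReal.ofReal (bracket t ^ (-β / 2 - δ / 2))
        * sobolevNorm n 2 (halfWave T a κ t : 𝓢'(E4, ℂ))
      + ENNReal.ofReal (bracket t ^ (-β / 2 - δ / 2)) * firstMoment (profile T a κ t)
      + ENNReal.ofReal (bracket t ^ (-(1 / 8 : ℝ))) * secondMoment (profile T a κ t))) t ht).trans h1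
  have hp : β / 2 + δ / 2 ≤ 1 / 8 := by linarith
  rw [show -β / 2 - δ / 2 = -(β / 2 + δ / 2) by ring] at h2
  exact ⟨le_of_weight_mul_le hp hX ((le_self_add.trans le_self_add).trans h2),
    le_of_weight_mul_le hp hX ((le_add_self.trans le_self_add).trans h2),
    le_of_weight_mul_le le_rfl hX (le_add_self.trans h2)⟩

lemma norm_fourier_profile (T : ℝ) (a : ℝ → L2R) (κ : ℤˣ) (t : ℝ) :
    ∀ᵐ ξ, ‖(𝓕 (profile T a κ t) : L2C) ξ‖ = ‖(𝓕 (halfWave T a κ t) : L2C) ξ‖ := by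
  filter_upwards [fourier_profile T a κ t] with ξ hξ
  rw [hξ, norm_mul, norm_halfPhase, one_mul]

/-- The a priori assumption provides the data for the decay estimate: the profile of sign `κ` paired
with the one of sign `-κ`. The factor `2` turns the bound of the infimum that defines a homogeneous
norm into a strict one, which has a witness. -/
lemma exists_waveData {n β δ T X : ℝ} {a : ℝ → L2R} (hn : 0 ≤ n) (hX : 0 < X)
    (hβδ : β + δ ≤ 1 / 4) (ha : HasHalfWaves T a)
    (h : sigmaNorm n β δ T a ≤ ENNReal.ofReal X) (κ : ℤˣ) :
    ∃ g₁ h₁ g₂ h₂, WaveData n T (2 * X) ((κ : ℤ) : ℝ) (fun t => 𝓕 (toComplex (a t)))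
      (fun t => 𝓕 (toComplex (timeDeriv T a t))) (fun t => (𝓕 (profile T a κ t) : L2C))
      (fun t => (𝓕 (profile T a (-κ) t) : L2C)) g₁ h₁ g₂ h₂ := by
  have hhigh : ∀ κ : ℤˣ, ∀ t ∈ Set.Icc 0 T,
      eLpNorm (fun ξ => (bracketSymbol n ξ : ℂ) * (𝓕 (profile T a κ t) : L2C) ξ) 2 volume
        ≤ ENNReal.ofReal (X * bracket t ^ (1 / 8 : ℝ)) := fun κ t ht => by
    refine le_trans (le_of_eq (eLpNorm_congr_norm_ae ?_))
      ((eLpNorm_bracketSymbol_le_sobolevNorm n (halfWave T a κ t)).trans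
        (sigmaNorm_bounds hX.le hβδ h κ ht).1)
    filter_upwards [norm_fourier_profile T a κ t] with ξ hξ
    rw [norm_mul, norm_mul, hξ]
  have hjet : ∀ κ : ℤˣ, ∀ t, ∃ f₁ f₂, t ∈ Set.Icc 0 T →
      HasJet (𝓕 (profile T a κ t) : L2C) f₁ f₂ (2 * X * bracket t ^ (1 / 8 : ℝ)) := fun κ t => by
    by_cases ht : t ∈ Set.Icc 0 T
    · obtain ⟨-, b1, b2⟩ := sigmaNorm_bounds hX.le hβδ h κ ht
      have h0 : eLpNorm (𝓕 (profile T a κ t) : L2C) 2 volume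
          ≤ ENNReal.ofReal (X * bracket t ^ (1 / 8 : ℝ)) := by
        refine (eLpNorm_mono fun ξ => ?_).trans (hhigh κ t ht)
        rw [norm_mul, Complex.norm_real, Real.norm_of_nonneg (bracketSymbol_pos n ξ).le]
        exact le_mul_of_one_le_left (norm_nonneg _)
          (one_le_rpow (one_le_bracketSymbol_base ξ) (by linarith))
      obtain ⟨f₁, f₂, hf⟩ := exists_hasJet (profile T a κ t)
        (mul_pos hX (rpow_pos_of_pos (bracket_pos t) _)) h0
        (fun j => (homSobolevNorm_le_firstMoment _ j).trans b1)
        (fun i j => (homSobolevNorm_le_secondMoment _ i j).trans b2)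
      exact ⟨f₁, f₂, fun _ => by rwa [mul_assoc]⟩
    · exact ⟨0, 0, fun h => absurd h ht⟩
  choose f₁ f₂ hf using hjet
  refine ⟨f₁ κ, f₁ (-κ), f₂ κ, f₂ (-κ), fun t ht => hf κ t ht, fun t ht => hf (-κ) t ht,
    fun t ht => (hhigh κ t ht).trans (ENNReal.ofReal_le_ofReal ?_),
    fun t ht => hasDerivWithinAt_fourier_toComplex ha.1 ht,
    fun t ht => isWavePair_profile (ha.2 t ht) κ⟩
  have : 0 ≤ X * bracket t ^ (1 / 8 : ℝ) := (mul_pos hX (rpow_pos_of_pos (bracket_pos t) _)).le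
  linarith

lemma wavePhase_eq (x : E4) (τ : ℝ) (ξ : E4) :
    wavePhase x τ ξ = wavePhase x 0 ξ * halfPhase τ ξ := by
  unfold wavePhase halfPhase radialVar
  rw [← Complex.exp_add]
  congr 1
  push_cast
  ring

end MaxwellDecay

end

theorem proposition2p5 (n : ℝ) (hn : 2 < n) (K : ℝ) (hK : 0 < K) :
    ∃ C : ℝ, 0 < C ∧
      ∀ β δ : ℝ, 0 < β → β < δ → 56 / (n - 2) ≤ β → β + δ ≤ 1 / 4 →
      ∀ ε₁ : ℝ, 0 < ε₁ → ∀ T : ℝ, 0 < T →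
      ∀ A : Fin 5 → ℝ → MaxwellDecay.L2R, ∀ μ : Fin 5,
        MaxwellDecay.HasHalfWaves T (A μ) →
        MaxwellDecay.sigmaNorm n β δ T (A μ) ≤ ENNReal.ofReal (K * ε₁) →
        ∀ κ : ℤˣ, ∀ s : ℝ, 0 ≤ s → s ≤ 20 → ∀ t ∈ Set.Icc 0 T,
          MaxwellDecay.sobolevNorm s ⊤
              (MaxwellDecay.halfWave T (A μ) κ t : TemperedDistribution MaxwellDecay.E4 ℂ)
            ≤ ENNReal.ofReal (C * MaxwellDecay.bracket t ^ (-(3 / 2) : ℝ) * ε₁) := by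
  open MaxwellDecay in
  obtain ⟨C, hC, hdecay⟩ := exists_decay
  refine ⟨2 * K * C, by positivity, ?_⟩
  intro β δ hβ hβδ hnβ hsum ε hε T _ A μ hA hbound κ s hs0 hs t ht
  -- The constraints on `β` and `δ` force `n > 450`.
  have hn' : 423 ≤ n := by
    have h1 : β < 1 / 8 := by linarith
    rw [div_le_iff₀ (by linarith)] at hnβ
    nlinarith
  have hX : 0 < K * ε := by positivity
  obtain ⟨g₁, h₁, g₂, h₂, hd⟩ := exists_waveData (by linarith) hX hsum hA hbound κ
  have hτ : |((κ : ℤ) : ℝ) * t| = t := by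
    rcases Int.units_eq_one_or κ with rfl | rfl <;> simp [abs_of_nonneg ht.1]
  have hae : ∀ᵐ ξ, (bracketSymbol s ξ : ℂ) * (𝓕 (halfWave T (A μ) κ t) : L2C) ξ
      = halfPhase (((κ : ℤ) : ℝ) * t) ξ *
        ((bracketSymbol s ξ : ℂ) * (𝓕 (profile T (A μ) κ t) : L2C) ξ) := by
    filter_upwards [fourier_profile T (A μ) κ t] with ξ hξ
    rw [hξ, neg_mul]
    linear_combination -((bracketSymbol s ξ : ℂ) * (𝓕 (halfWave T (A μ) κ t) : L2C) ξ) *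
      halfPhase_neg_mul (((κ : ℤ) : ℝ) * t) ξ
  have hint := hd.integrable_symbol hn' ht hs
  refine sobolevNorm_top_le ?_ fun x => ?_
  · exact (hint.bdd_mul (c := 1) (continuous_halfPhase _).aestronglyMeasurable
      (ae_of_all _ fun ξ => (norm_halfPhase _ _).le)).congr (hae.mono fun ξ hξ => hξ.symm)
  · have h1 := hdecay (sign_sq κ) (by positivity) hn' hd t ht s hs0 hs x _ hτ
    have h2 : ∫ ξ, wavePhase x 0 ξ * ((bracketSymbol s ξ : ℂ) * (𝓕 (halfWave T (A μ) κ t) : L2C) ξ)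
        = ∫ ξ, wavePhase x (((κ : ℤ) : ℝ) * t) ξ *
          ((bracketSymbol s ξ : ℂ) * (𝓕 (profile T (A μ) κ t) : L2C) ξ) := by
      refine integral_congr_ae ?_
      filter_upwards [hae] with ξ hξ
      rw [hξ, wavePhase_eq x (((κ : ℤ) : ℝ) * t)]
      ring
    rw [h2]
    refine h1.trans (le_of_eq ?_)
    ring
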